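/- Let $W$ be a finite Coxeter group with set of simple reflections $S$, set of reflections $T$, and length functions $\ell_S$ and $\ell_T$ with respect to the generating sets $S$ and $T$. Let $c$ be a standard Coxeter element, that is, a product of all the simple reflections, each used once, in some order. Let $\mathrm{NC}(W,c)=\{x\in W:\ell_T(x)+\ell_T(x^{-1}c)=\ell_T(c)\}$, ordered by $x\le_T y\iff \ell_T(x)+\ell_T(x^{-1}y)=\ell_T(y)$. To a maximal chain $\vec\pi=\{\pi_0<_T\pi_1<_T\cdots<_T\pi_r\}$ of $\mathrm{NC}(W,c)$ associate the word $t_1\cdots t_r$ in reflections with $t_i=\pi_{i-1}^{-1}\pi_i$. Two maximal chains are commutation equivalent if their words are related by a sequence of interchanges of adjacent commuting letters; the equivalence classes are called commutation classes. Let $\le_{\mathrm B}$ be the Bruhat order on $W$, and let $W_c^+=\{u\in W:\ell_S(uc)=\ell_S(u)+\ell_S(c)\}$. A maximal chain $\vec\pi$ is concordant with $u\in W_c^+$ if $u\pi_0\le_{\mathrm B}u\pi_1\le_{\mathrm B}\cdots\le_{\mathrm B}u\pi_r$. Let $\mathrm{Class}_c(u)$ be the set of commutation classes of maximal chains concordant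 with $u$. Fix a reduced word $\mathsf c$ in $S$ for $c$. Let $s_1s_2\cdots s_N$ be the lexicographically first subword of the infinite word $\mathsf{ccc}\cdots$ that is a reduced word for the long element of $W$, and let $\mathsf t$ be the word in reflections whose $i$-th letter is $s_1\cdots s_{i-1}s_is_{i-1}\cdots s_1$ $(1\le i\le N)$. Up to interchanges of adjacent commuting letters, $\mathsf t$ does not depend on the choice of $\mathsf c$. Every reflection occurs exactly once in $\mathsf t$. For $t,t'\in T$ write $t\preceq_c t'$ if $t=t'$ or $t$ appears to the left of $t'$ in every word obtained from $\mathsf t$ by interchanges of adjacent commuting letters. A maximal chain with word $t_1\cdots t_r$ is $\preceq_c$-increasing if there are no $i<j$ with $t_j\preceq_c t_i$, and $\preceq_c$-decreasing if there are no $i<j$ with $t_i\preceq_c t_j$. A commutation class is called $\preceq_c$-increasing (respectively, $\preceq_c$-decreasing) if it contains a $\preceq_c$-increasing (respectively, $\preceq_c$-decreasing) chain. Theorem. There is exactly one $\preceq_c$-increasing commutation class $\mathcal I_c$ of maximal chains of $\mathrm{NC}(W,c)$. For every $u\in W_c^+$, the set $\mathrm{Class}_c(u)$ contains $\mathcal I_c$,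 and it contains exactly one $\preceq_c$-decreasing class $\mathcal D_c(u)$. -/

import Mathlib

namespace CoxeterSystem

section Words

variable {G : Type*} [Group G]

/-- A single commutation move: two adjacent letters that commute in the group are interchanged. -/
inductive CommMove : List G → List G → Prop
  | swap (l₁ l₂ : List G) (s t : G) (h : s * t = t * s) :
      CommMove (l₁ ++ s :: t :: l₂) (l₁ ++ t :: s :: l₂)

/-- Two words are commutation equivalent if they are related by a sequence of commutation moves. -/
def CommEquiv : List G → List G → Prop :=
  Relation.EqvGen CommMove

/-- For a list `π₀, π₁, …, πₖ`, the word `t₁ ⋯ tₖ` with `tᵢ = πᵢ₋₁⁻¹ πᵢ`. -/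
def quotientWord (l : List G) : List G :=
  List.zipWith (fun x y => x⁻¹ * y) l l.tail

end Words

variable {B W : Type*} [Group W] {M : CoxeterMatrix B} (cs : CoxeterSystem M W)

/-- A standard Coxeter element: a product of all the simple reflections, each used exactly once,
in some order. -/
def IsStandardCoxeterElement (c : W) : Prop :=
  ∃ ω : List B, ω.Nodup ∧ (∀ i : B, i ∈ ω) ∧ cs.wordProd ω = c

/-- The reflection length `ℓ_T`: the least length of a word in the reflections representing `w`. -/
noncomputable def reflLength (w : W) : ℕ :=
  sInf {n | ∃ l : List W, (∀ t ∈ l, cs.IsReflection t) ∧ l.prod = w ∧ l.length = n}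

/-- The absolute order `x ≤_T y`: some geodesic from `1` to `y` in the right Cayley graph generated
by the reflections passes through `x`. -/
def AbsLE (x y : W) : Prop :=
  cs.reflLength x + cs.reflLength (x⁻¹ * y) = cs.reflLength y

/-- The underlying set of the noncrossing partition lattice `NC(W, c) = [1, c]_T`. -/
def noncrossing (c : W) : Set W :=
  {x | cs.AbsLE 1 x ∧ cs.AbsLE x c}

/-- A maximal chain of `NC(W, c)`, listed in strictly increasing order. -/
structure MaxChain (c : W) where
  /-- The elements `π₀, π₁, …, πᵣ` of the chain. -/
  elems : List W
  mem_noncrossing : ∀ x ∈ elems, x ∈ cs.noncrossing c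
  increasing : elems.Pairwise (fun x y => cs.AbsLE x y ∧ x ≠ y)
  maximal : ∀ x ∈ cs.noncrossing c,
    (∀ y ∈ elems, cs.AbsLE x y ∨ cs.AbsLE y x) → x ∈ elems

/-- The cover relation of the Bruhat order. -/
def BruhatCover (u v : W) : Prop :=
  cs.length v = cs.length u + 1 ∧ ∃ t, cs.IsReflection t ∧ v = u * t

/-- The Bruhat order. -/
def BruhatLE : W → W → Prop :=
  Relation.ReflTransGen cs.BruhatCover

/-- The set `W_c^+` of all `u` with `ℓ_S(uc) = ℓ_S(u) + ℓ_S(c)`. -/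
def plusSet (c : W) : Set W :=
  {u | cs.length (u * c) = cs.length u + cs.length c}

/-- `ω` is a reduced word in the simple reflections for `w`. -/
def IsReducedWordFor (ω : List B) (w : W) : Prop :=
  cs.IsReduced ω ∧ cs.wordProd ω = w

/-- The letters of the infinite word `ω ω ω ⋯` at a list of positions; the position `(k, i)` is
the `i`-th letter of the `k`-th copy of `ω`, and positions are ordered lexicographically. -/
def lettersAt (ω : List B) (P : List (ℕ ×ₗ Fin ω.length)) : List B :=
  P.map (fun p => ω.get (ofLex p).2)

/-- The word `η` is the lexicographically first subword of `ω ω ω ⋯` that is a reduced word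
for `w`; subwords are given by strictly increasing lists of positions. -/
def IsSortingWord (ω : List B) (w : W) (η : List B) : Prop :=
  ∃ P : List (ℕ ×ₗ Fin ω.length),
    IsLeast {Q | Q.Pairwise (· < ·) ∧ cs.IsReducedWordFor (lettersAt ω Q) w} P ∧
      lettersAt ω P = η

/-- The long element: its length is the number of reflections. -/
def IsLongElement (w : W) : Prop :=
  cs.length w = Nat.card {t : W // cs.IsReflection t}

/-- The partial order `t ⪯_c t'` on reflections: `t` is equal to `t'`, or `t` appears to the left
of `t'` in every word commutation equivalent to the inversion sequence of a `c`-sorting word of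
the long element. All reduced words `ω` for `c` are allowed here; the sorting words they
give are commutation equivalent to one another. -/
def SortLE (c t t' : W) : Prop :=
  t = t' ∨ ∀ (ω η : List B) (w₀ : W) (l : List W),
    cs.IsReducedWordFor ω c → cs.IsLongElement w₀ → cs.IsSortingWord ω w₀ η →
      CommEquiv (cs.leftInvSeq η) l → List.Sublist [t, t'] l

namespace MaxChain

variable {cs} {c : W}

/-- The reduced word in the reflections that corresponds to a maximal chain. -/
def reflWord (π : cs.MaxChain c) : List W :=
  quotientWord π.elems

/-- The chain `π` is concordant with `u`: `u π₀ ≤_B u π₁ ≤_B ⋯ ≤_B u πᵣ`. -/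
def Concordant (u : W) (π : cs.MaxChain c) : Prop :=
  (π.elems.map (fun x => u * x)).IsChain cs.BruhatLE

/-- There are no `i < j` with `tⱼ ⪯_c tᵢ`. -/
def IsIncreasing (π : cs.MaxChain c) : Prop :=
  π.reflWord.Pairwise (fun t t' => ¬ cs.SortLE c t' t)

/-- There are no `i < j` with `tᵢ ⪯_c tⱼ`. -/
def IsDecreasing (π : cs.MaxChain c) : Prop :=
  π.reflWord.Pairwise (fun t t' => ¬ cs.SortLE c t t')

end MaxChain

/-- Commutation equivalence of maximal chains. -/
def commSetoid (c : W) : Setoid (cs.MaxChain c) where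
  r π π' := CommEquiv π.reflWord π'.reflWord
  iseqv :=
    { refl := fun _ => Relation.EqvGen.refl _
      symm := fun h => Relation.EqvGen.symm _ _ h
      trans := fun h h' => Relation.EqvGen.trans _ _ _ h h' }

/-- The commutation classes of maximal chains of `NC(W, c)`. -/
def CommClass (c : W) : Type _ :=
  Quotient (cs.commSetoid c)

/-- The commutation class of a maximal chain. -/
def commClass {c : W} (π : cs.MaxChain c) : cs.CommClass c :=
  Quotient.mk (cs.commSetoid c) π

/-- The set of commutation classes of maximal chains concordant with `u`. -/
def concordantClasses (c u : W) : Set (cs.CommClass c) :=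
  {C | ∃ π : cs.MaxChain c, cs.commClass π = C ∧ π.Concordant u}

/-- A class is increasing if it is the class of an increasing chain. -/
def IsIncreasingClass {c : W} (C : cs.CommClass c) : Prop :=
  ∃ π : cs.MaxChain c, cs.commClass π = C ∧ π.IsIncreasing

/-- A class is decreasing if it is the class of a decreasing chain. Other chains in the class need
not be decreasing: two commuting reflections may be comparable for `⪯_c`. -/
def IsDecreasingClass {c : W} (C : cs.CommClass c) : Prop :=
  ∃ π : cs.MaxChain c, cs.commClass π = C ∧ π.IsDecreasing

end CoxeterSystem

/-! The theorem is translated into angles between positive roots. Since `ℓ_T(c)` is the rank `n`,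
maximal chains correspond to words `t₁ ⋯ tₙ` of reflections with product `c` (`IsFactorization`).
Let `β₁, …, βₙ` be the positive roots of the letters.

A word `ω` for `c` has a triangular Euler form `E` whose symmetrization is twice the invariant form,
and `E(x, y - c⁻¹y) = 2(x, y)` (`euler_sub_geom_inv`). It follows that the roots of a factorization
form an exceptional sequence: `E(βᵢ, βⱼ) = 0` for `i < j` (`pairwise_euler_eq_zero`). Hence the skew
form `E(x, y) - E(y, x)` equals `-2(βᵢ, βⱼ)` on such pairs. On the other hand, `t ⪯_c t'` for
noncommuting `t, t'` means exactly that the skew form is positive on their roots (`sortLE_iff`). So,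
up to commutations, the increasing factorizations are those with pairwise nonacute roots and the
decreasing ones those with pairwise nonobtuse roots. Both angle conditions are invariant under
commutations.

Nonacute case (`commEquiv_of_obtuse`). Write `c = sᵢ c'`. If `sᵢ` is a letter, it commutes to the
front and can be cancelled. Otherwise conjugation by `sᵢ` gives a nonacute factorization of `c' sᵢ`.
If letters never become available for cancellation, every `c⁻ᵏβ` is a positive root; the sum over a
period of `c` is fixed by `c`, hence zero, which is absurd. So only the word of simple reflections
remains, and it is concordant with every `u ∈ W_c⁺` because `u c` is a reduced product.

Nonobtuse case (`exists_isAcuteUp`). Concordance means that the path `u, u t₁, u t₁ t₂, …` goes up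
in length. With `c = sᵢ c'`, compare `u c sᵢ` with `u c`. If it is longer, `sᵢ` is not a letter and
conjugation by `sᵢ` passes to the pair `(c' sᵢ, u sᵢ)`. If it is shorter, `sᵢ` must be a letter,
commutes to the end, and its removal passes to `(c', u sᵢ)`. Both passages are reversible, so
existence and uniqueness follow by induction.

The description of `⪯_c` comes from greedy words. Alignment (`Aligned`) of an element with `ω`
survives both taking and skipping a letter. The core is `Aligned.apply_eq_zero`: if the first letter
is not a descent of an aligned element, it plays no role in the inversions of that element. The long
element is trivially aligned, so its sorting word lists the roots in skew order. -/

/-! ### The invariant form and the braid relations of the simple reflections -/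

namespace CoxeterMatrix

variable {B : Type*} [DecidableEq B]

/-- The simple root `αᵢ`, a basis vector of `B → ℝ`. -/
def simpleRoot (i : B) : B → ℝ := Pi.single i 1

theorem simpleRoot_apply (i j : B) : simpleRoot i j = if j = i then (1 : ℝ) else 0 := by
  simp [simpleRoot, Pi.single_apply]

@[simp] theorem simpleRoot_self (i : B) : simpleRoot i i = (1 : ℝ) := by
  simp [simpleRoot]

theorem simpleRoot_nonneg (i : B) : 0 ≤ simpleRoot i := by
  intro j
  rw [simpleRoot_apply]
  split <;> simp

variable [Fintype B] (M : CoxeterMatrix B)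

/-- The symmetric bilinear form with `(αᵢ, αⱼ) = -cos (π / Mᵢⱼ)`. -/
noncomputable def cosForm : LinearMap.BilinForm ℝ (B → ℝ) :=
  Matrix.toBilin' (Matrix.of fun i j => -Real.cos (Real.pi / M i j))

/-- The reflection in the simple root `αᵢ`. -/
noncomputable def simpleRefl (i : B) : Module.End ℝ (B → ℝ) :=
  LinearMap.id - (2 : ℝ) • (M.cosForm (simpleRoot i)).smulRight (simpleRoot i)

theorem cosForm_simpleRoot (i j : B) :
    M.cosForm (simpleRoot i) (simpleRoot j) = -Real.cos (Real.pi / M i j) := by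
  simp [cosForm, simpleRoot]

@[simp] theorem cosForm_simpleRoot_self (i : B) :
    M.cosForm (simpleRoot i) (simpleRoot i) = 1 := by
  simp [cosForm_simpleRoot]

theorem cosForm_simpleRoot_nonpos {i j : B} (h : i ≠ j) :
    M.cosForm (simpleRoot i) (simpleRoot j) ≤ 0 := by
  rw [cosForm_simpleRoot, neg_nonpos]
  have h1 := M.off_diagonal i j h
  rcases Nat.eq_zero_or_pos (M i j) with h0 | h0
  · simp [h0]
  · have h2 : (2 : ℝ) ≤ M i j := by exact_mod_cast (by omega : 2 ≤ M i j)
    apply Real.cos_nonneg_of_mem_Icc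
    constructor
    · have : 0 ≤ Real.pi / M i j := by positivity
      linarith [Real.pi_pos]
    · gcongr

theorem sum_smul_simpleRoot (x : B → ℝ) : ∑ i, x i • simpleRoot i = x := by
  ext j
  simp [simpleRoot_apply]

theorem cosForm_symm (x y : B → ℝ) : M.cosForm x y = M.cosForm y x := by
  simp only [cosForm, Matrix.toBilin'_apply, Matrix.of_apply]
  rw [Finset.sum_comm]
  refine Finset.sum_congr rfl fun i _ => Finset.sum_congr rfl fun j _ => ?_
  rw [M.symmetric i j]
  ring

theorem simpleRefl_apply (i : B) (x : B → ℝ) :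
    M.simpleRefl i x = x - (2 * M.cosForm (simpleRoot i) x) • simpleRoot i := by
  simp [simpleRefl, mul_smul]

theorem simpleRefl_simpleRefl (i : B) (x : B → ℝ) : M.simpleRefl i (M.simpleRefl i x) = x := by
  simp only [simpleRefl_apply, map_sub, map_smul, cosForm_simpleRoot_self]
  module

theorem cosForm_simpleRefl (i : B) (x y : B → ℝ) :
    M.cosForm (M.simpleRefl i x) (M.simpleRefl i y) = M.cosForm x y := by
  simp only [simpleRefl_apply, map_sub, map_smul, LinearMap.sub_apply, LinearMap.smul_apply,
    cosForm_simpleRoot_self, smul_eq_mul, M.cosForm_symm x (simpleRoot i)]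
  ring

/-- The coefficients of the roots of the dihedral subgroup generated by `sᵢ` and `sⱼ`. -/
theorem exists_dihedral_coeff {i j : B} (h : i ≠ j) :
    ∃ a : ℕ → ℝ, a 0 = 0 ∧ a 1 = 1 ∧
      (∀ k, a (k + 2) = -2 * M.cosForm (simpleRoot i) (simpleRoot j) * a (k + 1) - a k) ∧
      (∀ k, (M i j = 0 ∨ k ≤ M i j) → 0 ≤ a k) ∧
      (M i j ≠ 0 → a (2 * M i j) = 0 ∧ a (2 * M i j + 1) = 1 ∧
        M.cosForm (simpleRoot i) (simpleRoot j) ^ 2 ≠ 1) := by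
  rw [cosForm_simpleRoot]
  rcases Nat.eq_zero_or_pos (M i j) with h0 | h0
  -- The entry `0` encodes an infinite bond. Since division by zero gives `0`, the form takes the
  -- value `-cos 0 = -1`, and the recursion has the linear solution `k`.
  · refine ⟨fun k => k, by simp, by simp, fun k => ?_, fun k _ => by positivity,
      fun h => absurd h0 h⟩
    simp only [h0, Nat.cast_zero, div_zero, Real.cos_zero]
    push_cast
    ring
  · have h1 := M.off_diagonal i j h
    have h2 : (2 : ℝ) ≤ M i j := by exact_mod_cast (by omega : 2 ≤ M i j)
    set m : ℝ := ((M i j : ℕ) : ℝ) with hm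
    have hm0 : 0 < m := by linarith
    have hlt : Real.pi / m < Real.pi := div_lt_self Real.pi_pos (by linarith)
    have hs : 0 < Real.sin (Real.pi / m) := Real.sin_pos_of_pos_of_lt_pi (by positivity) hlt
    -- The Chebyshev recursion with factor `2 cos (π/m)` is solved by quotients of sines. They are
    -- nonnegative up to `k = m` and have period `2m`.
    refine ⟨fun k => Real.sin (k * (Real.pi / m)) / Real.sin (Real.pi / m), by simp,
      by simp [hs.ne'], fun k => ?_, fun k hk => ?_, fun _ => ⟨?_, ?_, ?_⟩⟩
    · field_simp
      push_cast
      have e1 : ((k : ℝ) + 2) * Real.pi / m = Real.pi * (k + 1) / m + Real.pi / m := by ring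
      have e2 : Real.pi * (k : ℝ) / m = Real.pi * (k + 1) / m - Real.pi / m := by ring
      rw [e1, e2, Real.sin_add, Real.sin_sub]
      ring
    · have hk : (k : ℝ) ≤ m := by
        rw [hm]
        exact_mod_cast hk.resolve_left h0.ne'
      refine div_nonneg (Real.sin_nonneg_of_nonneg_of_le_pi (by positivity) ?_) hs.le
      rw [mul_div_assoc', div_le_iff₀ hm0, mul_comm]
      exact mul_le_mul_of_nonneg_left hk Real.pi_pos.le
    · have : ((2 * M i j : ℕ) : ℝ) * (Real.pi / m) = 2 * Real.pi := by
        push_cast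
        field_simp
        rw [hm]
      simp only [this]
      simp
    · have : ((2 * M i j + 1 : ℕ) : ℝ) * (Real.pi / m) = Real.pi / m + 2 * Real.pi := by
        push_cast
        rw [← hm]
        field_simp
        ring
      simp only [this, Real.sin_add_two_pi, div_self hs.ne']
    · intro hc
      have := Real.sin_sq_add_cos_sq (Real.pi / m)
      nlinarith

theorem simpleRefl_dihedral {i j : B} {a : ℕ → ℝ}
    (ha : ∀ k, a (k + 2) = -2 * M.cosForm (simpleRoot i) (simpleRoot j) * a (k + 1) - a k)
    (k : ℕ) :
    M.simpleRefl j (a (k + 1) • simpleRoot i + a k • simpleRoot j) =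
      a (k + 1) • simpleRoot i + a (k + 2) • simpleRoot j := by
  simp only [simpleRefl_apply, map_add, map_smul, cosForm_simpleRoot_self,
    ha k, M.cosForm_symm (simpleRoot j) (simpleRoot i)]
  module

/-- In the plane of `αᵢ` and `αⱼ` the product of the two reflections shifts the coefficient sequence
`a` by two, so periodicity makes its power fix the plane. It also fixes everything orthogonal to
both roots. Plane and orthogonal vectors together span, because the Gram determinant `1 - b ^ 2` is
nonzero. -/
theorem isLiftable_simpleRefl : M.IsLiftable M.simpleRefl := by
  intro i j
  by_cases h : i = j
  · subst h
    refine LinearMap.ext fun x => ?_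
    simp [simpleRefl_simpleRefl]
  by_cases h0 : M i j = 0
  · simp [h0]
  obtain ⟨a, a0, a1, ha, -, h2⟩ := M.exists_dihedral_coeff h
  obtain ⟨p0, p1, hdet⟩ := h2 h0
  set b := M.cosForm (simpleRoot i) (simpleRoot j) with hb
  have hb' : M.cosForm (simpleRoot j) (simpleRoot i) = b := M.cosForm_symm _ _
  have ha' : ∀ k, a (k + 2) = -2 * M.cosForm (simpleRoot j) (simpleRoot i) * a (k + 1) - a k := by
    intro k; rw [hb']; exact ha k
  have step : ∀ k n, ((M.simpleRefl i * M.simpleRefl j) ^ n)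
      (a (k + 1) • simpleRoot i + a k • simpleRoot j) =
      a (k + 2 * n + 1) • simpleRoot i + a (k + 2 * n) • simpleRoot j := by
    intro k n
    induction n with
    | zero => simp
    | succ n ih =>
      rw [pow_succ', Module.End.mul_apply, ih, Module.End.mul_apply, M.simpleRefl_dihedral ha,
        add_comm, M.simpleRefl_dihedral ha', add_comm]
      rfl
  have per : ∀ k, a (k + 2 * M i j) = a k ∧ a (k + 2 * M i j + 1) = a (k + 1) := by
    intro k
    induction k with
    | zero => simp [p0, p1, a0, a1]
    | succ k ih =>
      have e : k + 1 + 2 * M i j = k + 2 * M i j + 1 := by ring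
      refine ⟨by rw [e, ih.2], ?_⟩
      rw [e]
      have := ha (k + 2 * M i j)
      rw [ih.1, ih.2, ← ha k] at this
      exact this
  have fix : ∀ k, ((M.simpleRefl i * M.simpleRefl j) ^ M i j)
      (a (k + 1) • simpleRoot i + a k • simpleRoot j) =
      a (k + 1) • simpleRoot i + a k • simpleRoot j := by
    intro k
    rw [step, (per k).1, (per k).2]
  have fixi : ((M.simpleRefl i * M.simpleRefl j) ^ M i j) (simpleRoot i) = simpleRoot i := by
    have := fix 0
    simpa [a0, a1] using this
  have fixj : ((M.simpleRefl i * M.simpleRefl j) ^ M i j) (simpleRoot j) = simpleRoot j := by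
    have := fix 1
    rw [map_add, map_smul, map_smul, fixi, a1, one_smul, one_smul] at this
    exact add_left_cancel this
  have fixo : ∀ (z : B → ℝ) (n : ℕ), M.cosForm (simpleRoot i) z = 0 →
      M.cosForm (simpleRoot j) z = 0 → ((M.simpleRefl i * M.simpleRefl j) ^ n) z = z := by
    intro z n hi hj
    induction n with
    | zero => simp
    | succ n ih =>
      rw [pow_succ', Module.End.mul_apply, ih, Module.End.mul_apply, simpleRefl_apply M j, hj]
      simp [simpleRefl_apply, hi]
  have hdet' : 1 - b ^ 2 ≠ 0 := fun h => hdet (by linarith)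
  refine LinearMap.ext fun z => ?_
  obtain ⟨x, y, hx, hy⟩ : ∃ x y : ℝ,
      M.cosForm (simpleRoot i) (z - (x • simpleRoot i + y • simpleRoot j)) = 0 ∧
      M.cosForm (simpleRoot j) (z - (x • simpleRoot i + y • simpleRoot j)) = 0 := by
    set p := M.cosForm (simpleRoot i) z
    set q := M.cosForm (simpleRoot j) z
    refine ⟨(p - b * q) / (1 - b ^ 2), (q - b * p) / (1 - b ^ 2), ?_, ?_⟩
    · simp only [map_sub, map_add, map_smul, cosForm_simpleRoot_self, ← hb, smul_eq_mul]
      field_simp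
      ring
    · simp only [map_sub, map_add, map_smul, cosForm_simpleRoot_self, hb', smul_eq_mul]
      field_simp
      ring
  have hz := fixo _ (M i j) hx hy
  rw [map_sub, map_add, map_smul, map_smul, fixi, fixj] at hz
  simpa using hz

end CoxeterMatrix

/-! ### The geometric representation and the positivity of its roots -/

namespace CoxeterSystem

open CoxeterMatrix

variable {B W : Type*} [Group W] {M : CoxeterMatrix B} (cs : CoxeterSystem M W)
variable [Fintype B] [DecidableEq B]

/-- The geometric representation. -/
noncomputable def geom : W →* Module.End ℝ (B → ℝ) :=
  cs.lift ⟨M.simpleRefl, M.isLiftable_simpleRefl⟩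

theorem geom_simple (i : B) : cs.geom (cs.simple i) = M.simpleRefl i :=
  cs.lift_apply_simple M.isLiftable_simpleRefl i

theorem geom_simple_apply (i : B) (x : B → ℝ) :
    cs.geom (cs.simple i) x = x - (2 * M.cosForm (simpleRoot i) x) • simpleRoot i := by
  rw [geom_simple, simpleRefl_apply]

theorem geom_mul_apply (v w : W) (x : B → ℝ) :
    cs.geom (v * w) x = cs.geom v (cs.geom w x) := by
  rw [map_mul, Module.End.mul_apply]

@[simp] theorem geom_one_apply (x : B → ℝ) : cs.geom 1 x = x := by
  rw [map_one, Module.End.one_apply]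

@[simp] theorem geom_inv_geom (w : W) (x : B → ℝ) : cs.geom w⁻¹ (cs.geom w x) = x := by
  rw [← geom_mul_apply, inv_mul_cancel, geom_one_apply]

@[simp] theorem geom_geom_inv (w : W) (x : B → ℝ) : cs.geom w (cs.geom w⁻¹ x) = x := by
  rw [← geom_mul_apply, mul_inv_cancel, geom_one_apply]

theorem cosForm_geom (w : W) (x y : B → ℝ) :
    M.cosForm (cs.geom w x) (cs.geom w y) = M.cosForm x y := by
  induction w using cs.simple_induction_left with
  | one => simp
  | mul_simple_left w i ih =>
    rw [geom_mul_apply, geom_mul_apply, geom_simple, cosForm_simpleRefl, ih]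

theorem geom_simple_simpleRoot (i : B) :
    cs.geom (cs.simple i) (simpleRoot i) = -simpleRoot i := by
  rw [geom_simple_apply, cosForm_simpleRoot_self]
  module

theorem geom_alternatingWord {i j : B} {a : ℕ → ℝ} (a0 : a 0 = 0) (a1 : a 1 = 1)
    (ha : ∀ k, a (k + 2) = -2 * M.cosForm (simpleRoot i) (simpleRoot j) * a (k + 1) - a k)
    (k : ℕ) :
    cs.geom (cs.wordProd (alternatingWord i j k)) (simpleRoot i) =
      if Even k then a (k + 1) • simpleRoot i + a k • simpleRoot j
      else a k • simpleRoot i + a (k + 1) • simpleRoot j := by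
  have ha' : ∀ k, a (k + 2) = -2 * M.cosForm (simpleRoot j) (simpleRoot i) * a (k + 1) - a k := by
    intro k; rw [M.cosForm_symm]; exact ha k
  induction k with
  | zero => simp [alternatingWord, a0, a1]
  | succ k ih =>
    rw [alternatingWord_succ', wordProd_cons, geom_mul_apply, ih]
    by_cases hk : Even k
    · simp only [hk, if_true, Nat.even_add_one, not_true, if_false, geom_simple,
        M.simpleRefl_dihedral ha]
    · simp only [hk, if_false, Nat.even_add_one, not_false_iff, if_true, geom_simple]
      rw [add_comm, M.simpleRefl_dihedral ha', add_comm]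

/-- Choose a right descent `j` of `w` and split off the longest alternating word in `i, j`, ending
in `j`, with lengths adding up: `w = v d`. By maximality and reducedness neither `i` nor `j` is a
descent of `v`, so induction applies to `v` and both roots. Since `w sᵢ` is longer than `w`, the
word `d` is shorter than the bond `M i j`, and `d αᵢ` has nonnegative dihedral coefficients. -/
theorem geom_simpleRoot_nonneg_aux (n : ℕ) : ∀ (w : W) (i : B), cs.length w ≤ n →
    cs.length w < cs.length (w * cs.simple i) → 0 ≤ cs.geom w (simpleRoot i) := by
  induction n with
  | zero =>
    intro w i hw _
    have : w = 1 := cs.length_eq_zero_iff.mp (by omega)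
    subst this
    rw [geom_one_apply]
    exact simpleRoot_nonneg i
  | succ n ih =>
    intro w i hw hi
    by_cases h1 : w = 1
    · subst h1
      rw [geom_one_apply]
      exact simpleRoot_nonneg i
    obtain ⟨j, hj⟩ := cs.exists_rightDescent_of_ne_one h1
    have hij : i ≠ j := by
      rintro rfl
      unfold IsRightDescent at hj
      omega
    have hj' := cs.isRightDescent_iff.mp hj
    classical
    let p : ℕ → Prop := fun k => ∃ v, w = v * cs.wordProd (alternatingWord i j k) ∧
      cs.length w = cs.length v + k
    have hp1 : p 1 := by
      refine ⟨w * cs.simple j, by simp [alternatingWord], hj'.symm⟩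
    have hb : ∀ k, p k → k ≤ cs.length w := by
      rintro k ⟨v, -, h⟩
      omega
    set k := Nat.findGreatest p (cs.length w) with hk
    have hpk : p k := Nat.findGreatest_spec (hb 1 hp1) hp1
    have hk1 : 1 ≤ k := Nat.le_findGreatest (hb 1 hp1) hp1
    have hmax : ¬ p (k + 1) := fun h =>
      absurd (Nat.le_findGreatest (hb _ h) h) (by omega)
    obtain ⟨v, hv, hlen⟩ := hpk
    clear_value k
    have hfirst : ∀ q : B, q = (if Even k then j else i) →
        cs.length v < cs.length (v * cs.simple q) := by
      intro q hq
      by_contra hcon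
      have hd : cs.IsRightDescent v q := by
        have := cs.length_mul_simple_ne v q
        unfold IsRightDescent
        omega
      have hd' := cs.isRightDescent_iff.mp hd
      refine hmax ⟨v * cs.simple q, ?_, by omega⟩
      rw [alternatingWord_succ', wordProd_cons, ← hq, hv, mul_assoc,
        simple_mul_simple_cancel_left]
    have hsecond : ∀ q : B, q = (if Even k then i else j) →
        cs.length v < cs.length (v * cs.simple q) := by
      intro q hq
      obtain ⟨k', rfl⟩ : ∃ k', k = k' + 1 := ⟨k - 1, by omega⟩
      have e : w = v * cs.simple q * cs.wordProd (alternatingWord i j k') := by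
        rw [hv, alternatingWord_succ', wordProd_cons, hq]
        by_cases he : Even k'
        · simp [he, Nat.even_add_one, mul_assoc]
        · simp [he, Nat.even_add_one, mul_assoc]
      have h1 := cs.length_mul_le (v * cs.simple q) (cs.wordProd (alternatingWord i j k'))
      have h2 := cs.length_wordProd_le (alternatingWord i j k')
      rw [length_alternatingWord] at h2
      rw [← e] at h1
      omega
    have hvi : 0 ≤ cs.geom v (simpleRoot i) := by
      refine ih v i (by omega) ?_
      by_cases he : Even k
      · exact hsecond i (by simp [he])
      · exact hfirst i (by simp [he])
    have hvj : 0 ≤ cs.geom v (simpleRoot j) := by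
      refine ih v j (by omega) ?_
      by_cases he : Even k
      · exact hfirst j (by simp [he])
      · exact hsecond j (by simp [he])
    obtain ⟨a, a0, a1, ha, hpos, -⟩ := M.exists_dihedral_coeff hij
    have hkm : M i j = 0 ∨ k + 1 ≤ M i j := by
      by_contra hcon
      push Not at hcon
      refine cs.not_isReduced_alternatingWord j i (m := k + 1)
        (by rw [M.symmetric]; exact hcon.1) (by rw [M.symmetric]; omega) ?_
      have e : w * cs.simple i = v * cs.wordProd (alternatingWord j i (k + 1)) := by
        rw [alternatingWord_succ, wordProd_concat, hv, mul_assoc]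
      have h1 := cs.length_mul_le v (cs.wordProd (alternatingWord j i (k + 1)))
      have h2 := cs.length_wordProd_le (alternatingWord j i (k + 1))
      rw [← e] at h1
      unfold IsReduced
      rw [length_alternatingWord] at *
      omega
    have hak : 0 ≤ a k := hpos k (by omega)
    have hak1 : 0 ≤ a (k + 1) := hpos (k + 1) hkm
    rw [hv, geom_mul_apply, cs.geom_alternatingWord a0 a1 ha]
    split
    · rw [map_add, map_smul, map_smul]
      exact add_nonneg (smul_nonneg hak1 hvi) (smul_nonneg hak hvj)
    · rw [map_add, map_smul, map_smul]
      exact add_nonneg (smul_nonneg hak hvi) (smul_nonneg hak1 hvj)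

theorem geom_simpleRoot_nonneg {w : W} {i : B}
    (h : cs.length w < cs.length (w * cs.simple i)) : 0 ≤ cs.geom w (simpleRoot i) :=
  cs.geom_simpleRoot_nonneg_aux _ w i le_rfl h

theorem geom_simpleRoot_nonpos {w : W} {i : B}
    (h : cs.length (w * cs.simple i) < cs.length w) : cs.geom w (simpleRoot i) ≤ 0 := by
  have := cs.geom_simpleRoot_nonneg (w := w * cs.simple i) (i := i) (by simpa using h)
  rw [geom_mul_apply, geom_simple_simpleRoot, map_neg] at this
  exact neg_nonneg.mp this

end CoxeterSystem

/-! ### Roots, reflections and inversions -/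

namespace CoxeterSystem

open CoxeterMatrix

variable {B W : Type*} [Group W] {M : CoxeterMatrix B} (cs : CoxeterSystem M W)
variable {cs}

theorem IsReflection.conj_simple {t : W} (ht : cs.IsReflection t) (i : B) :
    cs.IsReflection (cs.simple i * t * cs.simple i) := by
  have := ht.conj (cs.simple i)
  rwa [inv_simple] at this

theorem conj_simple_ne {t : W} {i : B} (h : t ≠ cs.simple i) :
    cs.simple i * t * cs.simple i ≠ cs.simple i := by
  intro h'
  apply h
  have h2 : cs.simple i * (cs.simple i * t * cs.simple i) * cs.simple i =
      cs.simple i * cs.simple i * cs.simple i := by rw [h']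
  simpa [mul_assoc] using h2

variable [Fintype B] [DecidableEq B]

variable (cs)

/-- A root is an image of a simple root under the geometric representation. -/
def IsRoot (β : B → ℝ) : Prop := ∃ w i, β = cs.geom w (simpleRoot i)

theorem isRoot_simpleRoot (i : B) : cs.IsRoot (simpleRoot i) := ⟨1, i, by simp⟩

variable {cs}

theorem IsRoot.geom {β : B → ℝ} (h : cs.IsRoot β) (w : W) : cs.IsRoot (cs.geom w β) := by
  obtain ⟨v, i, rfl⟩ := h
  exact ⟨w * v, i, by rw [geom_mul_apply]⟩

theorem IsRoot.cosForm_self {β : B → ℝ} (h : cs.IsRoot β) : M.cosForm β β = 1 := by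
  obtain ⟨w, i, rfl⟩ := h
  rw [cosForm_geom, cosForm_simpleRoot_self]

theorem IsRoot.ne_zero {β : B → ℝ} (h : cs.IsRoot β) : β ≠ 0 := by
  rintro rfl
  simpa using h.cosForm_self

theorem IsRoot.nonneg_or_nonpos {β : B → ℝ} (h : cs.IsRoot β) : 0 ≤ β ∨ β ≤ 0 := by
  obtain ⟨w, i, rfl⟩ := h
  rcases lt_or_gt_of_ne (cs.length_mul_simple_ne w i) with h | h
  · exact Or.inr (cs.geom_simpleRoot_nonpos h)
  · exact Or.inl (cs.geom_simpleRoot_nonneg h)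

theorem IsRoot.not_nonpos {β : B → ℝ} (h : cs.IsRoot β) (h0 : 0 ≤ β) : ¬ β ≤ 0 :=
  fun h1 => h.ne_zero (le_antisymm h1 h0)

theorem IsRoot.not_nonpos_iff {β : B → ℝ} (h : cs.IsRoot β) : ¬ β ≤ 0 ↔ 0 ≤ β :=
  ⟨fun h1 => h.nonneg_or_nonpos.resolve_right h1, h.not_nonpos⟩

theorem IsRoot.not_nonneg_iff {β : B → ℝ} (h : cs.IsRoot β) : ¬ 0 ≤ β ↔ β ≤ 0 :=
  ⟨fun h1 => h.nonneg_or_nonpos.resolve_left h1, fun h1 h0 => h.not_nonpos h0 h1⟩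

theorem eq_simpleRoot_of_nonneg {β : B → ℝ} (h : M.cosForm β β = 1) (h0 : 0 ≤ β) {i : B}
    (hi : ∀ j, j ≠ i → β j = 0) : β = simpleRoot i := by
  have e : β = β i • simpleRoot i := by
    ext j
    by_cases hj : j = i
    · subst hj; simp
    · simp [hi j hj, simpleRoot_apply, hj]
  have h1 : β i * β i = 1 := by
    rw [e] at h
    simpa using h
  have h2 : β i = 1 := by
    have := h0 i
    simp only [Pi.zero_apply] at this
    nlinarith
  rw [e, h2, one_smul]

theorem geom_simple_apply_of_ne {i j : B} (h : j ≠ i) (x : B → ℝ) :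
    cs.geom (cs.simple i) x j = x j := by
  simp [geom_simple_apply, simpleRoot_apply, h]

/-- A simple reflection changes only the `i`-th coordinate, so a positive root that it makes
negative is supported on `i`. -/
theorem IsRoot.geom_simple_nonneg {β : B → ℝ} (h : cs.IsRoot β) (h0 : 0 ≤ β) {i : B}
    (hi : β ≠ simpleRoot i) : 0 ≤ cs.geom (cs.simple i) β := by
  by_contra hcon
  rw [(h.geom _).not_nonneg_iff] at hcon
  refine hi (eq_simpleRoot_of_nonneg h.cosForm_self h0 fun j hj => ?_)
  have := hcon j
  rw [geom_simple_apply_of_ne hj] at this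
  exact le_antisymm this (h0 j)

theorem geom_conj_simple (w : W) (i : B) (x : B → ℝ) :
    cs.geom (w * cs.simple i * w⁻¹) x =
      x - (2 * M.cosForm (cs.geom w (simpleRoot i)) x) • cs.geom w (simpleRoot i) := by
  rw [geom_mul_apply, geom_mul_apply, geom_simple_apply, map_sub, map_smul, geom_geom_inv,
    ← cs.cosForm_geom w, geom_geom_inv]

theorem IsReflection.exists_root {t : W} (ht : cs.IsReflection t) :
    ∃ β : B → ℝ, 0 ≤ β ∧ ∃ w i, t = w * cs.simple i * w⁻¹ ∧ β = cs.geom w (simpleRoot i) := by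
  obtain ⟨w, i, rfl⟩ := ht
  rcases (show cs.IsRoot _ from ⟨w, i, rfl⟩).nonneg_or_nonpos with h | h
  · exact ⟨_, h, w, i, rfl, rfl⟩
  · refine ⟨-cs.geom w (simpleRoot i), neg_nonneg.mpr h, w * cs.simple i, i, ?_, ?_⟩
    · simp [mul_assoc]
    · rw [geom_mul_apply, geom_simple_simpleRoot, map_neg]

open Classical in
variable (cs) in
/-- The positive root of a reflection. -/
noncomputable def root (t : W) : B → ℝ :=
  if ht : cs.IsReflection t then ht.exists_root.choose else 0

theorem IsReflection.root_spec {t : W} (ht : cs.IsReflection t) :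
    0 ≤ cs.root t ∧ ∃ w i, t = w * cs.simple i * w⁻¹ ∧ cs.root t = cs.geom w (simpleRoot i) := by
  rw [root, dif_pos ht]
  exact ht.exists_root.choose_spec

theorem IsReflection.root_nonneg {t : W} (ht : cs.IsReflection t) : 0 ≤ cs.root t :=
  ht.root_spec.1

theorem IsReflection.isRoot_root {t : W} (ht : cs.IsReflection t) : cs.IsRoot (cs.root t) := by
  obtain ⟨w, i, -, h⟩ := ht.root_spec.2
  exact ⟨w, i, h⟩

theorem IsReflection.cosForm_root_self {t : W} (ht : cs.IsReflection t) :
    M.cosForm (cs.root t) (cs.root t) = 1 :=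
  ht.isRoot_root.cosForm_self

theorem IsReflection.geom_apply {t : W} (ht : cs.IsReflection t) (x : B → ℝ) :
    cs.geom t x = x - (2 * M.cosForm (cs.root t) x) • cs.root t := by
  obtain ⟨w, i, h, h'⟩ := ht.root_spec.2
  rw [h']
  conv_lhs => rw [h]
  rw [geom_conj_simple]

theorem IsReflection.geom_root {t : W} (ht : cs.IsReflection t) :
    cs.geom t (cs.root t) = -cs.root t := by
  rw [ht.geom_apply, ht.cosForm_root_self]
  module

theorem IsReflection.root_eq {t : W} (ht : cs.IsReflection t) {β : B → ℝ} (h0 : 0 ≤ β)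
    (h1 : M.cosForm β β = 1) (h : cs.geom t β = -β) : cs.root t = β := by
  rw [ht.geom_apply] at h
  set k := M.cosForm (cs.root t) β
  have e : β = k • cs.root t := by
    have h2 : (2 : ℝ) • β = (2 : ℝ) • (k • cs.root t) := by
      rw [smul_smul, two_smul, ← sub_eq_zero]
      rw [← sub_eq_zero] at h
      rw [← h]
      abel
    exact smul_right_injective _ (two_ne_zero) h2
  have hk : k * k = 1 := by
    rw [e] at h1
    simpa [ht.cosForm_root_self] using h1
  have hk' : k = 1 := by
    rcases mul_self_eq_one_iff.mp hk with h | h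
    · exact h
    · rw [h, neg_one_smul] at e
      rw [e] at h0
      exact absurd (neg_nonneg.mp h0) (ht.isRoot_root.not_nonpos ht.root_nonneg)
  rw [e, hk', one_smul]

@[simp] theorem root_simple (i : B) : cs.root (cs.simple i) = simpleRoot i :=
  (cs.isReflection_simple i).root_eq (simpleRoot_nonneg i) (cosForm_simpleRoot_self M i)
    (cs.geom_simple_simpleRoot i)

theorem IsRoot.exists_root_eq {β : B → ℝ} (h : cs.IsRoot β) (h0 : 0 ≤ β) :
    ∃ t, cs.IsReflection t ∧ cs.root t = β := by
  obtain ⟨w, i, rfl⟩ := h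
  have ht : cs.IsReflection (w * cs.simple i * w⁻¹) := ⟨w, i, rfl⟩
  refine ⟨_, ht, ht.root_eq h0 (by rw [cosForm_geom, cosForm_simpleRoot_self]) ?_⟩
  rw [geom_mul_apply, geom_mul_apply, geom_inv_geom, geom_simple_simpleRoot, map_neg]

theorem IsReflection.root_conj {t : W} (ht : cs.IsReflection t) {w : W}
    (h0 : 0 ≤ cs.geom w (cs.root t)) : cs.root (w * t * w⁻¹) = cs.geom w (cs.root t) := by
  refine (ht.conj w).root_eq h0 (by rw [cosForm_geom, ht.cosForm_root_self]) ?_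
  rw [geom_mul_apply, geom_mul_apply, geom_inv_geom, ht.geom_root, map_neg]

theorem eq_one_of_geom_eq_one {w : W} (h : cs.geom w = 1) : w = 1 := by
  by_contra hw
  obtain ⟨i, hi⟩ := cs.exists_rightDescent_of_ne_one hw
  have := cs.geom_simpleRoot_nonpos hi
  rw [h, Module.End.one_apply] at this
  exact (cs.isRoot_simpleRoot i).not_nonpos (simpleRoot_nonneg i) this

theorem geom_injective : Function.Injective cs.geom := by
  intro v w h
  have : v⁻¹ * w = 1 := eq_one_of_geom_eq_one (cs := cs) (by
    rw [map_mul, ← h, ← map_mul, inv_mul_cancel, map_one])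
  rw [inv_mul_eq_one] at this
  exact this

theorem IsReflection.eq_of_root_eq {t t' : W} (ht : cs.IsReflection t) (ht' : cs.IsReflection t')
    (h : cs.root t = cs.root t') : t = t' := by
  refine geom_injective (cs := cs) (LinearMap.ext fun x => ?_)
  rw [ht.geom_apply, ht'.geom_apply, h]

theorem IsReflection.root_eq_simpleRoot_iff {t : W} (ht : cs.IsReflection t) {i : B} :
    cs.root t = simpleRoot i ↔ t = cs.simple i := by
  constructor
  · intro h
    exact ht.eq_of_root_eq (cs.isReflection_simple i) (by rw [h, root_simple])
  · rintro rfl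
    exact root_simple i

theorem IsReflection.geom_simple_root_nonneg {t : W} (ht : cs.IsReflection t) {i : B}
    (h : t ≠ cs.simple i) : 0 ≤ cs.geom (cs.simple i) (cs.root t) :=
  ht.isRoot_root.geom_simple_nonneg ht.root_nonneg (fun h' => h (ht.root_eq_simpleRoot_iff.mp h'))

theorem IsReflection.root_conj_simple {t : W} (ht : cs.IsReflection t) {i : B}
    (h : t ≠ cs.simple i) :
    cs.root (cs.simple i * t * cs.simple i) = cs.geom (cs.simple i) (cs.root t) := by
  have := ht.root_conj (ht.geom_simple_root_nonneg h)
  rwa [inv_simple] at this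

/-- Strip a left descent `sᵢ` from `w`. Either `sᵢ w` still makes the root negative, and induction
applies, or `sᵢ w` sends the root to `αᵢ`, and then `w t = sᵢ w`. -/
theorem IsReflection.length_lt_of_nonpos {t : W} (ht : cs.IsReflection t) :
    ∀ (n : ℕ) (w : W), cs.length w = n → cs.geom w (cs.root t) ≤ 0 →
      cs.length (w * t) < cs.length w := by
  intro n
  induction n with
  | zero =>
    intro w hw h
    rw [cs.length_eq_zero_iff] at hw
    subst hw
    rw [geom_one_apply] at h
    exact absurd h (ht.isRoot_root.not_nonpos ht.root_nonneg)
  | succ n ih =>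
    intro w hw h
    have hw1 : w ≠ 1 := by
      rintro rfl
      simp at hw
    obtain ⟨i, hi⟩ := cs.exists_leftDescent_of_ne_one hw1
    rw [isLeftDescent_iff] at hi
    have hr := ht.isRoot_root.geom (cs.simple i * w)
    by_cases hsw : cs.geom (cs.simple i * w) (cs.root t) ≤ 0
    · have h1 := ih (cs.simple i * w) (by omega) hsw
      have h2 := cs.length_mul_le (cs.simple i) (cs.simple i * w * t)
      rw [mul_assoc, simple_mul_simple_cancel_left, length_simple, ← mul_assoc] at h2
      have h3 := ht.length_mul_left_ne w
      omega
    · rw [hr.not_nonpos_iff] at hsw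
      have e : cs.geom (cs.simple i * w) (cs.root t) = simpleRoot i := by
        by_contra hne
        have h3 := hr.geom_simple_nonneg hsw hne
        rw [← geom_mul_apply, simple_mul_simple_cancel_left] at h3
        exact (ht.isRoot_root.geom w).not_nonpos h3 h
      have h4 : cs.simple i * w * t * (cs.simple i * w)⁻¹ = cs.simple i := by
        rw [← (ht.conj _).root_eq_simpleRoot_iff, ht.root_conj hsw, e]
      have h5 : w * t = cs.simple i * w := by
        rw [mul_inv_eq_iff_eq_mul, simple_mul_simple_cancel_left, mul_assoc] at h4
        rw [← cs.simple_mul_simple_cancel_left i (w := w * t), h4]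
      rw [h5]
      omega

theorem IsReflection.length_mul_lt_iff {t : W} (ht : cs.IsReflection t) (w : W) :
    cs.length (w * t) < cs.length w ↔ cs.geom w (cs.root t) ≤ 0 := by
  refine ⟨fun h => ?_, ht.length_lt_of_nonpos _ w rfl⟩
  by_contra hcon
  rw [(ht.isRoot_root.geom w).not_nonpos_iff] at hcon
  have := ht.length_lt_of_nonpos _ (w * t) rfl (by
    rw [geom_mul_apply, ht.geom_root, map_neg]
    exact neg_nonpos.mpr hcon)
  rw [mul_assoc, ht.mul_self, mul_one] at this
  omega

theorem IsReflection.lt_length_mul_iff {t : W} (ht : cs.IsReflection t) (w : W) :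
    cs.length w < cs.length (w * t) ↔ 0 ≤ cs.geom w (cs.root t) := by
  rw [← (ht.isRoot_root.geom w).not_nonpos_iff, ← ht.length_mul_lt_iff]
  have := ht.length_mul_left_ne w
  omega

theorem IsReflection.length_mul_left_lt_iff {t : W} (ht : cs.IsReflection t) (w : W) :
    cs.length (t * w) < cs.length w ↔ cs.geom w⁻¹ (cs.root t) ≤ 0 := by
  rw [← ht.length_mul_lt_iff, ← cs.length_inv (w⁻¹ * t), mul_inv_rev, inv_inv, ht.inv,
    cs.length_inv]

theorem isLeftDescent_iff_geom {w : W} {i : B} :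
    cs.IsLeftDescent w i ↔ cs.geom w⁻¹ (simpleRoot i) ≤ 0 := by
  have := (cs.isReflection_simple i).length_mul_left_lt_iff w
  rw [root_simple] at this
  exact this

theorem IsReflection.commute_of_cosForm_eq_zero {t t' : W} (ht : cs.IsReflection t)
    (ht' : cs.IsReflection t') (h : M.cosForm (cs.root t) (cs.root t') = 0) :
    t * t' = t' * t := by
  refine geom_injective (cs := cs) (LinearMap.ext fun x => ?_)
  have h' : M.cosForm (cs.root t') (cs.root t) = 0 := by rw [cosForm_symm, h]
  simp only [geom_mul_apply, ht.geom_apply, ht'.geom_apply, map_sub, map_smul, h, h', smul_zero]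
  module

/-- Since `t` centralizes `t'`, it maps the root of `t'` to itself or to its negative. The first
forces orthogonality, the second forces the two roots to agree. -/
theorem IsReflection.cosForm_eq_zero_of_commute {t t' : W} (ht : cs.IsReflection t)
    (ht' : cs.IsReflection t') (hne : t ≠ t') (h : t * t' = t' * t) :
    M.cosForm (cs.root t) (cs.root t') = 0 := by
  have hc : t * t' * t⁻¹ = t' := by rw [h, mul_inv_cancel_right]
  have h1 : cs.geom t' (cs.geom t (cs.root t')) = -cs.geom t (cs.root t') := by
    rw [← geom_mul_apply, ← h, geom_mul_apply, ht'.geom_root, map_neg]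
  have hr := ht'.isRoot_root.geom t
  by_contra hf
  have key : ∀ e : ℝ, cs.geom t (cs.root t') = e • cs.root t' → e = 1 ∨ e = -1 → False := by
    intro e he hee
    have h2 := ht.geom_apply (cs.root t')
    rw [he] at h2
    rcases hee with rfl | rfl
    · have h3 : (2 * M.cosForm (cs.root t) (cs.root t')) • cs.root t = 0 := by
        rw [one_smul] at h2
        exact sub_eq_self.mp h2.symm
      rcases smul_eq_zero.mp h3 with h4 | h4
      · exact hf (by linarith)
      · exact ht.isRoot_root.ne_zero h4
    · have h3 : cs.root t' = (M.cosForm (cs.root t) (cs.root t')) • cs.root t := by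
        have h5 : (2 : ℝ) • cs.root t' =
            (2 : ℝ) • ((M.cosForm (cs.root t) (cs.root t')) • cs.root t) := by
          rw [smul_smul, two_smul]
          rw [neg_one_smul, ← sub_eq_zero] at h2
          rw [← sub_eq_zero, ← neg_eq_zero, ← h2]
          abel
        exact smul_right_injective _ two_ne_zero h5
      refine hne (ht.eq_of_root_eq ht' (ht.root_eq ht'.root_nonneg ht'.cosForm_root_self ?_))
      rw [h3, map_smul, ht.geom_root, smul_neg]
  rcases hr.nonneg_or_nonpos with h0 | h0
  · exact key 1 (by rw [one_smul, ← ht'.root_conj h0, hc]) (Or.inl rfl)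
  · refine key (-1) ?_ (Or.inr rfl)
    have := ht'.root_eq (neg_nonneg.mpr h0) (by
      simp only [map_neg, LinearMap.neg_apply, neg_neg, cosForm_geom, ht'.cosForm_root_self])
      (by rw [map_neg, h1])
    rw [neg_one_smul]
    exact (neg_eq_iff_eq_neg.mpr this).symm

/-- For a finite Coxeter group the form is positive definite. -/
theorem cosForm_pos [Finite W] (cs : CoxeterSystem M W) {x : B → ℝ} (hx : x ≠ 0) :
    0 < M.cosForm x x := by
  classical
  have := Fintype.ofFinite W
  -- A positive definite invariant form obtained by averaging the standard inner product over the
  -- group.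
  let g : (B → ℝ) → (B → ℝ) → ℝ := fun x y => ∑ w : W, ∑ i, cs.geom w x i * cs.geom w y i
  have gadd : ∀ x y z, g (x + y) z = g x z + g y z := by
    intro x y z
    simp only [g, map_add, Pi.add_apply, add_mul, Finset.sum_add_distrib]
  have gsmul : ∀ (a : ℝ) x z, g (a • x) z = a * g x z := by
    intro a x z
    simp only [g, map_smul, Pi.smul_apply, smul_eq_mul, mul_assoc, Finset.mul_sum]
  have gsymm : ∀ x y, g x y = g y x := by
    intro x y
    simp only [g, mul_comm]
  have ginv : ∀ v x y, g (cs.geom v x) (cs.geom v y) = g x y := by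
    intro v x y
    simp only [g, ← geom_mul_apply]
    exact Fintype.sum_equiv (Equiv.mulRight v) _ _ (fun w => rfl)
  have gpos : ∀ x, x ≠ 0 → 0 < g x x := by
    intro x hx
    obtain ⟨j, hj⟩ := Function.ne_iff.mp hx
    refine Finset.sum_pos' (fun w _ => Finset.sum_nonneg fun i _ => mul_self_nonneg _)
      ⟨1, Finset.mem_univ _, ?_⟩
    refine Finset.sum_pos' (fun i _ => mul_self_nonneg _) ⟨j, Finset.mem_univ _, ?_⟩
    simpa using mul_self_pos.mpr hj
  let N : B → ℝ := fun i => g (simpleRoot i) (simpleRoot i)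
  have hN : ∀ i, 0 < N i := fun i => gpos _ (cs.isRoot_simpleRoot i).ne_zero
  -- The reflection `sᵢ` is `g`-orthogonal and negates `αᵢ`, so pairing with `αᵢ` under `g` is
  -- proportional to pairing under the cosine form.
  have gform : ∀ x i, g x (simpleRoot i) = M.cosForm (simpleRoot i) x * N i := by
    intro x i
    have h1 := ginv (cs.simple i) x (simpleRoot i)
    have h2 : cs.geom (cs.simple i) (simpleRoot i) = (-1 : ℝ) • simpleRoot i := by
      rw [geom_simple_simpleRoot, neg_one_smul]
    have h3 : cs.geom (cs.simple i) x =
        x + (-(2 * M.cosForm (simpleRoot i) x)) • simpleRoot i := by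
      rw [geom_simple_apply]
      module
    rw [h2, gsymm, gsmul, gsymm, h3, gadd, gsmul] at h1
    change -1 * (_ + _ * N i) = _ at h1
    linarith
  have hNN : ∀ i j, M.cosForm (simpleRoot i) (simpleRoot j) = 0 ∨ N i = N j := by
    intro i j
    have h1 := gform (simpleRoot i) j
    have h2 := gform (simpleRoot j) i
    rw [gsymm, h2, M.cosForm_symm (simpleRoot j)] at h1
    rcases eq_or_ne (M.cosForm (simpleRoot i) (simpleRoot j)) 0 with h | h
    · exact Or.inl h
    · exact Or.inr (mul_left_cancel₀ h h1)
  -- The constants `N i` agree on nonorthogonal simple roots, so rescaling the `i`-th coordinate by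
  -- `√(N i)` carries the cosine form to `g`.
  let y : B → ℝ := fun i => x i / √(N i)
  have hy : y ≠ 0 := by
    obtain ⟨j, hj⟩ := Function.ne_iff.mp hx
    refine Function.ne_iff.mpr ⟨j, ?_⟩
    exact div_ne_zero hj (Real.sqrt_pos.mpr (hN j)).ne'
  have gsum : ∀ (c : B → ℝ) z, g (∑ i, c i • simpleRoot i) z = ∑ i, c i * g (simpleRoot i) z := by
    intro c z
    let G : (B → ℝ) →ₗ[ℝ] ℝ :=
      { toFun := fun x => g x z
        map_add' := fun x y => gadd x y z
        map_smul' := fun a x => gsmul a x z }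
    change G _ = ∑ i, c i * G _
    simp
  have e : M.cosForm x x = g y y := by
    conv_rhs => rw [← sum_smul_simpleRoot y]
    rw [gsum]
    conv_lhs => rw [← sum_smul_simpleRoot x]
    simp only [map_sum, LinearMap.sum_apply, map_smul, LinearMap.smul_apply, smul_eq_mul]
    simp_rw [Finset.mul_sum]
    rw [Finset.sum_comm]
    refine Finset.sum_congr rfl fun i _ => ?_
    rw [gsymm, gsum, Finset.mul_sum]
    refine Finset.sum_congr rfl fun j _ => ?_
    rw [gform]
    have hi := (Real.sqrt_pos.mpr (hN i)).ne'
    rcases hNN i j with h | h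
    · simp [h]
    · simp only [y, ← h]
      have h2 := Real.mul_self_sqrt (hN i).le
      field_simp
      rw [sq, h2]
  rw [e]
  exact gpos y hy

end CoxeterSystem

/-! ### The Euler form of a word -/

namespace CoxeterMatrix

variable {B : Type*}

/-- The span of the simple roots in `ω`: all vectors supported on `ω`. -/
def supp (ω : List B) : Submodule ℝ (B → ℝ) where
  carrier := {x | ∀ j, j ∉ ω → x j = 0}
  add_mem' := fun {x y} hx hy j hj => by simp [hx j hj, hy j hj]
  zero_mem' := fun j _ => rfl
  smul_mem' := fun a x hx j hj => by simp [hx j hj]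

variable [DecidableEq B]

/-- The coordinate projection onto the span of the simple roots in `ω`. -/
noncomputable def restr : List B → Module.End ℝ (B → ℝ)
  | [] => 0
  | i :: ω => (LinearMap.proj i : (B → ℝ) →ₗ[ℝ] ℝ).smulRight (simpleRoot i) + restr ω

theorem simpleRoot_mem_supp {ω : List B} {i : B} (h : i ∈ ω) : simpleRoot i ∈ supp ω := by
  intro j hj
  rw [simpleRoot_apply, if_neg]
  rintro rfl
  exact hj h

theorem restr_nil (x : B → ℝ) : restr [] x = 0 := rfl

theorem restr_cons (i : B) (ω : List B) (x : B → ℝ) :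
    restr (i :: ω) x = x i • simpleRoot i + restr ω x := rfl

theorem restr_append (ω ω' : List B) (x : B → ℝ) :
    restr (ω ++ ω') x = restr ω x + restr ω' x := by
  induction ω with
  | nil => simp [restr_nil]
  | cons i ω ih => rw [List.cons_append, restr_cons, restr_cons, ih, add_assoc]

theorem restr_apply {ω : List B} (h : ω.Nodup) (x : B → ℝ) (j : B) :
    restr ω x j = if j ∈ ω then x j else 0 := by
  induction ω with
  | nil => simp [restr_nil]
  | cons i ω ih =>
    rw [List.nodup_cons] at h
    rw [restr_cons, Pi.add_apply, ih h.2, Pi.smul_apply, simpleRoot_apply]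
    by_cases hj : j = i
    · subst hj; simp [h.1]
    · simp [hj]

theorem restr_eq_self {ω : List B} (h : ω.Nodup) {x : B → ℝ} (hx : x ∈ supp ω) :
    restr ω x = x := by
  ext j
  rw [restr_apply h]
  split_ifs with hj
  · rfl
  · exact (hx j hj).symm

theorem restr_simpleRoot_of_notMem {ω : List B} {i : B} (h : i ∉ ω) :
    restr ω (simpleRoot i) = 0 := by
  induction ω with
  | nil => rfl
  | cons j ω ih =>
    rw [List.mem_cons, not_or] at h
    rw [restr_cons, ih h.2, simpleRoot_apply, if_neg (Ne.symm h.1), zero_smul, add_zero]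

theorem restr_congr {ω : List B} {x y : B → ℝ} (h : ∀ j ∈ ω, x j = y j) :
    restr ω x = restr ω y := by
  induction ω with
  | nil => rfl
  | cons i ω ih =>
    rw [restr_cons, restr_cons, h i (by simp), ih fun j hj => h j (by simp [hj])]

variable [Fintype B] (M : CoxeterMatrix B)

/-- The Euler form of a word: `E(αᵢ, αᵢ) = 1`, and for distinct letters `E(αᵢ, αⱼ) = 2(αᵢ, αⱼ)`
if `i` comes after `j` and `0` if `i` comes before `j`. -/
noncomputable def euler : List B → LinearMap.BilinForm ℝ (B → ℝ)
  | [] => 0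
  | i :: ω => ((LinearMap.proj i : (B → ℝ) →ₗ[ℝ] ℝ) +
      (2 : ℝ) • (M.cosForm (simpleRoot i)) ∘ₗ restr ω).smulRight
        (LinearMap.proj i : (B → ℝ) →ₗ[ℝ] ℝ) + euler ω

theorem euler_nil (x y : B → ℝ) : M.euler [] x y = 0 := rfl

theorem euler_cons (i : B) (ω : List B) (x y : B → ℝ) :
    M.euler (i :: ω) x y =
      (x i + 2 * M.cosForm (simpleRoot i) (restr ω x)) * y i + M.euler ω x y := rfl

theorem euler_concat (ω : List B) (i : B) (x y : B → ℝ) :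
    M.euler (ω ++ [i]) x y =
      x i * (y i + 2 * M.cosForm (simpleRoot i) (restr ω y)) + M.euler ω x y := by
  induction ω with
  | nil => simp [euler_cons, euler_nil, restr_nil]
  | cons j ω ih =>
    rw [List.cons_append, euler_cons, ih, euler_cons, restr_append, restr_cons, restr_nil,
      add_zero, map_add, map_smul, restr_cons, map_add, map_smul,
      M.cosForm_symm (simpleRoot j) (simpleRoot i)]
    simp only [smul_eq_mul]
    ring

/-- Whenever the Euler form vanishes in one order of its arguments, this turns its value in the
other order into an angle. -/
theorem euler_add_euler (ω : List B) (x y : B → ℝ) :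
    M.euler ω x y + M.euler ω y x = 2 * M.cosForm (restr ω x) (restr ω y) := by
  induction ω with
  | nil => simp [euler_nil, restr_nil]
  | cons i ω ih =>
    rw [euler_cons, euler_cons, restr_cons, restr_cons]
    simp only [map_add, map_smul, LinearMap.add_apply, LinearMap.smul_apply, smul_eq_mul,
      cosForm_simpleRoot_self, M.cosForm_symm (restr ω x) (simpleRoot i)]
    linear_combination ih

theorem euler_congr {ω : List B} {x x' y y' : B → ℝ} (hx : ∀ j ∈ ω, x j = x' j)
    (hy : ∀ j ∈ ω, y j = y' j) : M.euler ω x y = M.euler ω x' y' := by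
  induction ω with
  | nil => rfl
  | cons i ω ih =>
    rw [euler_cons, euler_cons, hx i (by simp), hy i (by simp),
      restr_congr (fun j hj => hx j (by simp [hj])),
      ih (fun j hj => hx j (by simp [hj])) (fun j hj => hy j (by simp [hj]))]

theorem euler_simpleRoot_right_of_notMem {ω : List B} {i : B} (h : i ∉ ω) (x : B → ℝ) :
    M.euler ω x (simpleRoot i) = 0 := by
  rw [M.euler_congr (x' := x) (y' := 0) (fun _ _ => rfl), map_zero]
  intro j hj
  rw [simpleRoot_apply, if_neg]
  · rfl
  · rintro rfl
    exact h hj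

theorem euler_simpleRoot_left_of_notMem {ω : List B} {i : B} (h : i ∉ ω) (y : B → ℝ) :
    M.euler ω (simpleRoot i) y = 0 := by
  rw [M.euler_congr (x' := 0) (y' := y) _ (fun _ _ => rfl), map_zero, LinearMap.zero_apply]
  intro j hj
  rw [simpleRoot_apply, if_neg]
  · rfl
  · rintro rfl
    exact h hj

theorem euler_cons_simpleRoot {ω : List B} {i : B} (h : i ∉ ω) (y : B → ℝ) :
    M.euler (i :: ω) (simpleRoot i) y = y i := by
  rw [euler_cons, M.euler_simpleRoot_left_of_notMem h, restr_simpleRoot_of_notMem h]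
  simp

theorem euler_concat_simpleRoot {ω : List B} {i : B} (h : i ∉ ω) (x : B → ℝ) :
    M.euler (ω ++ [i]) x (simpleRoot i) = x i := by
  rw [euler_concat, M.euler_simpleRoot_right_of_notMem h, restr_simpleRoot_of_notMem h]
  simp

theorem cosForm_simpleRoot_nonpos_of_nonneg {i : B} {x : B → ℝ} (h0 : 0 ≤ x) (hi : x i = 0) :
    M.cosForm (simpleRoot i) x ≤ 0 := by
  rw [← sum_smul_simpleRoot x, map_sum]
  refine Finset.sum_nonpos fun j _ => ?_
  rw [map_smul, smul_eq_mul]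
  by_cases hj : i = j
  · subst hj; simp [hi]
  · exact mul_nonpos_of_nonneg_of_nonpos (h0 j) (M.cosForm_simpleRoot_nonpos hj)

end CoxeterMatrix

/-! ### The Euler form and the product of the word -/

namespace CoxeterSystem

open CoxeterMatrix

variable {B W : Type*} [Group W] {M : CoxeterMatrix B} (cs : CoxeterSystem M W)
variable [Fintype B] [DecidableEq B]

/-- The reflection replaces `xᵢ` by `-(xᵢ + 2(αᵢ, x'))`, with `x'` the part of `x` on the other
letters. This turns the term of `i` as a first letter into its term as a last letter. -/
theorem euler_rotate {i : B} {ω : List B} (h : (i :: ω).Nodup) {x y : B → ℝ}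
    (hx : x ∈ supp (i :: ω)) (hy : y ∈ supp (i :: ω)) :
    M.euler (ω ++ [i]) (cs.geom (cs.simple i) x) (cs.geom (cs.simple i) y) =
      M.euler (i :: ω) x y := by
  have hi : i ∉ ω := (List.nodup_cons.mp h).1
  have hne : ∀ (z : B → ℝ), ∀ j ∈ ω, cs.geom (cs.simple i) z j = z j := by
    intro z j hj
    refine geom_simple_apply_of_ne ?_ z
    rintro rfl
    exact hi hj
  have hz : ∀ z ∈ supp (i :: ω), cs.geom (cs.simple i) z i =
      -z i - 2 * M.cosForm (simpleRoot i) (restr ω z) := by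
    intro z hz
    have e := restr_eq_self h hz
    rw [restr_cons] at e
    rw [geom_simple_apply]
    simp only [Pi.sub_apply, Pi.smul_apply, simpleRoot_self, smul_eq_mul]
    conv_lhs => rw [← e]
    simp only [map_add, map_smul, cosForm_simpleRoot_self, Pi.add_apply, Pi.smul_apply,
      simpleRoot_self, smul_eq_mul, restr_apply (List.nodup_cons.mp h).2, hi, if_false]
    ring
  rw [euler_concat, euler_cons, M.euler_congr (hne x) (hne y), restr_congr (hne y), hz x hx,
    hz y hy]
  ring

theorem geom_wordProd_apply_of_notMem {ω : List B} {j : B} (h : j ∉ ω) (x : B → ℝ) :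
    cs.geom (cs.wordProd ω) x j = x j := by
  induction ω with
  | nil => simp
  | cons i ω ih =>
    rw [List.mem_cons, not_or] at h
    rw [wordProd_cons, geom_mul_apply, geom_simple_apply_of_ne h.1, ih h.2]

theorem geom_wordProd_inv_apply_of_notMem {ω : List B} {j : B} (h : j ∉ ω) (x : B → ℝ) :
    cs.geom (cs.wordProd ω)⁻¹ x j = x j := by
  rw [← wordProd_reverse]
  exact cs.geom_wordProd_apply_of_notMem (by simpa using h) x

/-- The key identity: once `1 - c⁻¹` is known to be onto the span of the letters, it determines the
Euler form there. In the induction, `c'⁻¹` leaves the `i`-th coordinate alone, so `y - c⁻¹y` has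
`i`-th coordinate `2(αᵢ, y)`. -/
theorem euler_sub_geom_inv {ω : List B} (h : ω.Nodup) (x y : B → ℝ) :
    M.euler ω x (y - cs.geom (cs.wordProd ω)⁻¹ y) = 2 * M.cosForm (restr ω x) y := by
  induction ω generalizing y with
  | nil => simp [euler_nil, restr_nil]
  | cons i ω ih =>
    rw [List.nodup_cons] at h
    rw [euler_cons, wordProd_cons, mul_inv_rev, inv_simple, geom_mul_apply]
    set k := 2 * M.cosForm (simpleRoot i) y with hk
    have h1 : (y - cs.geom (cs.wordProd ω)⁻¹ (cs.geom (cs.simple i) y)) i = k := by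
      rw [Pi.sub_apply, cs.geom_wordProd_inv_apply_of_notMem h.1, geom_simple_apply]
      simp [hk]
    have h2 : y - cs.geom (cs.wordProd ω)⁻¹ (cs.geom (cs.simple i) y) =
        (cs.geom (cs.simple i) y - cs.geom (cs.wordProd ω)⁻¹ (cs.geom (cs.simple i) y)) +
          k • simpleRoot i := by
      conv_rhs => rw [cs.geom_simple_apply i y]
      rw [cs.geom_simple_apply i y]
      abel
    rw [h1]
    conv_lhs => rw [h2]
    rw [map_add, ih h.2, map_smul, M.euler_simpleRoot_right_of_notMem h.1, geom_simple_apply,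
      restr_cons]
    simp only [map_add, map_sub, map_smul, LinearMap.add_apply, LinearMap.smul_apply,
      smul_eq_mul, M.cosForm_symm (restr ω x) (simpleRoot i), ← hk]
    linear_combination x i * hk

/-! ### Factorizations into reflections are exceptional sequences -/

section Factorization

/-- The span of the roots of the letters of a word in the reflections. -/
noncomputable def rootSpan (ts : List W) : Submodule ℝ (B → ℝ) :=
  Submodule.span ℝ {β | β ∈ ts.map cs.root}

theorem rootSpan_nil : cs.rootSpan [] = ⊥ := by
  simp [rootSpan]

theorem rootSpan_cons (t : W) (ts : List W) :
    cs.rootSpan (t :: ts) = Submodule.span ℝ {cs.root t} ⊔ cs.rootSpan ts := by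
  rw [rootSpan, rootSpan, ← Submodule.span_union]
  congr 1
  ext β
  simp

theorem root_mem_rootSpan {ts : List W} {t : W} (h : t ∈ ts) : cs.root t ∈ cs.rootSpan ts :=
  Submodule.subset_span (List.mem_map_of_mem h)

theorem rootSpan_le_cons (t : W) (ts : List W) : cs.rootSpan ts ≤ cs.rootSpan (t :: ts) := by
  rw [rootSpan_cons]
  exact le_sup_right

theorem finrank_rootSpan_le (ts : List W) :
    Module.finrank ℝ (cs.rootSpan ts) ≤ ts.length := by
  induction ts with
  | nil => simp [rootSpan_nil]
  | cons t ts ih =>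
    rw [rootSpan_cons, List.length_cons]
    have h1 := Submodule.finrank_add_le_finrank_add_finrank (Submodule.span ℝ {cs.root t})
      (cs.rootSpan ts)
    have h2 : Module.finrank ℝ (Submodule.span ℝ {cs.root t}) ≤ 1 := by
      simpa using finrank_span_le_card (R := ℝ) ({cs.root t} : Set (B → ℝ))
    omega

theorem sub_geom_inv_mem_rootSpan {ts : List W} (h : ∀ t ∈ ts, cs.IsReflection t) (y : B → ℝ) :
    y - cs.geom ts.prod⁻¹ y ∈ cs.rootSpan ts := by
  induction ts generalizing y with
  | nil => simp
  | cons t ts ih =>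
    have ht := h t (by simp)
    rw [List.prod_cons, mul_inv_rev, ht.inv, geom_mul_apply]
    have h1 := cs.rootSpan_le_cons t ts (ih (fun t' h' => h t' (by simp [h'])) (cs.geom t y))
    have h2 : y - cs.geom t y ∈ cs.rootSpan (t :: ts) := by
      rw [ht.geom_apply, sub_sub_cancel]
      exact Submodule.smul_mem _ _ (cs.root_mem_rootSpan (by simp))
    convert Submodule.add_mem _ h1 h2 using 1
    abel

/-- A linear endomorphism `1 - w` mapping `U` to itself without fixed vectors is onto. -/
theorem exists_sub_geom_eq {U : Submodule ℝ (B → ℝ)} {w : W}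
    (hU : ∀ y ∈ U, y - cs.geom w y ∈ U) (h0 : ∀ y ∈ U, cs.geom w y = y → y = 0) {x : B → ℝ}
    (hx : x ∈ U) : ∃ y ∈ U, y - cs.geom w y = x := by
  let f : U →ₗ[ℝ] U := (LinearMap.id - cs.geom w).restrict hU
  have hf : Function.Injective f := by
    rw [← LinearMap.ker_eq_bot, LinearMap.ker_eq_bot']
    intro y hy
    have h1 : (y : B → ℝ) - cs.geom w y = 0 := congrArg Subtype.val hy
    exact Subtype.ext (h0 y y.2 (sub_eq_zero.mp h1).symm)
  obtain ⟨y, hy⟩ := LinearMap.injective_iff_surjective.mp hf ⟨x, hx⟩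
  exact ⟨y, y.2, congrArg Subtype.val hy⟩

variable [Finite W]

theorem eq_zero_of_cosForm_self (cs : CoxeterSystem M W) {x : B → ℝ} (h : M.cosForm x x = 0) : x = 0 := by
  by_contra hx
  exact (cs.cosForm_pos hx).ne' h

theorem eq_zero_of_geom_inv_wordProd_eq {ω : List B} (h : ω.Nodup) {y : B → ℝ} (hy : y ∈ supp ω)
    (he : cs.geom (cs.wordProd ω)⁻¹ y = y) : y = 0 := by
  have := cs.euler_sub_geom_inv h y y
  rw [he, sub_self, map_zero, restr_eq_self h hy] at this
  exact cs.eq_zero_of_cosForm_self (by linarith)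

theorem exists_sub_geom_inv_wordProd_eq {ω : List B} (h : ω.Nodup) {x : B → ℝ}
    (hx : x ∈ supp ω) : ∃ y ∈ supp ω, y - cs.geom (cs.wordProd ω)⁻¹ y = x := by
  refine cs.exists_sub_geom_eq (fun y hy => ?_)
    (fun y hy => cs.eq_zero_of_geom_inv_wordProd_eq h hy) hx
  intro j hj
  rw [Pi.sub_apply, cs.geom_wordProd_inv_apply_of_notMem hj, sub_self]

/-- Values of `1 - c⁻¹` lie in the span of the roots of any factorization, and they exhaust the span
of the letters. This gives the lower bound on reflection length. -/
theorem supp_le_rootSpan {ω : List B} (h : ω.Nodup) {ts : List W}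
    (hts : ∀ t ∈ ts, cs.IsReflection t) (hprod : ts.prod = cs.wordProd ω) :
    supp ω ≤ cs.rootSpan ts := by
  intro x hx
  obtain ⟨y, -, rfl⟩ := cs.exists_sub_geom_inv_wordProd_eq h hx
  rw [← hprod]
  exact cs.sub_geom_inv_mem_rootSpan hts y

theorem length_le_finrank_supp {ω : List B} (h : ω.Nodup) :
    ω.length ≤ Module.finrank ℝ (supp ω) := by
  have hli : LinearIndependent ℝ (fun i : B => (simpleRoot i : B → ℝ)) := by
    convert (Pi.basisFun ℝ B).linearIndependent using 1
    ext i
    simp [simpleRoot]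
  have h1 := (hli.comp (fun k : Fin ω.length => ω.get k) (List.nodup_iff_injective_get.mp h))
  have h2 : LinearIndependent ℝ (fun k : Fin ω.length =>
      (⟨simpleRoot (ω.get k), simpleRoot_mem_supp (ω.get_mem k)⟩ : supp ω)) :=
    LinearIndependent.of_comp (supp ω).subtype h1
  simpa using h2.fintype_card_le_finrank

theorem length_le_of_prod_eq {ω : List B} (h : ω.Nodup) {ts : List W}
    (hts : ∀ t ∈ ts, cs.IsReflection t) (hprod : ts.prod = cs.wordProd ω) :
    ω.length ≤ ts.length :=
  (length_le_finrank_supp h).trans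
    ((Submodule.finrank_mono (cs.supp_le_rootSpan h hts hprod)).trans (cs.finrank_rootSpan_le ts))

/-- A factorization of the product of the word `ω` into `|ω|` reflections. -/
structure IsFactorization (ω : List B) (ts : List W) : Prop where
  isReflection : ∀ t ∈ ts, cs.IsReflection t
  prod_eq : ts.prod = cs.wordProd ω
  length_eq : ts.length = ω.length

variable {cs}

theorem IsFactorization.supp_eq {ω : List B} (h : ω.Nodup) {ts : List W}
    (hts : cs.IsFactorization ω ts) : supp ω = cs.rootSpan ts := by
  refine Submodule.eq_of_le_of_finrank_le (cs.supp_le_rootSpan h hts.1 hts.2) ?_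
  have := length_le_finrank_supp h
  rw [← hts.3] at this
  exact (cs.finrank_rootSpan_le ts).trans this

theorem IsFactorization.root_mem_supp {ω : List B} (h : ω.Nodup) {ts : List W}
    (hts : cs.IsFactorization ω ts) {t : W} (ht : t ∈ ts) : cs.root t ∈ supp ω := by
  rw [hts.supp_eq h]
  exact cs.root_mem_rootSpan ht

/-- Let `c = t c'` and let `x` lie in the span of the later roots; write `x = y - c⁻¹y`. Then `2(β,
y) β`, for `β` the root of `t`, also lies in that span, whereas `β` does not, by independence. So
`(β, y) = 0`, which is `E(β, x) = 0`. Consequently `E(x, β) = 2(x, β)`, which is what carries the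
hypothesis `hE` from `c` to `c'`. The form is kept abstract because `c'` need not come with a word
in simple reflections. -/
theorem pairwise_euler_eq_zero (E : LinearMap.BilinForm ℝ (B → ℝ)) {ts : List W}
    (hts : ∀ t ∈ ts, cs.IsReflection t)
    (hind : ts.length ≤ Module.finrank ℝ (cs.rootSpan ts))
    (hE : ∀ x ∈ cs.rootSpan ts, ∀ y, E x (y - cs.geom ts.prod⁻¹ y) = 2 * M.cosForm x y)
    (hS : ∀ x ∈ cs.rootSpan ts, ∀ y ∈ cs.rootSpan ts, E x y + E y x = 2 * M.cosForm x y) :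
    ts.Pairwise fun t t' => t ≠ t' ∧ E (cs.root t) (cs.root t') = 0 := by
  induction ts with
  | nil => exact List.Pairwise.nil
  | cons t ts ih =>
    have ht := hts t (by simp)
    have hts' : ∀ t ∈ ts, cs.IsReflection t := fun t' h' => hts t' (by simp [h'])
    have hle := cs.rootSpan_le_cons t ts
    have htm : cs.root t ∈ cs.rootSpan (t :: ts) := cs.root_mem_rootSpan (by simp)
    have hnot : cs.root t ∉ cs.rootSpan ts := by
      intro hmem
      have : cs.rootSpan (t :: ts) = cs.rootSpan ts := by
        rw [rootSpan_cons]
        exact sup_eq_right.mpr ((Submodule.span_singleton_le_iff_mem _ _).mpr hmem)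
      rw [this, List.length_cons] at hind
      have := cs.finrank_rootSpan_le ts
      omega
    have hind' : ts.length ≤ Module.finrank ℝ (cs.rootSpan ts) := by
      rw [rootSpan_cons, List.length_cons] at hind
      have h1 := Submodule.finrank_add_le_finrank_add_finrank (Submodule.span ℝ {cs.root t})
        (cs.rootSpan ts)
      have h2 : Module.finrank ℝ (Submodule.span ℝ {cs.root t}) ≤ 1 := by
        simpa using finrank_span_le_card (R := ℝ) ({cs.root t} : Set (B → ℝ))
      omega
    have hinv : (t :: ts).prod⁻¹ = ts.prod⁻¹ * t := by
      rw [List.prod_cons, mul_inv_rev, ht.inv]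
    have hzero : ∀ x ∈ cs.rootSpan ts, E (cs.root t) x = 0 := by
      intro x hx
      obtain ⟨y, -, hy⟩ := cs.exists_sub_geom_eq (U := cs.rootSpan (t :: ts))
        (w := (t :: ts).prod⁻¹) (fun y _ => cs.sub_geom_inv_mem_rootSpan hts y) (by
          intro y hy he
          have := hE y hy y
          rw [he, sub_self, map_zero] at this
          exact cs.eq_zero_of_cosForm_self (by linarith)) (hle hx)
      have h1 := hE _ htm y
      rw [hy] at h1
      have h2 : (2 * M.cosForm (cs.root t) y) • cs.root t ∈ cs.rootSpan ts := by
        have h3 := cs.sub_geom_inv_mem_rootSpan hts' (cs.geom t y)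
        have h4 : (2 * M.cosForm (cs.root t) y) • cs.root t =
            x - (cs.geom t y - cs.geom ts.prod⁻¹ (cs.geom t y)) := by
          rw [← hy, hinv, geom_mul_apply]
          conv_rhs => rw [ht.geom_apply]
          abel
        rw [h4]
        exact Submodule.sub_mem _ hx h3
      by_contra hne
      rw [h1] at hne
      exact hnot ((Submodule.smul_mem_iff _ hne).mp h2)
    refine List.pairwise_cons.mpr ⟨fun t' h' => ⟨?_, hzero _ (cs.root_mem_rootSpan h')⟩,
      ih hts' hind' (fun x hx y => ?_) (fun x hx y hy => hS x (hle hx) y (hle hy))⟩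
    · rintro rfl
      exact hnot (cs.root_mem_rootSpan h')
    · obtain ⟨z, rfl⟩ : ∃ z, y = cs.geom t z :=
        ⟨cs.geom t y, by rw [← geom_mul_apply, ht.mul_self, geom_one_apply]⟩
      have h1 := hE x (hle hx) z
      rw [hinv, geom_mul_apply] at h1
      have h2 := hS x (hle hx) _ htm
      rw [hzero x hx, add_zero] at h2
      have h3 : cs.geom t z - cs.geom ts.prod⁻¹ (cs.geom t z) =
          (z - cs.geom ts.prod⁻¹ (cs.geom t z)) -
            (2 * M.cosForm (cs.root t) z) • cs.root t := by
        rw [sub_right_comm, ← ht.geom_apply z]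
      rw [h3, map_sub, h1, map_smul, h2, ht.geom_apply, map_sub, map_smul]
      simp only [smul_eq_mul]
      ring

theorem IsFactorization.pairwise {ω : List B} (h : ω.Nodup) {ts : List W}
    (hts : cs.IsFactorization ω ts) :
    ts.Pairwise fun t t' => t ≠ t' ∧ M.euler ω (cs.root t) (cs.root t') = 0 := by
  refine pairwise_euler_eq_zero _ hts.1 ?_ ?_ ?_
  · rw [← hts.supp_eq h, hts.3]
    exact length_le_finrank_supp h
  · intro x hx y
    rw [← hts.supp_eq h] at hx
    rw [hts.2, cs.euler_sub_geom_inv h, restr_eq_self h hx]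
  · intro x hx y hy
    rw [← hts.supp_eq h] at hx hy
    rw [euler_add_euler, restr_eq_self h hx, restr_eq_self h hy]

theorem IsFactorization.nodup {ω : List B} (h : ω.Nodup) {ts : List W}
    (hts : cs.IsFactorization ω ts) : ts.Nodup :=
  (hts.pairwise h).imp fun h => h.1

end Factorization

end CoxeterSystem

/-! ### Commutation equivalence -/

namespace CoxeterSystem

section Words

variable {G : Type*} [Group G]

theorem CommEquiv.refl (l : List G) : CommEquiv l l := Relation.EqvGen.refl _

theorem CommEquiv.symm {l l' : List G} (h : CommEquiv l l') : CommEquiv l' l :=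
  Relation.EqvGen.symm _ _ h

theorem CommEquiv.trans {l l' l'' : List G} (h : CommEquiv l l') (h' : CommEquiv l' l'') :
    CommEquiv l l'' :=
  Relation.EqvGen.trans _ _ _ h h'

theorem CommEquiv.swap (l₁ l₂ : List G) {s t : G} (h : s * t = t * s) :
    CommEquiv (l₁ ++ s :: t :: l₂) (l₁ ++ t :: s :: l₂) :=
  Relation.EqvGen.rel _ _ (CommMove.swap l₁ l₂ s t h)

/-- A property that is invariant under commutation moves is invariant under commutation
equivalence. -/
theorem CommEquiv.iff_of_move {p : List G → Prop} (hp : ∀ l l', CommMove l l' → (p l ↔ p l'))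
    {l l' : List G} (h : CommEquiv l l') : p l ↔ p l' := by
  induction h with
  | rel _ _ h => exact hp _ _ h
  | refl _ => exact Iff.rfl
  | symm _ _ _ ih => exact ih.symm
  | trans _ _ _ _ _ ih ih' => exact ih.trans ih'

theorem CommEquiv.map_of_move {H : Type*} [Group H] {f : List G → List H}
    (hf : ∀ l l', CommMove l l' → CommEquiv (f l) (f l')) {l l' : List G} (h : CommEquiv l l') :
    CommEquiv (f l) (f l') := by
  induction h with
  | rel _ _ h => exact hf _ _ h
  | refl _ => exact CommEquiv.refl _
  | symm _ _ _ ih => exact ih.symm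
  | trans _ _ _ _ _ ih ih' => exact ih.trans ih'

theorem CommEquiv.perm {l l' : List G} (h : CommEquiv l l') : l.Perm l' := by
  induction h with
  | rel _ _ h =>
    obtain ⟨l₁, l₂, s, t, -⟩ := h
    exact (List.Perm.swap _ _ _).append_left _
  | refl _ => exact List.Perm.refl _
  | symm _ _ _ ih => exact ih.symm
  | trans _ _ _ _ _ ih ih' => exact ih.trans ih'

theorem CommEquiv.prod_eq {l l' : List G} (h : CommEquiv l l') : l.prod = l'.prod := by
  induction h with
  | rel _ _ h =>
    obtain ⟨l₁, l₂, s, t, h⟩ := h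
    simp only [List.prod_append, List.prod_cons]
    rw [← mul_assoc s, h, mul_assoc]
  | refl _ => rfl
  | symm _ _ _ ih => exact ih.symm
  | trans _ _ _ _ _ ih ih' => exact ih.trans ih'

theorem CommEquiv.cons (a : G) {l l' : List G} (h : CommEquiv l l') :
    CommEquiv (a :: l) (a :: l') := by
  refine h.map_of_move (f := List.cons a) ?_
  rintro _ _ ⟨l₁, l₂, s, t, h⟩
  exact CommEquiv.swap (a :: l₁) l₂ h

theorem CommEquiv.append_left (a : List G) {l l' : List G} (h : CommEquiv l l') :
    CommEquiv (a ++ l) (a ++ l') := by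
  induction a with
  | nil => exact h
  | cons x a ih => exact ih.cons x

theorem CommEquiv.append_right (a : List G) {l l' : List G} (h : CommEquiv l l') :
    CommEquiv (l ++ a) (l' ++ a) := by
  refine h.map_of_move (f := fun l => l ++ a) ?_
  rintro _ _ ⟨l₁, l₂, s, t, h⟩
  simpa using CommEquiv.swap l₁ (l₂ ++ a) h

theorem CommEquiv.map {f : G → G} (hf : ∀ a b, a * b = b * a → f a * f b = f b * f a)
    {l l' : List G} (h : CommEquiv l l') : CommEquiv (l.map f) (l'.map f) := by
  refine h.map_of_move ?_
  rintro _ _ ⟨l₁, l₂, s, t, h⟩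
  simpa using CommEquiv.swap (l₁.map f) (l₂.map f) (hf _ _ h)

theorem CommEquiv.move_front {l₁ : List G} (l₂ : List G) {s : G}
    (h : ∀ x ∈ l₁, x * s = s * x) : CommEquiv (l₁ ++ s :: l₂) (s :: (l₁ ++ l₂)) := by
  induction l₁ with
  | nil => exact CommEquiv.refl _
  | cons x l₁ ih =>
    exact ((ih fun y hy => h y (by simp [hy])).cons x).trans
      (CommEquiv.swap [] (l₁ ++ l₂) (h x (by simp)))

theorem CommEquiv.move_back (l₁ : List G) {l₂ : List G} {s : G}
    (h : ∀ x ∈ l₂, s * x = x * s) : CommEquiv (l₁ ++ s :: l₂) (l₁ ++ l₂ ++ [s]) := by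
  have h1 := (CommEquiv.move_front [] fun x hx => (h x hx).symm).symm.append_left l₁
  simpa using h1

end Words

/-! ### Rotation of factorizations and the nonacute case -/

open CoxeterMatrix

variable {B W : Type*} [Group W] {M : CoxeterMatrix B} (cs : CoxeterSystem M W)

/-- The word obtained by conjugating every letter by a simple reflection. -/
def conjWord (i : B) (ts : List W) : List W :=
  ts.map fun t => cs.simple i * t * cs.simple i

theorem prod_conjWord (i : B) (ts : List W) :
    (cs.conjWord i ts).prod = cs.simple i * ts.prod * cs.simple i := by
  induction ts with
  | nil => simp [conjWord]
  | cons t ts ih =>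
    rw [conjWord, List.map_cons, List.prod_cons, ← conjWord, ih, List.prod_cons]
    simp [mul_assoc]

theorem mem_conjWord {i : B} {ts : List W} {t : W} :
    t ∈ cs.conjWord i ts ↔ ∃ t' ∈ ts, cs.simple i * t' * cs.simple i = t := by
  simp [conjWord]

theorem simple_notMem_conjWord {i : B} {ts : List W} (h : cs.simple i ∉ ts) :
    cs.simple i ∉ cs.conjWord i ts := by
  rw [mem_conjWord]
  rintro ⟨t, ht, he⟩
  refine conj_simple_ne ?_ he
  rintro rfl
  exact h ht

theorem conjWord_conjWord (i : B) (ts : List W) : cs.conjWord i (cs.conjWord i ts) = ts := by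
  rw [conjWord, conjWord, List.map_map]
  conv_rhs => rw [← List.map_id ts]
  refine List.map_congr_left fun t _ => ?_
  simp [mul_assoc]

theorem CommEquiv.conjWord {ts ts' : List W} (h : CommEquiv ts ts') (i : B) :
    CommEquiv (cs.conjWord i ts) (cs.conjWord i ts') := by
  refine CommEquiv.map (fun a b hab => ?_) h
  have : ∀ x y : W, cs.simple i * x * cs.simple i * (cs.simple i * y * cs.simple i) =
      cs.simple i * (x * y) * cs.simple i := by
    intro x y
    simp [mul_assoc]
  rw [this, this, hab]

variable {cs} in
theorem isReflection_of_mem_conjWord {i : B} {ts : List W} (h : ∀ t ∈ ts, cs.IsReflection t) :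
    ∀ t ∈ cs.conjWord i ts, cs.IsReflection t := by
  intro t ht
  obtain ⟨t', h', rfl⟩ := cs.mem_conjWord.mp ht
  exact (h t' h').conj_simple i

variable {cs} in
theorem IsFactorization.rotate {i : B} {ω : List B} {ts : List W}
    (h : cs.IsFactorization (i :: ω) ts) : cs.IsFactorization (ω ++ [i]) (cs.conjWord i ts) where
  isReflection := isReflection_of_mem_conjWord h.1
  prod_eq := by
    rw [prod_conjWord, h.2, wordProd_cons, wordProd_append]
    simp
  length_eq := by simp [conjWord, h.3]

variable {cs} in
theorem IsFactorization.rotate_symm {i : B} {ω : List B} {ts : List W}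
    (h : cs.IsFactorization (ω ++ [i]) ts) : cs.IsFactorization (i :: ω) (cs.conjWord i ts) where
  isReflection := isReflection_of_mem_conjWord h.1
  prod_eq := by
    rw [prod_conjWord, h.2, wordProd_cons, wordProd_append]
    simp [mul_assoc]
  length_eq := by simp [conjWord, h.3]

variable [Fintype B] [DecidableEq B]

variable {cs} in
theorem cosForm_root_conj_simple {i : B} {t t' : W} (ht : cs.IsReflection t)
    (ht' : cs.IsReflection t') (h : t ≠ cs.simple i) (h' : t' ≠ cs.simple i) :
    M.cosForm (cs.root (cs.simple i * t * cs.simple i))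
      (cs.root (cs.simple i * t' * cs.simple i)) = M.cosForm (cs.root t) (cs.root t') := by
  rw [ht.root_conj_simple h, ht'.root_conj_simple h', cosForm_geom]

theorem pairwise_cosForm_conjWord {p : ℝ → Prop} {i : B} {ts : List W}
    (hts : ∀ t ∈ ts, cs.IsReflection t) (hi : cs.simple i ∉ ts)
    (h : ts.Pairwise fun t t' => p (M.cosForm (cs.root t) (cs.root t'))) :
    (cs.conjWord i ts).Pairwise fun t t' => p (M.cosForm (cs.root t) (cs.root t')) := by
  rw [conjWord, List.pairwise_map]
  refine h.imp_of_mem fun {t t'} h1 h2 h3 => ?_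
  rwa [cosForm_root_conj_simple (hts _ h1) (hts _ h2)]
  · rintro rfl; exact hi h1
  · rintro rfl; exact hi h2

theorem pairwise_cosForm_perm {p : ℝ → Prop} {ts ts' : List W} (h : ts.Perm ts')
    (hp : ts.Pairwise fun t t' => p (M.cosForm (cs.root t) (cs.root t'))) :
    ts'.Pairwise fun t t' => p (M.cosForm (cs.root t) (cs.root t')) := by
  refine (h.pairwise_iff fun {t t'} h' => ?_).mp hp
  rwa [cosForm_symm]

variable [Finite W]

variable {cs} in
/-- If all roots of a factorization make pairwise nonacute angles, an occurrence of the first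
letter can be moved to the front. -/
theorem IsFactorization.move_front {i : B} {ω : List B} (hω : (i :: ω).Nodup) {l₁ l₂ : List W}
    (h : cs.IsFactorization (i :: ω) (l₁ ++ cs.simple i :: l₂))
    (hp : (l₁ ++ cs.simple i :: l₂).Pairwise fun t t' => M.cosForm (cs.root t) (cs.root t') ≤ 0) :
    CommEquiv (l₁ ++ cs.simple i :: l₂) (cs.simple i :: (l₁ ++ l₂)) := by
  refine CommEquiv.move_front l₂ fun t ht => ?_
  have hr := h.1 t (by simp [ht])
  have h1 := (List.pairwise_append.mp (h.pairwise hω)).2.2 t ht (cs.simple i) (by simp)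
  have h2 := (List.pairwise_append.mp hp).2.2 t ht (cs.simple i) (by simp)
  rw [root_simple] at h1 h2
  refine hr.commute_of_cosForm_eq_zero (cs.isReflection_simple i) ?_
  rw [root_simple]
  -- As `E(β, αᵢ) = 0`, this reads `βᵢ = 2(β, αᵢ)`: the left side is nonnegative, the right side
  -- nonpositive.
  have h3 := M.euler_add_euler (i :: ω) (cs.root t) (simpleRoot i)
  rw [restr_eq_self hω (h.root_mem_supp hω (by simp [ht])),
    restr_eq_self hω (simpleRoot_mem_supp (by simp)), h1.2,
    M.euler_cons_simpleRoot (List.nodup_cons.mp hω).1] at h3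
  have h4 := hr.root_nonneg i
  rw [Pi.zero_apply] at h4
  linarith

variable {cs} in
/-- If all roots of a factorization make pairwise nonobtuse angles, an occurrence of the first
letter can be moved to the back. -/
theorem IsFactorization.move_back {i : B} {ω : List B} (hω : (i :: ω).Nodup) {l₁ l₂ : List W}
    (h : cs.IsFactorization (i :: ω) (l₁ ++ cs.simple i :: l₂))
    (hp : (l₁ ++ cs.simple i :: l₂).Pairwise fun t t' => 0 ≤ M.cosForm (cs.root t) (cs.root t')) :
    CommEquiv (l₁ ++ cs.simple i :: l₂) (l₁ ++ l₂ ++ [cs.simple i]) := by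
  refine CommEquiv.move_back l₁ fun t ht => ?_
  have hr := h.1 t (by simp [ht])
  have h1 := (List.pairwise_cons.mp (List.pairwise_append.mp (h.pairwise hω)).2.1).1 t ht
  have h2 := (List.pairwise_cons.mp (List.pairwise_append.mp hp).2.1).1 t ht
  rw [root_simple] at h1 h2
  refine (cs.isReflection_simple i).commute_of_cosForm_eq_zero hr ?_
  rw [root_simple]
  -- Here `E(αᵢ, β) = βᵢ` vanishes, and a positive root without `αᵢ`-coordinate makes a nonacute
  -- angle with `αᵢ`.
  rw [M.euler_cons_simpleRoot (List.nodup_cons.mp hω).1] at h1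
  exact le_antisymm (M.cosForm_simpleRoot_nonpos_of_nonneg hr.root_nonneg h1.2) h2

variable {cs} in
/-- If all roots of a factorization make pairwise nonobtuse angles, an occurrence of the last
letter can be moved to the front. -/
theorem IsFactorization.move_front_last {i : B} {ω : List B} (hω : (ω ++ [i]).Nodup)
    {l₁ l₂ : List W} (h : cs.IsFactorization (ω ++ [i]) (l₁ ++ cs.simple i :: l₂))
    (hp : (l₁ ++ cs.simple i :: l₂).Pairwise fun t t' => 0 ≤ M.cosForm (cs.root t) (cs.root t')) :
    CommEquiv (l₁ ++ cs.simple i :: l₂) (cs.simple i :: (l₁ ++ l₂)) := by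
  refine CommEquiv.move_front l₂ fun t ht => ?_
  have hr := h.1 t (by simp [ht])
  have h1 := (List.pairwise_append.mp (h.pairwise hω)).2.2 t ht (cs.simple i) (by simp)
  have h2 := (List.pairwise_append.mp hp).2.2 t ht (cs.simple i) (by simp)
  rw [root_simple] at h1 h2
  refine hr.commute_of_cosForm_eq_zero (cs.isReflection_simple i) ?_
  rw [root_simple]
  have hi : i ∉ ω := by
    have := List.nodup_append_comm.mp hω
    exact (List.nodup_cons.mp this).1
  rw [M.euler_concat_simpleRoot hi] at h1
  refine le_antisymm ?_ h2
  rw [cosForm_symm]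
  exact M.cosForm_simpleRoot_nonpos_of_nonneg hr.root_nonneg h1.2

/-- A factorization of a Coxeter element whose roots make pairwise nonacute angles consists of
the simple reflections, up to commutations. -/
theorem commEquiv_of_obtuse (n : ℕ) : ∀ (ω : List B) (ts : List W), ω.length = n → ω.Nodup →
    cs.IsFactorization ω ts →
    (ts.Pairwise fun t t' => M.cosForm (cs.root t) (cs.root t') ≤ 0) →
    CommEquiv ts (ω.map cs.simple) := by
  induction n with
  | zero =>
    intro ω ts hn hω h _
    rw [List.length_eq_zero_iff] at hn
    subst hn
    have := h.3
    rw [List.length_nil, List.length_eq_zero_iff] at this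
    subst this
    exact CommEquiv.refl _
  | succ n ih =>
    -- Counterexamples of minimal rank. The first letter of the word cannot occur in one, since it
    -- could be cancelled, and conjugating by that letter gives a counterexample for the rotated
    -- word.
    let Bad : List B → List W → Prop := fun ω ts => cs.IsFactorization ω ts ∧
      (ts.Pairwise fun t t' => M.cosForm (cs.root t) (cs.root t') ≤ 0) ∧
      ¬ CommEquiv ts (ω.map cs.simple)
    have hrot : ∀ (i : B) (ω : List B) (ts : List W), (i :: ω).length = n + 1 → (i :: ω).Nodup →
        Bad (i :: ω) ts → cs.simple i ∉ ts ∧ Bad (ω ++ [i]) (cs.conjWord i ts) := by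
      rintro i ω ts hlen hω ⟨hf, hp, hc⟩
      have hi : cs.simple i ∉ ts := by
        intro hmem
        obtain ⟨l₁, l₂, rfl⟩ := List.append_of_mem hmem
        have h1 := hf.move_front hω hp
        refine hc (h1.trans ?_)
        rw [List.map_cons]
        refine CommEquiv.cons _ (ih ω _ (by simpa using hlen) (List.nodup_cons.mp hω).2
          ⟨fun t ht => hf.1 t ?_, ?_, ?_⟩ ?_)
        · simp only [List.mem_append, List.mem_cons] at ht ⊢
          tauto
        · have h2 := h1.prod_eq
          rw [hf.2, List.prod_cons, wordProd_cons] at h2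
          exact (mul_left_cancel h2).symm
        · have := hf.3
          simp only [List.length_append, List.length_cons] at this ⊢
          omega
        · exact (List.pairwise_cons.mp
            (cs.pairwise_cosForm_perm (p := fun a => a ≤ 0) h1.perm hp)).2
      refine ⟨hi, hf.rotate, cs.pairwise_cosForm_conjWord (p := fun a => a ≤ 0) hf.1 hi hp, ?_⟩
      intro hc'
      refine cs.simple_notMem_conjWord hi (hc'.perm.mem_iff.mpr ?_)
      simp
    -- No letter met while rotating is ever equal to the conjugating reflection, so each letter's
    -- positive root is transported by the group action without a sign. A full turn acts on it by
    -- `c⁻¹`.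
    have hround : ∀ (ω₁ ω₂ : List B) (ts : List W) (t : W), (ω₁ ++ ω₂).length = n + 1 →
        (ω₁ ++ ω₂).Nodup → Bad (ω₁ ++ ω₂) ts → t ∈ ts → ∃ ts' t', Bad (ω₂ ++ ω₁) ts' ∧
          t' ∈ ts' ∧ cs.root t' = cs.geom (cs.wordProd ω₁)⁻¹ (cs.root t) := by
      intro ω₁
      induction ω₁ with
      | nil =>
        intro ω₂ ts t _ _ hb ht
        exact ⟨ts, t, by simpa using hb, ht, by simp⟩
      | cons i ω₁ ih' =>
        intro ω₂ ts t hlen hω hb ht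
        obtain ⟨hi, hb'⟩ := hrot i (ω₁ ++ ω₂) ts hlen hω hb
        rw [List.append_assoc] at hb'
        obtain ⟨ts', t', h1, h2, h3⟩ := ih' (ω₂ ++ [i]) _ (cs.simple i * t * cs.simple i)
          (by simp at hlen ⊢; omega)
          (by
            rw [← List.append_assoc]
            exact List.nodup_append_comm.mp hω) hb'
          (cs.mem_conjWord.mpr ⟨t, ht, rfl⟩)
        refine ⟨ts', t', by simpa using h1, h2, ?_⟩
        rw [h3, (hb.1.1 t ht).root_conj_simple, wordProd_cons, mul_inv_rev, geom_mul_apply,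
          inv_simple]
        rintro rfl
        exact hi ht
    intro ω ts hlen hω hf hp
    by_contra hc
    have hb : Bad ω ts := ⟨hf, hp, hc⟩
    obtain ⟨t, ht⟩ : ∃ t, t ∈ ts := List.exists_mem_of_ne_nil _ (by
      rintro rfl
      have := hf.3
      simp at this
      omega)
    set c := cs.wordProd ω with hcdef
    have hpow : ∀ k : ℕ, ∃ ts' t', Bad ω ts' ∧ t' ∈ ts' ∧
        cs.root t' = cs.geom (c⁻¹ ^ k) (cs.root t) := by
      intro k
      induction k with
      | zero => exact ⟨ts, t, hb, ht, by simp⟩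
      | succ k ihk =>
        obtain ⟨ts', t', h1, h2, h3⟩ := ihk
        obtain ⟨ts'', t'', h4, h5, h6⟩ := hround ω [] ts' t' (by simpa using hlen)
          (by simpa using hω) (by simpa using h1) h2
        refine ⟨ts'', t'', by simpa using h4, h5, ?_⟩
        rw [h6, h3, pow_succ', geom_mul_apply]
    have hpos : ∀ k : ℕ, 0 ≤ cs.geom (c⁻¹ ^ k) (cs.root t) := by
      intro k
      obtain ⟨ts', t', h1, h2, h3⟩ := hpow k
      rw [← h3]
      exact (h1.1.1 t' h2).root_nonneg
    have hmem : ∀ k : ℕ, cs.geom (c⁻¹ ^ k) (cs.root t) ∈ supp ω := by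
      intro k
      obtain ⟨ts', t', h1, h2, h3⟩ := hpow k
      rw [← h3]
      exact h1.1.root_mem_supp hω h2
    set N := orderOf c⁻¹ with hN
    have hN0 : 0 < N := orderOf_pos _
    -- The sum over a period is fixed by `c⁻¹`, which has no nonzero fixed vector in the span of the
    -- letters. Its summands are nonnegative, so each of them would vanish.
    have hsum : ∑ k ∈ Finset.range N, cs.geom (c⁻¹ ^ k) (cs.root t) = 0 := by
      refine cs.eq_zero_of_geom_inv_wordProd_eq hω (Submodule.sum_mem _ fun k _ => hmem k) ?_
      rw [← hcdef, map_sum]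
      have h1 : ∀ k, cs.geom c⁻¹ (cs.geom (c⁻¹ ^ k) (cs.root t)) =
          cs.geom (c⁻¹ ^ (k + 1)) (cs.root t) := by
        intro k
        rw [pow_succ', geom_mul_apply]
      simp_rw [h1]
      have h2 := Finset.sum_range_succ (fun k => cs.geom (c⁻¹ ^ k) (cs.root t)) N
      rw [Finset.sum_range_succ', pow_zero, hN, pow_orderOf_eq_one] at h2
      exact add_right_cancel h2
    have h0 := (Finset.sum_eq_zero_iff_of_nonneg fun k _ => hpos k).mp hsum 0
      (Finset.mem_range.mpr hN0)
    rw [pow_zero, geom_one_apply] at h0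
    exact (hf.1 t ht).isRoot_root.ne_zero h0

end CoxeterSystem

/-! ### Upward factorizations with nonobtuse angles -/

namespace CoxeterSystem

open CoxeterMatrix

variable {B W : Type*} [Group W] {M : CoxeterMatrix B} (cs : CoxeterSystem M W)
variable [Fintype B] [DecidableEq B]

/-- Every step of the path `u, u t₁, u t₁ t₂, …` goes up in length. -/
def IsUp (u : W) : List W → Prop
  | [] => True
  | t :: ts => 0 ≤ cs.geom u (cs.root t) ∧ IsUp (u * t) ts

theorem isUp_nil (u : W) : cs.IsUp u [] := trivial

theorem isUp_cons {u t : W} {ts : List W} :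
    cs.IsUp u (t :: ts) ↔ 0 ≤ cs.geom u (cs.root t) ∧ cs.IsUp (u * t) ts := Iff.rfl

theorem isUp_append {u : W} {l₁ l₂ : List W} :
    cs.IsUp u (l₁ ++ l₂) ↔ cs.IsUp u l₁ ∧ cs.IsUp (u * l₁.prod) l₂ := by
  induction l₁ generalizing u with
  | nil => simp [isUp_nil]
  | cons t l₁ ih => simp [isUp_cons, ih, and_assoc, mul_assoc]

variable {cs}

theorem IsUp.length_le {u : W} {ts : List W} (h : cs.IsUp u ts)
    (hts : ∀ t ∈ ts, cs.IsReflection t) :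
    cs.length u + ts.length ≤ cs.length (u * ts.prod) := by
  induction ts generalizing u with
  | nil => simp
  | cons t ts ih =>
    have h1 := ih h.2 fun t' h' => hts t' (by simp [h'])
    have h2 := ((hts t (by simp)).lt_length_mul_iff u).mpr h.1
    rw [List.prod_cons, ← mul_assoc, List.length_cons]
    omega

/-- Distinct commuting reflections have orthogonal roots, so each fixes the root of the other and
the sign conditions do not depend on the order. -/
theorem IsUp.swap {u : W} {l : List W} {s t : W} (hs : cs.IsReflection s)
    (ht : cs.IsReflection t) (hst : s * t = t * s) (h : cs.IsUp u (s :: t :: l)) :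
    cs.IsUp u (t :: s :: l) := by
  by_cases he : s = t
  · subst he; exact h
  have h0 := hs.cosForm_eq_zero_of_commute ht he hst
  have h0' : M.cosForm (cs.root t) (cs.root s) = 0 := by rw [cosForm_symm, h0]
  obtain ⟨h1, h2, h3⟩ := h
  rw [geom_mul_apply, hs.geom_apply, h0] at h2
  refine ⟨by simpa using h2, ?_, ?_⟩
  · rw [geom_mul_apply, ht.geom_apply, h0']
    simpa using h1
  · rwa [mul_assoc, ← hst, ← mul_assoc]

theorem CommEquiv.isUp_iff {u : W} {l l' : List W} (h : CommEquiv l l')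
    (hl : ∀ t ∈ l, cs.IsReflection t) : cs.IsUp u l ↔ cs.IsUp u l' := by
  have key := h.iff_of_move (p := fun l => (∀ t ∈ l, cs.IsReflection t) ∧ cs.IsUp u l) (by
    rintro _ _ ⟨l₁, l₂, s, t, hst⟩
    have hm : (∀ x ∈ l₁ ++ s :: t :: l₂, cs.IsReflection x) ↔
        ∀ x ∈ l₁ ++ t :: s :: l₂, cs.IsReflection x :=
      forall_congr' fun x => by simp only [List.mem_append, List.mem_cons]; tauto
    rw [← hm]
    refine and_congr_right fun hr => ?_
    rw [isUp_append, isUp_append]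
    refine and_congr_right fun _ => ?_
    have hs := hr s (by simp)
    have ht := hr t (by simp)
    exact ⟨fun h => h.swap hs ht hst, fun h => h.swap ht hs hst.symm⟩)
  have hl' : ∀ t ∈ l', cs.IsReflection t := fun t ht => hl t (h.perm.mem_iff.mpr ht)
  exact ⟨fun h1 => (key.mp ⟨hl, h1⟩).2, fun h1 => (key.mpr ⟨hl', h1⟩).2⟩

/-- Away from `αᵢ`, conjugation by `sᵢ` acts on positive roots through `sᵢ`, which cancels against
the new starting point `u sᵢ`. -/
theorem IsUp.conjWord {u : W} {ts : List W} (h : cs.IsUp u ts)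
    (hts : ∀ t ∈ ts, cs.IsReflection t) {i : B} (hi : cs.simple i ∉ ts) :
    cs.IsUp (u * cs.simple i) (cs.conjWord i ts) := by
  induction ts generalizing u with
  | nil => exact trivial
  | cons t ts ih =>
    have hne : t ≠ cs.simple i := by
      rintro rfl
      exact hi (by simp)
    refine ⟨?_, ?_⟩
    · rw [(hts t (by simp)).root_conj_simple hne, ← geom_mul_apply,
        simple_mul_simple_cancel_right]
      exact h.1
    · have h1 := ih h.2 (fun t' h' => hts t' (by simp [h'])) (fun h' => hi (by simp [h']))
      have e : u * cs.simple i * (cs.simple i * t * cs.simple i) = u * t * cs.simple i := by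
        simp [mul_assoc]
      rw [e]
      exact h1

variable (cs) in
/-- An upward factorization whose roots make pairwise nonobtuse angles. -/
structure IsAcuteUp (ω : List B) (u : W) (ts : List W) : Prop where
  fact : cs.IsFactorization ω ts
  up : cs.IsUp u ts
  acute : ts.Pairwise fun t t' => 0 ≤ M.cosForm (cs.root t) (cs.root t')

theorem IsAcuteUp.rotate {i : B} {ω : List B} {u : W} {ts : List W}
    (h : cs.IsAcuteUp (i :: ω) u ts) (hi : cs.simple i ∉ ts) :
    cs.IsAcuteUp (ω ++ [i]) (u * cs.simple i) (cs.conjWord i ts) where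
  fact := h.fact.rotate
  up := h.up.conjWord h.fact.1 hi
  acute := cs.pairwise_cosForm_conjWord (p := fun a => 0 ≤ a) h.fact.1 hi h.acute

theorem IsAcuteUp.rotate_symm {i : B} {ω : List B} {u : W} {ts : List W}
    (h : cs.IsAcuteUp (ω ++ [i]) (u * cs.simple i) ts) (hi : cs.simple i ∉ ts) :
    cs.IsAcuteUp (i :: ω) u (cs.conjWord i ts) where
  fact := h.fact.rotate_symm
  up := by
    have := h.up.conjWord h.fact.1 hi
    rwa [simple_mul_simple_cancel_right] at this
  acute := cs.pairwise_cosForm_conjWord (p := fun a => 0 ≤ a) h.fact.1 hi h.acute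

variable [Finite W]

/-- An acute upward factorization of `c = sᵢ c'` that contains `sᵢ` ends with `sᵢ`, up to
commutations, and the other letters are conjugate to an acute upward factorization of `c'`. -/
theorem IsAcuteUp.exists_commEquiv_concat {i : B} {ω : List B} (hω : (i :: ω).Nodup) {u : W}
    {ts : List W} (h : cs.IsAcuteUp (i :: ω) u ts) (hi : cs.simple i ∈ ts) :
    ∃ l : List W, CommEquiv ts (l ++ [cs.simple i]) ∧ cs.simple i ∉ l ∧
      cs.IsUp u (l ++ [cs.simple i]) ∧
      cs.IsAcuteUp ω (u * cs.simple i) (cs.conjWord i l) := by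
  obtain ⟨l₁, l₂, rfl⟩ := List.append_of_mem hi
  have h1 := h.fact.move_back hω h.acute
  have hnd := h1.perm.nodup_iff.mp (h.fact.nodup hω)
  have hnot : cs.simple i ∉ l₁ ++ l₂ := by
    intro hmem
    exact (List.nodup_append.mp hnd).2.2 _ hmem _ (by simp) rfl
  have hup := (h1.isUp_iff h.fact.1).mp h.up
  have hrefl : ∀ t ∈ l₁ ++ l₂, cs.IsReflection t := by
    intro t ht
    refine h.fact.1 t ?_
    simp only [List.mem_append, List.mem_cons] at ht ⊢
    tauto
  refine ⟨l₁ ++ l₂, h1, hnot, hup, ⟨isReflection_of_mem_conjWord hrefl, ?_, ?_⟩,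
    ((cs.isUp_append).mp hup).1.conjWord hrefl hnot,
    cs.pairwise_cosForm_conjWord (p := fun a => 0 ≤ a) hrefl hnot ?_⟩
  · have h2 := h1.prod_eq
    rw [h.fact.2, wordProd_cons, List.prod_append, List.prod_singleton] at h2
    rw [prod_conjWord, mul_assoc, ← h2, simple_mul_simple_cancel_left]
  · have := h.fact.3
    simp only [List.length_append, List.length_cons, conjWord, List.length_map] at this ⊢
    omega
  · exact (List.pairwise_append.mp
      (cs.pairwise_cosForm_perm (p := fun a => 0 ≤ a) h1.perm h.acute)).1

/-- Conversely, if `u c sᵢ < u c`, an acute upward factorization of `c'` gives one of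
`c = sᵢ c'`. -/
theorem IsAcuteUp.concat {i : B} {ω : List B} (hω : (i :: ω).Nodup) {u : W} {ts : List W}
    (h : cs.IsAcuteUp ω (u * cs.simple i) ts)
    (hlt : cs.length (u * cs.wordProd (i :: ω) * cs.simple i) <
      cs.length (u * cs.wordProd (i :: ω))) :
    cs.IsAcuteUp (i :: ω) u (cs.conjWord i ts ++ [cs.simple i]) := by
  rw [List.nodup_cons] at hω
  have hzero : ∀ t ∈ ts, cs.root t i = 0 := fun t ht =>
    h.fact.root_mem_supp hω.2 ht i hω.1
  have hnot : cs.simple i ∉ ts := by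
    intro hmem
    have := hzero _ hmem
    rw [root_simple, simpleRoot_self] at this
    exact one_ne_zero this
  refine ⟨⟨?_, ?_, ?_⟩, ?_, ?_⟩
  · intro t ht
    rw [List.mem_append, List.mem_singleton] at ht
    rcases ht with ht | rfl
    · exact isReflection_of_mem_conjWord h.fact.1 t ht
    · exact cs.isReflection_simple i
  · rw [List.prod_append, prod_conjWord, h.fact.2, wordProd_cons]
    simp [mul_assoc]
  · simp [conjWord, h.fact.3]
  · rw [isUp_append]
    refine ⟨?_, ?_, trivial⟩
    · have := h.up.conjWord h.fact.1 hnot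
      rwa [simple_mul_simple_cancel_right] at this
    · rw [← (cs.isReflection_simple i).lt_length_mul_iff, prod_conjWord, h.fact.2]
      rw [wordProd_cons] at hlt
      simpa [mul_assoc] using hlt
  · rw [List.pairwise_append]
    refine ⟨cs.pairwise_cosForm_conjWord (p := fun a => 0 ≤ a) h.fact.1 hnot h.acute,
      List.pairwise_singleton _ _, ?_⟩
    intro t ht s hs
    rw [List.mem_singleton] at hs
    subst hs
    obtain ⟨t', h', rfl⟩ := cs.mem_conjWord.mp ht
    have hne : t' ≠ cs.simple i := by
      rintro rfl
      exact hnot h'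
    have hr := h.fact.1 t' h'
    -- The root of `t'` has no `αᵢ`-coordinate, so its product with `αᵢ` is nonpositive; applying
    -- `sᵢ` reverses the sign of that product.
    have h1 := M.cosForm_simpleRoot_nonpos_of_nonneg hr.root_nonneg (hzero t' h')
    rw [hr.root_conj_simple hne, root_simple, ← cs.cosForm_geom (cs.simple i),
      ← geom_mul_apply, simple_mul_simple_self, geom_one_apply, geom_simple_simpleRoot, map_neg,
      cosForm_symm]
    linarith

/-- Up to commutations there is exactly one acute upward factorization. -/
theorem exists_isAcuteUp (L : ℕ) (hL : ∀ w, cs.length w ≤ L) (n : ℕ) :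
    ∀ (k : ℕ) (ω : List B) (u : W), L ≤ cs.length u + k → ω.length = n → ω.Nodup →
      cs.length (u * cs.wordProd ω) = cs.length u + n →
      ∃ ts, cs.IsAcuteUp ω u ts ∧ ∀ ts', cs.IsAcuteUp ω u ts' → CommEquiv ts' ts := by
  induction n with
  | zero =>
    intro k ω u _ hn _ _
    rw [List.length_eq_zero_iff] at hn
    subst hn
    refine ⟨[], ⟨⟨by simp, by simp, rfl⟩, trivial, List.Pairwise.nil⟩, fun ts' h' => ?_⟩
    have := h'.fact.3
    rw [List.length_nil, List.length_eq_zero_iff] at this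
    subst this
    exact CommEquiv.refl _
  | succ n ih =>
    intro k
    -- Here `k` bounds the room left above `u`: rotation lengthens `u` by one and keeps the rank,
    -- whereas removal of a letter lowers the rank.
    induction k with
    | zero =>
      intro ω u hk hn hω hlen
      have := hL (u * cs.wordProd ω)
      omega
    | succ k ihk =>
      intro ω u hk hn hω hlen
      obtain ⟨i, ω, rfl⟩ := List.exists_cons_of_length_eq_add_one hn
      have hn' : ω.length = n := by simpa using hn
      have hω' := List.nodup_cons.mp hω
      have hus : cs.length (u * cs.simple i) = cs.length u + 1 := by
        have h1 := cs.length_mul_le (u * cs.simple i) (cs.wordProd ω)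
        rw [mul_assoc, ← wordProd_cons] at h1
        have h2 := cs.length_wordProd_le ω
        have h3 := cs.length_mul_le u (cs.simple i)
        rw [length_simple] at h3
        omega
      -- Whether `sᵢ` occurs as a letter is decided by whether `u c sᵢ` is longer or shorter than `u
      -- c`.
      rcases cs.length_mul_simple (u * cs.wordProd (i :: ω)) i with hup | hdown
      · have hprod : u * cs.simple i * cs.wordProd (ω ++ [i]) =
            u * cs.wordProd (i :: ω) * cs.simple i := by
          rw [wordProd_append, wordProd_singleton, wordProd_cons]
          simp [mul_assoc]
        obtain ⟨ts, hts, huniq⟩ := ihk (ω ++ [i]) (u * cs.simple i) (by omega) (by simpa using hn')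
          (List.nodup_append_comm.mp hω) (by rw [hprod]; omega)
        -- In the rotated factorization `sᵢ` could be moved to the front, but the step from `u sᵢ`
        -- to `u` goes down.
        have hnot : cs.simple i ∉ ts := by
          intro hmem
          obtain ⟨l₁, l₂, rfl⟩ := List.append_of_mem hmem
          have h1 := hts.fact.move_front_last (List.nodup_append_comm.mp hω) hts.acute
          have h2 := ((h1.isUp_iff hts.fact.1).mp hts.up).1
          rw [← (cs.isReflection_simple i).lt_length_mul_iff, simple_mul_simple_cancel_right] at h2
          omega
        refine ⟨cs.conjWord i ts, hts.rotate_symm hnot, fun ts' h' => ?_⟩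
        -- Otherwise `sᵢ` could be moved to the end, and the last step from `u c sᵢ` to `u c` would
        -- go down.
        have hnot' : cs.simple i ∉ ts' := by
          intro hmem
          obtain ⟨l, hl, -, hlup, -⟩ := h'.exists_commEquiv_concat hω hmem
          have h2 := ((cs.isUp_append).mp hlup).2.1
          rw [← (cs.isReflection_simple i).lt_length_mul_iff] at h2
          have h3 := hl.prod_eq
          rw [h'.fact.2, List.prod_append, List.prod_singleton] at h3
          rw [h3, ← mul_assoc, simple_mul_simple_cancel_right] at hup
          omega
        have h1 := (huniq _ (h'.rotate hnot')).conjWord cs i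
        rwa [conjWord_conjWord] at h1
      · obtain ⟨ts, hts, huniq⟩ := ih L ω (u * cs.simple i) (by omega) hn' hω'.2 (by
          rw [mul_assoc, ← wordProd_cons]
          omega)
        refine ⟨_, hts.concat hω (by omega), fun ts' h' => ?_⟩
        -- Without `sᵢ` the conjugated path would climb `n + 1` steps from `u sᵢ` to `u c sᵢ`, which
        -- is too short for that.
        have hmem : cs.simple i ∈ ts' := by
          by_contra hnot
          have h1 := h'.rotate hnot
          have h2 := h1.up.length_le h1.fact.1
          have e : u * cs.simple i * (cs.simple i * cs.wordProd (i :: ω) * cs.simple i) =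
              u * cs.wordProd (i :: ω) * cs.simple i := by
            simp [mul_assoc]
          rw [prod_conjWord, h'.fact.2, e, h1.fact.3, List.length_append] at h2
          simp only [List.length_singleton] at h2
          omega
        obtain ⟨l, hl, -, -, hl'⟩ := h'.exists_commEquiv_concat hω hmem
        have h1 := ((huniq _ hl').conjWord cs i).append_right [cs.simple i]
        rw [conjWord_conjWord] at h1
        exact hl.trans h1

end CoxeterSystem

/-! ### The skew form -/

namespace CoxeterMatrix

variable {B : Type*}

theorem mem_supp_of_full {ω : List B} (h : ∀ i, i ∈ ω) (x : B → ℝ) : x ∈ supp ω :=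
  fun j hj => absurd (h j) hj

variable [DecidableEq B] [Fintype B] (M : CoxeterMatrix B)

/-- The skew form of a word: the antisymmetrization of its Euler form. -/
noncomputable def skew (ω : List B) (x y : B → ℝ) : ℝ := M.euler ω x y - M.euler ω y x

/-- The skew form is nonnegative on the pair, and positive unless the pair is orthogonal. -/
def SkewLE (ω : List B) (x y : B → ℝ) : Prop :=
  0 ≤ M.skew ω x y ∧ (M.skew ω x y = 0 → M.cosForm x y = 0)

theorem skew_swap (ω : List B) (x y : B → ℝ) : M.skew ω y x = -M.skew ω x y := by
  simp [skew]

theorem skew_add_smul (ω : List B) (x x' y : B → ℝ) (a : ℝ) :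
    M.skew ω (x + a • x') y = M.skew ω x y + a * M.skew ω x' y := by
  simp only [skew, map_add, map_smul, LinearMap.add_apply, LinearMap.smul_apply, smul_eq_mul]
  ring

theorem SkewLE.add_smul {ω : List B} {x x' y : B → ℝ} {a : ℝ} (ha : 0 ≤ a)
    (h : M.SkewLE ω x y) (h' : M.SkewLE ω x' y) : M.SkewLE ω (x + a • x') y := by
  rcases ha.eq_or_lt with rfl | ha
  · simpa using h
  have h1 := mul_nonneg ha.le h'.1
  refine ⟨?_, fun h0 => ?_⟩
  · rw [skew_add_smul]
    exact add_nonneg h.1 h1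
  · rw [skew_add_smul] at h0
    have h2 := h.1
    have h3 : a * M.skew ω x' y = 0 := by linarith
    rw [map_add, map_smul, LinearMap.add_apply, LinearMap.smul_apply, h.2 (by linarith),
      h'.2 ((mul_eq_zero.mp h3).resolve_left ha.ne')]
    simp

/-- With `cosForm_simpleRoot_le` this makes the first simple root precede every nonnegative vector
in the skew sense. As a last letter the same root follows all of them. -/
theorem skew_cons_simpleRoot {i : B} {ω : List B} (hω : (i :: ω).Nodup)
    (hfull : ∀ j, j ∈ i :: ω) (y : B → ℝ) :
    M.skew (i :: ω) (simpleRoot i) y = 2 * (y i - M.cosForm (simpleRoot i) y) := by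
  have h1 := M.euler_add_euler (i :: ω) (simpleRoot i) y
  rw [restr_eq_self hω (mem_supp_of_full hfull _), restr_eq_self hω (mem_supp_of_full hfull _)] at h1
  have h2 := M.euler_cons_simpleRoot (List.nodup_cons.mp hω).1 y
  rw [skew]
  linarith

theorem skew_concat_simpleRoot {i : B} {ω : List B} (hω : (ω ++ [i]).Nodup)
    (hfull : ∀ j, j ∈ ω ++ [i]) (y : B → ℝ) :
    M.skew (ω ++ [i]) (simpleRoot i) y = -(2 * (y i - M.cosForm (simpleRoot i) y)) := by
  have h1 := M.euler_add_euler (ω ++ [i]) (simpleRoot i) y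
  rw [restr_eq_self hω (mem_supp_of_full hfull _), restr_eq_self hω (mem_supp_of_full hfull _)] at h1
  have hi : i ∉ ω := (List.nodup_cons.mp (List.nodup_append_comm.mp hω : (i :: ω).Nodup)).1
  have h2 := M.euler_concat_simpleRoot hi y
  rw [skew]
  linarith

theorem cosForm_simpleRoot_le {i : B} {y : B → ℝ} (hy : 0 ≤ y) :
    M.cosForm (simpleRoot i) y ≤ y i := by
  have h1 := M.cosForm_simpleRoot_nonpos_of_nonneg (i := i) (x := y - y i • simpleRoot i) (by
    intro j
    have := hy j
    by_cases hj : j = i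
    · subst hj; simp
    · simpa [simpleRoot_apply, hj] using this) (by simp)
  rw [map_sub, map_smul, cosForm_simpleRoot_self] at h1
  simp only [smul_eq_mul, mul_one] at h1
  linarith

theorem skew_cons_eq_skew_concat {i : B} {ω : List B} {x y : B → ℝ} (hx : x i = 0)
    (hy : y i = 0) : M.skew (i :: ω) x y = M.skew (ω ++ [i]) x y := by
  simp [skew, euler_cons, euler_concat, hx, hy]

end CoxeterMatrix

/-! ### Greedy words and aligned elements -/

namespace CoxeterSystem

open CoxeterMatrix

variable {B W : Type*} [Group W] {M : CoxeterMatrix B} (cs : CoxeterSystem M W)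

/-- The greedy reduced word `η` for `w` along the periodic word `ω ω ω ⋯`, together with the list
of its positions, which are counted from `p`. -/
inductive SortSeq : List B → ℕ → W → List B → List ℕ → Prop
  | nil (ω : List B) (p : ℕ) : SortSeq ω p 1 [] []
  | take {i : B} {ω : List B} {p : ℕ} {w : W} {η : List B} {P : List ℕ}
      (h : cs.IsLeftDescent w i) (h' : SortSeq (ω ++ [i]) (p + 1) (cs.simple i * w) η P) :
      SortSeq (i :: ω) p w (i :: η) (p :: P)
  | skip {i : B} {ω : List B} {p : ℕ} {w : W} {η : List B} {P : List ℕ}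
      (h : ¬ cs.IsLeftDescent w i) (h' : SortSeq (ω ++ [i]) (p + 1) w η P) :
      SortSeq (i :: ω) p w η P

variable {cs}

theorem SortSeq.isReducedWordFor {ω : List B} {p : ℕ} {w : W} {η : List B} {P : List ℕ}
    (h : cs.SortSeq ω p w η P) : cs.IsReducedWordFor η w := by
  induction h with
  | nil => exact ⟨by simp [IsReduced], by simp⟩
  | take hd _ ih =>
    rw [isLeftDescent_iff] at hd
    have e := ih.2
    have h1 := ih.1
    unfold IsReduced at h1
    rw [e] at h1
    refine ⟨?_, by rw [wordProd_cons, e, simple_mul_simple_cancel_left]⟩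
    rw [IsReduced, wordProd_cons, e, simple_mul_simple_cancel_left, List.length_cons]
    omega
  | skip _ _ ih => exact ih

-- A nontrivial element has a descent, which must come up within one turn of the word. The inner
-- induction is on the letters standing before it.
variable (cs) in
theorem exists_sortSeq (n : ℕ) : ∀ (ω : List B) (p : ℕ) (w : W), cs.length w ≤ n →
    (∀ i, i ∈ ω) → ∃ η P, cs.SortSeq ω p w η P := by
  induction n with
  | zero =>
    intro ω p w hw _
    have : w = 1 := cs.length_eq_zero_iff.mp (by omega)
    subst this
    exact ⟨_, _, SortSeq.nil _ _⟩
  | succ n ih =>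
    intro ω p w hw hfull
    by_cases h1 : w = 1
    · subst h1
      exact ⟨_, _, SortSeq.nil _ _⟩
    obtain ⟨j, hj⟩ := cs.exists_leftDescent_of_ne_one h1
    obtain ⟨ω₁, ω₂, rfl⟩ := List.append_of_mem (hfull j)
    induction ω₁ generalizing p ω₂ with
    | nil =>
      obtain ⟨η, P, h⟩ := ih (ω₂ ++ [j]) (p + 1) (cs.simple j * w) (by
        rw [isLeftDescent_iff] at hj
        omega) (fun i => by simpa [or_comm] using hfull i)
      exact ⟨_, _, SortSeq.take hj h⟩
    | cons i ω₁ ih' =>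
      by_cases hi : cs.IsLeftDescent w i
      · obtain ⟨η, P, h⟩ := ih (ω₁ ++ j :: ω₂ ++ [i]) (p + 1) (cs.simple i * w) (by
          rw [isLeftDescent_iff] at hi
          omega) (fun k => by
            have := hfull k
            simp only [List.cons_append, List.mem_cons, List.mem_append] at this ⊢
            tauto)
        exact ⟨_, _, SortSeq.take hi h⟩
      · obtain ⟨η, P, h⟩ := ih' (p + 1) (ω₂ ++ [i]) (fun k => by
          have := hfull k
          simp only [List.cons_append, List.mem_cons, List.mem_append] at this ⊢
          tauto)
        refine ⟨η, P, SortSeq.skip hi ?_⟩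
        simpa using h

theorem isReduced_append_left {η₁ η₂ : List B} (h : cs.IsReduced (η₁ ++ η₂)) :
    cs.IsReduced η₁ := by
  simpa using h.take η₁.length

theorem isReduced_append_right {η₁ η₂ : List B} (h : cs.IsReduced (η₁ ++ η₂)) :
    cs.IsReduced η₂ := by
  simpa using h.drop η₁.length

variable [Fintype B] [DecidableEq B]

variable (cs) in
/-- The positive roots that correspond to the left inversion sequence of a reduced word. -/
noncomputable def rootSeq : List B → List (B → ℝ)
  | [] => []
  | i :: η => simpleRoot i :: (rootSeq η).map (cs.geom (cs.simple i))

theorem rootSeq_append (η₁ η₂ : List B) :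
    cs.rootSeq (η₁ ++ η₂) =
      cs.rootSeq η₁ ++ (cs.rootSeq η₂).map (cs.geom (cs.wordProd η₁)) := by
  induction η₁ with
  | nil => simp [rootSeq, Module.End.one_eq_id]
  | cons i η₁ ih =>
    simp only [List.cons_append, rootSeq, ih, List.map_append, List.map_map, wordProd_cons,
      map_mul, Module.End.mul_eq_comp, LinearMap.coe_comp]

theorem mem_rootSeq {η : List B} {r : B → ℝ} (h : r ∈ cs.rootSeq η) :
    ∃ η₁ j η₂, η = η₁ ++ j :: η₂ ∧ r = cs.geom (cs.wordProd η₁) (simpleRoot j) := by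
  induction η generalizing r with
  | nil => simp [rootSeq] at h
  | cons i η ih =>
    simp only [rootSeq, List.mem_cons, List.mem_map] at h
    rcases h with rfl | ⟨r', h', rfl⟩
    · exact ⟨[], i, η, rfl, by simp⟩
    · obtain ⟨η₁, j, η₂, rfl, rfl⟩ := ih h'
      exact ⟨i :: η₁, j, η₂, rfl, by rw [wordProd_cons, geom_mul_apply]⟩

theorem geom_wordProd_nonneg_of_isReduced {η₁ η₂ : List B} {j : B}
    (h : cs.IsReduced (η₁ ++ j :: η₂)) : 0 ≤ cs.geom (cs.wordProd η₁) (simpleRoot j) := by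
  apply cs.geom_simpleRoot_nonneg
  have h1 : cs.IsReduced (η₁ ++ [j]) := by
    have e : η₁ ++ j :: η₂ = (η₁ ++ [j]) ++ η₂ := by simp
    rw [e] at h
    exact isReduced_append_left h
  have h2 := isReduced_append_left h1
  unfold IsReduced at h1 h2
  rw [wordProd_append, wordProd_singleton, List.length_append, List.length_singleton] at h1
  omega

theorem rootSeq_spec {η : List B} (hη : cs.IsReduced η) {r : B → ℝ} (h : r ∈ cs.rootSeq η) :
    cs.IsRoot r ∧ 0 ≤ r ∧ cs.geom (cs.wordProd η)⁻¹ r ≤ 0 := by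
  obtain ⟨η₁, j, η₂, rfl, rfl⟩ := mem_rootSeq h
  refine ⟨⟨_, _, rfl⟩, geom_wordProd_nonneg_of_isReduced hη, ?_⟩
  have h1 : cs.IsReduced (j :: η₂) := isReduced_append_right hη
  have h2 : cs.IsReduced η₂ := isReduced_append_right (η₁ := [j]) h1
  unfold IsReduced at h1 h2
  rw [wordProd_append, mul_inv_rev, geom_mul_apply, geom_inv_geom]
  have h3 : cs.IsLeftDescent (cs.wordProd (j :: η₂)) j := by
    unfold IsLeftDescent
    rw [h1, wordProd_cons, simple_mul_simple_cancel_left, h2]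
    simp
  exact isLeftDescent_iff_geom.mp h3

theorem map_root_leftInvSeq {η : List B} (hη : cs.IsReduced η) :
    (cs.leftInvSeq η).map cs.root = cs.rootSeq η := by
  induction η with
  | nil => rfl
  | cons i η ih =>
    have hη' : cs.IsReduced η := isReduced_append_right (η₁ := [i]) hη
    rw [leftInvSeq, rootSeq, List.map_cons, root_simple, ← ih hη', List.map_map, List.map_map]
    congr 1
    refine List.map_congr_left fun t ht => ?_
    have hr := cs.isReflection_of_mem_leftInvSeq η ht
    have hm : cs.geom (cs.simple i) (cs.root t) ∈ cs.rootSeq (i :: η) := by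
      rw [rootSeq, ← ih hη']
      exact List.mem_cons_of_mem _ (List.mem_map_of_mem (List.mem_map_of_mem ht))
    exact hr.root_conj (rootSeq_spec hη hm).2.1

theorem mem_leftInvSeq_of_geom_nonpos (η : List B) {t : W} (ht : cs.IsReflection t)
    (h : cs.geom (cs.wordProd η)⁻¹ (cs.root t) ≤ 0) : t ∈ cs.leftInvSeq η := by
  induction η generalizing t with
  | nil =>
    rw [wordProd_nil, inv_one, geom_one_apply] at h
    exact absurd h (ht.isRoot_root.not_nonpos ht.root_nonneg)
  | cons i η ih =>
    by_cases hi : t = cs.simple i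
    · subst hi
      simp [leftInvSeq]
    · rw [wordProd_cons, mul_inv_rev, inv_simple, geom_mul_apply, ← ht.root_conj_simple hi] at h
      have h1 := ih (ht.conj_simple i) h
      rw [leftInvSeq, List.mem_cons, List.mem_map]
      refine Or.inr ⟨_, h1, ?_⟩
      simp [mul_assoc]

variable (cs) in
/-- The element `w` is aligned with the word `ω`: in every positive combination of two positive
roots that is an inversion of `w`, the root that comes first is an inversion of `w`, too. -/
def Aligned (ω : List B) (w : W) : Prop :=
  ∀ (α γ : B → ℝ) (a b : ℝ), cs.IsRoot α → 0 ≤ α → cs.IsRoot γ → 0 ≤ γ → 0 < a → 0 < b →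
    cs.IsRoot (a • α + b • γ) → 0 < M.skew ω α γ → cs.geom w⁻¹ (a • α + b • γ) ≤ 0 →
    cs.geom w⁻¹ α ≤ 0

theorem skew_rotate {i : B} {ω : List B} (hω : (i :: ω).Nodup) (hfull : ∀ j, j ∈ i :: ω)
    (x y : B → ℝ) :
    M.skew (i :: ω) (cs.geom (cs.simple i) x) (cs.geom (cs.simple i) y) =
      M.skew (ω ++ [i]) x y := by
  have h := fun x y => cs.euler_rotate hω (mem_supp_of_full hfull x) (mem_supp_of_full hfull y)
  rw [skew, ← h, ← h, skew]
  simp only [← geom_mul_apply, simple_mul_simple_self, geom_one_apply]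

/-- Apply `sᵢ` to the two roots; this transports the skew form. In the rotated word `αᵢ` is last, so
`α` cannot be `αᵢ`. If `γ` is `αᵢ`, its image under `sᵢ` is negative and alignment does not apply,
but the descent at `i` gives the conclusion directly. -/
theorem Aligned.take {i : B} {ω : List B} (hω : (i :: ω).Nodup) (hfull : ∀ j, j ∈ i :: ω) {w : W}
    (h : cs.Aligned (i :: ω) w) (hd : cs.IsLeftDescent w i) :
    cs.Aligned (ω ++ [i]) (cs.simple i * w) := by
  intro α γ a b hα hα0 hγ hγ0 ha hb hβ hs hinv
  have hω' : (ω ++ [i]).Nodup := List.nodup_append_comm.mp hω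
  have hfull' : ∀ j, j ∈ ω ++ [i] := fun j => by simpa [or_comm] using hfull j
  rw [mul_inv_rev, inv_simple, geom_mul_apply] at hinv ⊢
  rw [isLeftDescent_iff_geom] at hd
  have hαi : α ≠ simpleRoot i := by
    rintro rfl
    rw [M.skew_concat_simpleRoot hω' hfull'] at hs
    have := M.cosForm_simpleRoot_le (i := i) hγ0
    linarith
  by_cases hγi : γ = simpleRoot i
  · subst hγi
    rw [map_add, map_smul, map_smul, geom_simple_simpleRoot, map_add, map_smul, map_smul,
      map_neg] at hinv
    intro j
    have h1 := hinv j
    have h2 := hd j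
    simp only [Pi.add_apply, Pi.smul_apply, Pi.neg_apply, Pi.zero_apply, smul_eq_mul] at h1 h2 ⊢
    have h3 : b * cs.geom w⁻¹ (simpleRoot i) j ≤ 0 := mul_nonpos_of_nonneg_of_nonpos hb.le h2
    by_contra hcon
    push Not at hcon
    have := mul_pos ha hcon
    linarith
  · have e : cs.geom (cs.simple i) (a • α + b • γ) =
        a • cs.geom (cs.simple i) α + b • cs.geom (cs.simple i) γ := by
      rw [map_add, map_smul, map_smul]
    rw [e] at hinv
    refine h _ _ a b (hα.geom _) (hα.geom_simple_nonneg hα0 hαi) (hγ.geom _)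
      (hγ.geom_simple_nonneg hγ0 hγi) ha hb (by rw [← e]; exact hβ.geom _) ?_ hinv
    rwa [skew_rotate hω hfull]

/-- On vectors without `i`-th coordinate the two skew forms agree, and nonnegative summands of such
a vector have no `i`-th coordinate either. -/
theorem Aligned.skip {i : B} {ω : List B} {w : W} (h : cs.Aligned (i :: ω) w)
    (hinv : ∀ β, cs.IsRoot β → 0 ≤ β → cs.geom w⁻¹ β ≤ 0 → β i = 0) :
    cs.Aligned (ω ++ [i]) w := by
  intro α γ a b hα hα0 hγ hγ0 ha hb hβ hs hi
  have h1 := hinv _ hβ (add_nonneg (smul_nonneg ha.le hα0) (smul_nonneg hb.le hγ0)) hi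
  simp only [Pi.add_apply, Pi.smul_apply, smul_eq_mul] at h1
  have hαi : 0 ≤ α i := hα0 i
  have hγi : 0 ≤ γ i := hγ0 i
  have hα1 : α i = 0 := by nlinarith [mul_nonneg ha.le hαi, mul_nonneg hb.le hγi]
  have hγ1 : γ i = 0 := by nlinarith [mul_nonneg ha.le hαi, mul_nonneg hb.le hγi]
  refine h α γ a b hα hα0 hγ hγ0 ha hb hβ ?_ hi
  rwa [M.skew_cons_eq_skew_concat hα1 hγ1]

/-- The root `η αᵢ` is `αᵢ` plus a nonnegative combination of the inversion roots along `η`, and the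
skew relation to `r` is preserved by such combinations. -/
theorem skewLE_geom_wordProd {ω : List B} {i : B} {r : B → ℝ} (hi : M.SkewLE ω (simpleRoot i) r)
    (η : List B) (hη : i ∉ η) (h : ∀ r' ∈ cs.rootSeq η, M.SkewLE ω r' r) :
    M.SkewLE ω (cs.geom (cs.wordProd η) (simpleRoot i)) r := by
  induction η using List.reverseRecOn with
  | nil => simpa using hi
  | append_singleton η j ih =>
    rw [rootSeq_append] at h
    have hij : j ≠ i := by
      rintro rfl
      simp at hη
    have h1 := ih (fun h' => hη (by simp [h'])) fun r' h' => h r' (by simp [h'])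
    have h2 : M.SkewLE ω (cs.geom (cs.wordProd η) (simpleRoot j)) r :=
      h _ (by simp [rootSeq])
    have e : cs.geom (cs.wordProd (η ++ [j])) (simpleRoot i) =
        cs.geom (cs.wordProd η) (simpleRoot i) +
          (-(2 * M.cosForm (simpleRoot j) (simpleRoot i))) •
            cs.geom (cs.wordProd η) (simpleRoot j) := by
      rw [wordProd_append, wordProd_singleton, geom_mul_apply, geom_simple_apply, map_sub,
        map_smul]
      module
    rw [e]
    refine SkewLE.add_smul M ?_ h1 h2
    have := M.cosForm_simpleRoot_nonpos hij
    linarith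

theorem skewLE_simpleRoot {i : B} {ω : List B} (hω : (i :: ω).Nodup) (hfull : ∀ j, j ∈ i :: ω)
    {r : B → ℝ} (hr : cs.IsRoot r) (h0 : 0 ≤ r) (hne : r ≠ simpleRoot i) :
    M.SkewLE (i :: ω) (simpleRoot i) r := by
  rw [SkewLE, M.skew_cons_simpleRoot hω hfull]
  have h1 := M.cosForm_simpleRoot_le (i := i) h0
  refine ⟨by linarith, fun h => ?_⟩
  have h2 := hr.geom_simple_nonneg h0 hne i
  rw [geom_simple_apply] at h2
  simp only [Pi.zero_apply, Pi.sub_apply, Pi.smul_apply, simpleRoot_self, smul_eq_mul] at h2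
  have h3 := h0 i
  rw [Pi.zero_apply] at h3
  linarith

/-- If the first letter is not a descent of an aligned element `w`, then the inversions of `w`
do not involve that letter. -/
theorem Aligned.apply_eq_zero {i : B} {ω : List B} (hω : (i :: ω).Nodup)
    (hfull : ∀ j, j ∈ i :: ω) {w : W} (h : cs.Aligned (i :: ω) w) (hd : ¬ cs.IsLeftDescent w i)
    (ih : ∀ v, cs.length v < cs.length w → cs.Aligned (i :: ω) v →
      ∃ η, cs.IsReducedWordFor η v ∧ (cs.rootSeq η).Pairwise (M.SkewLE (i :: ω)))
    {β : B → ℝ} (hβ0 : 0 ≤ β) (hinv : cs.geom w⁻¹ β ≤ 0) : β i = 0 := by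
  classical
  -- The longest prefix `v` of `w` that avoids the letter `i`, that is, the parabolic factor of `w`;
  -- the remaining factor can then have only `i` as a left descent.
  let p : ℕ → Prop := fun k => ∃ ζ : List B, i ∉ ζ ∧ cs.length (cs.wordProd ζ) = k ∧
    k + cs.length ((cs.wordProd ζ)⁻¹ * w) = cs.length w
  have hp0 : p 0 := ⟨[], by simp, by simp, by simp⟩
  have hb : ∀ k, p k → k ≤ cs.length w := by
    rintro k ⟨ζ, -, -, h⟩
    omega
  have hpk := Nat.findGreatest_spec (hb 0 hp0) hp0
  have hmax : ¬ p (Nat.findGreatest p (cs.length w) + 1) := fun h =>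
    absurd (Nat.le_findGreatest (hb _ h) h) (by omega)
  generalize Nat.findGreatest p (cs.length w) = k at hpk hmax
  obtain ⟨ζ, hζ, hk, hlen⟩ := hpk
  set v := cs.wordProd ζ with hv
  have hvi : ∀ x, cs.geom v⁻¹ x i = x i := cs.geom_wordProd_inv_apply_of_notMem hζ
  have hβi : 0 ≤ β i := hβ0 i
  by_cases hvw : v⁻¹ * w = 1
  · have : v = w := by rwa [inv_mul_eq_one] at hvw
    have h1 := hinv i
    rw [← this, hvi] at h1
    exact le_antisymm h1 hβi
  exfalso
  have hdj : ∀ j, j ≠ i → ¬ cs.IsLeftDescent (v⁻¹ * w) j := by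
    intro j hj hjd
    rw [isLeftDescent_iff] at hjd
    have e : (v * cs.simple j)⁻¹ * w = cs.simple j * (v⁻¹ * w) := by simp [mul_assoc]
    have h1 := cs.length_mul_le (v * cs.simple j) ((v * cs.simple j)⁻¹ * w)
    rw [mul_inv_cancel_left, e] at h1
    have h2 := cs.length_mul_simple v j
    refine hmax ⟨ζ ++ [j], by simp [hζ, Ne.symm hj], ?_, ?_⟩
    · rw [wordProd_append, wordProd_singleton, ← hv]
      omega
    · rw [wordProd_append, wordProd_singleton, ← hv, e]
      omega
  have hdi : cs.IsLeftDescent (v⁻¹ * w) i := by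
    obtain ⟨j, hj⟩ := cs.exists_leftDescent_of_ne_one hvw
    by_cases hji : j = i
    · subst hji; exact hj
    · exact absurd hj (hdj j hji)
  have hw : ∀ x, cs.geom w⁻¹ x = cs.geom (v⁻¹ * w)⁻¹ (cs.geom v⁻¹ x) := by
    intro x
    rw [← geom_mul_apply, mul_inv_rev, inv_inv, mul_inv_cancel_right]
  -- The inverse of the remaining factor keeps all simple roots other than `αᵢ` positive.
  have hcone : ∀ x, 0 ≤ x → x i = 0 → 0 ≤ cs.geom (v⁻¹ * w)⁻¹ x := by
    intro x hx hxi
    rw [← sum_smul_simpleRoot x, map_sum]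
    refine Finset.sum_nonneg fun j _ => ?_
    rw [map_smul]
    by_cases hj : j = i
    · subst hj; simp [hxi]
    · refine smul_nonneg (hx j) ?_
      have h1 := hdj j hj
      rw [isLeftDescent_iff_geom, ((cs.isRoot_simpleRoot j).geom _).not_nonpos_iff] at h1
      exact h1
  -- The inversions of `v` are exactly the inversions of `w` without `αᵢ`-coordinate, so `v`
  -- inherits alignment and, being shorter, falls under `ih`.
  have hinv_v : ∀ δ, cs.IsRoot δ → 0 ≤ δ →
      (cs.geom v⁻¹ δ ≤ 0 ↔ δ i = 0 ∧ cs.geom w⁻¹ δ ≤ 0) := by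
    intro δ hδ hδ0
    constructor
    · intro hle
      have h1 := hle i
      rw [hvi] at h1
      have h2 : δ i = 0 := le_antisymm h1 (hδ0 i)
      refine ⟨h2, ?_⟩
      have h3 := hcone (-cs.geom v⁻¹ δ) (neg_nonneg.mpr hle) (by simp [hvi, h2])
      rw [map_neg, ← hw] at h3
      exact neg_nonneg.mp h3
    · rintro ⟨h1, h2⟩
      by_contra hcon
      rw [(hδ.geom _).not_nonpos_iff] at hcon
      have h3 := hcone _ hcon (by rw [hvi, h1])
      rw [← hw] at h3
      exact (hδ.geom _).not_nonpos h3 h2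
  have hv_aligned : cs.Aligned (i :: ω) v := by
    intro α γ a b hα hα0 hγ hγ0 ha hb hδ hs hle
    rw [hinv_v _ hδ (add_nonneg (smul_nonneg ha.le hα0) (smul_nonneg hb.le hγ0))] at hle
    rw [hinv_v _ hα hα0]
    refine ⟨?_, h α γ a b hα hα0 hγ hγ0 ha hb hδ hs hle.2⟩
    have h1 := hle.1
    simp only [Pi.add_apply, Pi.smul_apply, smul_eq_mul] at h1
    have hαi : 0 ≤ α i := hα0 i
    have hγi : 0 ≤ γ i := hγ0 i
    nlinarith [mul_nonneg ha.le hαi, mul_nonneg hb.le hγi]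
  have hvlt : cs.length v < cs.length w := by
    have : cs.length (v⁻¹ * w) ≠ 0 := fun h0 => hvw (cs.length_eq_zero_iff.mp h0)
    omega
  obtain ⟨η, ⟨hηr, hηv⟩, hpw⟩ := ih v hvlt hv_aligned
  have hroot : ∀ r ∈ cs.rootSeq η, cs.IsRoot r ∧ 0 ≤ r ∧ r i = 0 := by
    intro r hr
    obtain ⟨h1, h2, h3⟩ := rootSeq_spec hηr hr
    rw [hηv, hinv_v r h1 h2] at h3
    exact ⟨h1, h2, h3.1⟩
  have hletters : ∀ η₁ η₂, η = η₁ ++ η₂ → i ∉ η₁ := by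
    intro η₁
    induction η₁ using List.reverseRecOn with
    | nil => simp
    | append_singleton η₁ j ihη =>
      intro η₂ e
      have h1 := ihη (j :: η₂) (by simpa using e)
      have h2 := (hroot (cs.geom (cs.wordProd η₁) (simpleRoot j)) (by
        rw [e, rootSeq_append, rootSeq_append]
        simp [rootSeq])).2.2
      rw [cs.geom_wordProd_apply_of_notMem h1, simpleRoot_apply] at h2
      have h3 : i ≠ j := by
        intro hij
        simp [hij] at h2
      simp [h1, h3]
  -- Starting from `v αᵢ`, which is an inversion of `w`, letters of the word for `v` are removed
  -- from the right. At each removal the current root is a positive combination of `η₁ αᵢ` and `η₁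
  -- αⱼ`, unless `αᵢ` and `αⱼ` are orthogonal and it does not change. The first of the two precedes
  -- the second in the skew sense, so alignment makes it an inversion. At the end `αᵢ` itself is
  -- one, contrary to `hd`.
  have hdesc : ∀ η₂ η₁, η = η₁ ++ η₂ →
      cs.geom w⁻¹ (cs.geom (cs.wordProd η₁) (simpleRoot i)) ≤ 0 := by
    intro η₂
    induction η₂ with
    | nil =>
      intro η₁ e
      rw [List.append_nil] at e
      rw [← e, hηv, hw, geom_inv_geom]
      exact isLeftDescent_iff_geom.mp hdi
    | cons j η₂ ihη =>
      intro η₁ e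
      have h1 := ihη (η₁ ++ [j]) (by simpa using e)
      have hi1 := hletters _ _ e
      have hij : i ≠ j := by
        have := hletters (η₁ ++ [j]) η₂ (by simpa using e)
        simp only [List.mem_append, List.mem_singleton, not_or] at this
        exact this.2
      set x := cs.geom (cs.wordProd η₁) (simpleRoot i) with hx
      set r := cs.geom (cs.wordProd η₁) (simpleRoot j) with hr
      set k := M.cosForm (simpleRoot j) (simpleRoot i) with hk
      have e2 : cs.geom (cs.wordProd (η₁ ++ [j])) (simpleRoot i) = (1 : ℝ) • x + (-(2 * k)) • r := by
        rw [wordProd_append, wordProd_singleton, geom_mul_apply, geom_simple_apply, map_sub,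
          map_smul, one_smul]
        module
      have hk0 : k ≤ 0 := M.cosForm_simpleRoot_nonpos hij.symm
      rcases hk0.eq_or_lt with hk0 | hk0
      · rw [e2, hk0] at h1
        simpa using h1
      have hrm : r ∈ cs.rootSeq η := by
        rw [e, rootSeq_append]
        simp [rootSeq, hr]
      have hxroot : cs.IsRoot x := (cs.isRoot_simpleRoot i).geom _
      have hx1 : x i = 1 := by
        rw [hx, cs.geom_wordProd_apply_of_notMem hi1, simpleRoot_self]
      have hx0 : 0 ≤ x := by
        rw [← hxroot.not_nonpos_iff]
        intro hcon
        have := hcon i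
        rw [hx1, Pi.zero_apply] at this
        linarith
      obtain ⟨hr1, hr2, hr3⟩ := hroot r hrm
      have hrne : r ≠ simpleRoot i := by
        intro hcon
        rw [hcon, simpleRoot_self] at hr3
        exact one_ne_zero hr3
      have hskew : M.SkewLE (i :: ω) x r := by
        refine skewLE_geom_wordProd (skewLE_simpleRoot hω hfull hr1 hr2 hrne) η₁ hi1 ?_
        intro r' hr'
        rw [e, rootSeq_append] at hpw
        exact (List.pairwise_append.mp hpw).2.2 r' hr' r (by simp [rootSeq, hr])
      have hne : M.cosForm x r ≠ 0 := by
        rw [hx, hr, cosForm_geom, cosForm_symm]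
        exact hk0.ne
      refine h x r 1 (-(2 * k)) hxroot hx0 hr1 hr2 one_pos (by linarith) ?_
        (lt_of_le_of_ne hskew.1 fun h0 => hne (hskew.2 h0.symm)) (by rw [← e2]; exact h1)
      rw [← e2]
      exact (cs.isRoot_simpleRoot i).geom _
  have := hdesc η [] (by simp)
  rw [wordProd_nil, geom_one_apply] at this
  exact hd (isLeftDescent_iff_geom.mpr this)

/-- The inversion roots of the greedy word of an aligned element are ordered by the skew form. -/
theorem SortSeq.pairwise_skewLE (n : ℕ) : ∀ {ω : List B} {p : ℕ} {w : W} {η : List B}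
    {P : List ℕ}, cs.SortSeq ω p w η P → ω.Nodup → (∀ j, j ∈ ω) → cs.length w ≤ n →
    cs.Aligned ω w → (cs.rootSeq η).Pairwise (M.SkewLE ω) := by
  -- The outer induction on length serves the skipped letters, where `Aligned.apply_eq_zero` needs
  -- the result for shorter elements along the same word.
  induction n using Nat.strong_induction_on with
  | _ n IH =>
  intro ω p w η P h
  induction h with
  | nil =>
    intros
    exact List.Pairwise.nil
  | @take i ω p w η P hd h' ih =>
    intro hω hfull hn hal
    have hred : cs.IsReduced (i :: η) := (SortSeq.take hd h').isReducedWordFor.1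
    have hred' : cs.IsReduced η := h'.isReducedWordFor.1
    rw [isLeftDescent_iff] at hd
    have h1 := ih (List.nodup_append_comm.mp hω) (fun j => by simpa [or_comm] using hfull j)
      (by omega) (hal.take hω hfull (cs.isLeftDescent_iff.mpr hd))
    rw [rootSeq, List.pairwise_cons, List.pairwise_map]
    constructor
    · intro r hr
      have h2 := rootSeq_spec hred (List.mem_cons_of_mem _ hr)
      refine skewLE_simpleRoot hω hfull h2.1 h2.2.1 ?_
      rintro rfl
      obtain ⟨r', hr', he⟩ := List.mem_map.mp hr
      have h3 := rootSeq_spec hred' hr'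
      have h4 : r' = -simpleRoot i := by
        rw [← geom_simple_simpleRoot cs, ← he, ← geom_mul_apply, simple_mul_simple_self,
          geom_one_apply]
      rw [h4] at h3
      exact (cs.isRoot_simpleRoot i).not_nonpos (simpleRoot_nonneg i) (neg_nonneg.mp h3.2.1)
    · refine h1.imp fun {x y} hxy => ?_
      rw [SkewLE, skew_rotate hω hfull, cosForm_geom]
      exact hxy
  | @skip i ω p w η P hd h' ih =>
    intro hω hfull hn hal
    have hinv : ∀ β, cs.IsRoot β → 0 ≤ β → cs.geom w⁻¹ β ≤ 0 → β i = 0 := by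
      intro β _ hβ0 hle
      refine hal.apply_eq_zero hω hfull hd (fun v hv hval => ?_) hβ0 hle
      obtain ⟨η', P', hs⟩ := cs.exists_sortSeq _ (i :: ω) 0 v le_rfl hfull
      exact ⟨η', hs.isReducedWordFor, IH _ (by omega) hs hω hfull le_rfl hval⟩
    have h1 := ih (List.nodup_append_comm.mp hω) (fun j => by simpa [or_comm] using hfull j)
      hn (hal.skip hinv)
    have hred := h'.isReducedWordFor
    refine h1.imp_of_mem fun {x y} hx hy hxy => ?_
    have hx1 := rootSeq_spec hred.1 hx
    have hy1 := rootSeq_spec hred.1 hy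
    rw [hred.2] at hx1 hy1
    rw [SkewLE, M.skew_cons_eq_skew_concat (hinv x hx1.1 hx1.2.1 hx1.2.2)
      (hinv y hy1.1 hy1.2.1 hy1.2.2)]
    exact hxy

end CoxeterSystem

/-! ### Greedy words are the lexicographically first subwords -/

namespace CoxeterSystem

open CoxeterMatrix

section Positions

/-- The positions `(k, i)` of a periodic word are ordered as the natural numbers `k n + i`. -/
noncomputable def positionIso {n : ℕ} (hn : 0 < n) : ℕ ×ₗ Fin n ≃o ℕ :=
  StrictMono.orderIsoOfRightInverse (fun q => (ofLex q).1 * n + (ofLex q).2)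
    (by
      intro a b h
      rw [Prod.Lex.lt_iff] at h
      have ha := (ofLex a).2.isLt
      rcases h with h | ⟨h, h'⟩
      · have : ((ofLex a).1 + 1) * n ≤ (ofLex b).1 * n := Nat.mul_le_mul_right _ h
        dsimp only
        rw [add_mul, one_mul] at this
        omega
      · have h'' : ((ofLex a).2 : ℕ) < (ofLex b).2 := h'
        dsimp only
        rw [h]
        omega)
    (fun m => toLex (m / n, ⟨m % n, Nat.mod_lt _ hn⟩))
    (by
      intro m
      simp [Nat.div_add_mod'])

theorem list_nil_le {α : Type*} [LinearOrder α] (l : List α) : [] ≤ l := by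
  cases l with
  | nil => exact le_rfl
  | cons a l => exact le_of_lt List.Lex.nil

end Positions

variable {B W : Type*} [Group W] {M : CoxeterMatrix B} {cs : CoxeterSystem M W}

theorem rotate_add_one_of_eq_cons {i : B} {ω ω₀ : List B} {p : ℕ} (h : i :: ω = ω₀.rotate p) :
    ω ++ [i] = ω₀.rotate (p + 1) := by
  rw [← List.rotate_rotate, ← h, List.rotate_cons_succ, List.rotate_zero]

theorem get_positionIso_of_eq_cons {i : B} {ω ω₀ : List B} (hn : 0 < ω₀.length) {p : ℕ}
    (h : i :: ω = ω₀.rotate p) : ω₀.get (ofLex ((positionIso hn).symm p)).2 = i := by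
  have h1 := congrArg (fun l => l[0]?) h
  simp only [List.getElem?_cons_zero] at h1
  rw [List.getElem?_rotate hn, zero_add, List.getElem?_eq_getElem (Nat.mod_lt _ hn)] at h1
  exact (Option.some.inj h1).symm

theorem SortSeq.lettersAt_eq {ω₀ : List B} (hn : 0 < ω₀.length) {ω : List B} {p : ℕ} {w : W}
    {η : List B} {P : List ℕ} (h : cs.SortSeq ω p w η P) (hω : ω = ω₀.rotate p) :
    lettersAt ω₀ (P.map (positionIso hn).symm) = η ∧ (∀ q ∈ P, p ≤ q) ∧
      P.Pairwise (· < ·) := by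
  induction h with
  | nil => simp [lettersAt]
  | take _ _ ih =>
    obtain ⟨h1, h2, h3⟩ := ih (rotate_add_one_of_eq_cons hω)
    refine ⟨?_, ?_, List.pairwise_cons.mpr ⟨fun q hq => h2 q hq, h3⟩⟩
    · rw [List.map_cons, lettersAt, List.map_cons, get_positionIso_of_eq_cons hn hω, ← lettersAt,
        h1]
    · intro q hq
      rcases List.mem_cons.mp hq with rfl | hq
      · exact le_rfl
      · exact (Nat.le_succ _).trans (h2 q hq)
  | skip _ _ ih =>
    obtain ⟨h1, h2, h3⟩ := ih (rotate_add_one_of_eq_cons hω)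
    exact ⟨h1, fun q hq => (Nat.le_succ _).trans (h2 q hq), h3⟩

theorem IsReducedWordFor.tail {i : B} {η : List B} {w : W} (h : cs.IsReducedWordFor (i :: η) w) :
    cs.IsLeftDescent w i ∧ cs.IsReducedWordFor η (cs.simple i * w) := by
  obtain ⟨h1, rfl⟩ := h
  have h2 : cs.IsReduced η := isReduced_append_right (η₁ := [i]) h1
  refine ⟨?_, h2, by rw [wordProd_cons, simple_mul_simple_cancel_left]⟩
  unfold IsReduced at h1 h2
  rw [IsLeftDescent, h1, wordProd_cons, simple_mul_simple_cancel_left, h2, List.length_cons]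
  omega

/-- At a taken position, a competitor either uses it as well or starts later and is
lexicographically larger. At a skipped position, no competitor can start, since the first letter of
a reduced word is a left descent. -/
theorem SortSeq.le {ω₀ : List B} (hn : 0 < ω₀.length) {ω : List B} {p : ℕ} {w : W}
    {η : List B} {P : List ℕ} (h : cs.SortSeq ω p w η P) (hω : ω = ω₀.rotate p) :
    ∀ Q : List (ℕ ×ₗ Fin ω₀.length), Q.Pairwise (· < ·) →
      (∀ q ∈ Q, (positionIso hn).symm p ≤ q) →
      cs.IsReducedWordFor (lettersAt ω₀ Q) w → P.map (positionIso hn).symm ≤ Q := by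
  have hsucc : ∀ (p : ℕ) (q : ℕ ×ₗ Fin ω₀.length), (positionIso hn).symm p < q →
      (positionIso hn).symm (p + 1) ≤ q := by
    intro p q h
    rw [OrderIso.symm_apply_le]
    rw [OrderIso.symm_apply_lt] at h
    exact h
  induction h with
  | nil =>
    intro Q _ _ _
    exact list_nil_le Q
  | @take i ω p w η P hd _ ih =>
    intro Q hQ hQp hQw
    cases Q with
    | nil =>
      have : w = 1 := by rw [← hQw.2]; simp [lettersAt]
      subst this
      exact absurd hd (cs.not_isLeftDescent_one i)
    | cons q Q =>
      rw [List.map_cons]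
      have hQ' := List.pairwise_cons.mp hQ
      rcases (hQp q (by simp)).eq_or_lt with he | hlt
      · rw [he]
        apply List.cons_le_cons
        have hi := get_positionIso_of_eq_cons hn hω
        rw [he] at hi
        rw [lettersAt, List.map_cons, ← lettersAt, hi] at hQw
        refine ih (rotate_add_one_of_eq_cons hω) Q hQ'.2 (fun q' hq' => hsucc _ _ ?_) hQw.tail.2
        rw [he]
        exact hQ'.1 q' hq'
      · exact le_of_lt (List.Lex.rel hlt)
  | @skip i ω p w η P hd _ ih =>
    intro Q hQ hQp hQw
    refine ih (rotate_add_one_of_eq_cons hω) Q hQ (fun q hq => hsucc _ _ ?_) hQw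
    cases Q with
    | nil => simp at hq
    | cons q₀ Q =>
      have hne : (positionIso hn).symm p ≠ q₀ := by
        intro he
        have hi := get_positionIso_of_eq_cons hn hω
        rw [he] at hi
        rw [lettersAt, List.map_cons, ← lettersAt, hi] at hQw
        exact hd hQw.tail.1
      have hlt := lt_of_le_of_ne (hQp q₀ (by simp)) hne
      rcases List.mem_cons.mp hq with rfl | hq
      · exact hlt
      · exact hlt.trans ((List.pairwise_cons.mp hQ).1 q hq)

/-- The greedy word is the sorting word. -/
theorem SortSeq.isSortingWord {ω : List B} {w : W} {η : List B} {P : List ℕ}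
    (h : cs.SortSeq ω 0 w η P) : cs.IsSortingWord ω w η := by
  rcases Nat.eq_zero_or_pos ω.length with h0 | hn
  · rw [List.length_eq_zero_iff] at h0
    subst h0
    cases h
    refine ⟨[], ⟨⟨List.Pairwise.nil, by simp [lettersAt, IsReducedWordFor, IsReduced]⟩, ?_⟩, rfl⟩
    intro Q _
    exact list_nil_le Q
  · obtain ⟨h1, -, h3⟩ := h.lettersAt_eq hn (by simp)
    refine ⟨P.map (positionIso hn).symm, ⟨⟨?_, ?_⟩, ?_⟩, h1⟩
    · rw [List.pairwise_map]
      exact h3.imp fun h => (positionIso hn).symm.strictMono h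
    · rw [h1]
      exact h.isReducedWordFor
    · rintro Q ⟨hQ, hQ'⟩
      refine h.le hn (by simp) Q hQ (fun q _ => ?_) hQ'
      rw [OrderIso.symm_apply_le]
      exact Nat.zero_le _

theorem IsSortingWord.unique {ω : List B} {w : W} {η η' : List B}
    (h : cs.IsSortingWord ω w η) (h' : cs.IsSortingWord ω w η') : η = η' := by
  obtain ⟨P, hP, rfl⟩ := h
  obtain ⟨P', hP', rfl⟩ := h'
  rw [hP.unique hP']

/-- Delete all letters other than `t` and `t'`: since these two are never interchanged, what remains
does not change under commutation moves. -/
theorem CommEquiv.pair_sublist_iff {G : Type*} [Group G] {l l' : List G} (h : CommEquiv l l')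
    {t t' : G} (ht : t * t' ≠ t' * t) : List.Sublist [t, t'] l ↔ List.Sublist [t, t'] l' := by
  classical
  let f : List G → List G := List.filter fun x => decide (x = t ∨ x = t')
  have hf : f l = f l' := by
    induction h with
    | rel _ _ h =>
      obtain ⟨l₁, l₂, a, b, hab⟩ := h
      simp only [f, List.filter_append]
      congr 1
      by_cases ha : a = t ∨ a = t'
      · by_cases hb : b = t ∨ b = t'
        · rcases ha with rfl | rfl <;> rcases hb with rfl | rfl
          · rfl
          · exact absurd hab ht
          · exact absurd hab.symm ht
          · rfl
        · simp [ha, hb]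
      · by_cases hb : b = t ∨ b = t' <;> simp [ha, hb]
    | refl _ => rfl
    | symm _ _ _ ih => exact ih.symm
    | trans _ _ _ _ _ ih ih' => exact ih.trans ih'
  have hs : ∀ l : List G, List.Sublist [t, t'] l ↔ List.Sublist [t, t'] (f l) := by
    intro l
    refine ⟨fun h => ?_, fun h => h.trans List.filter_sublist⟩
    have := h.filter fun x => decide (x = t ∨ x = t')
    simpa [f] using this
  rw [hs, hs l', hf]

theorem pair_sublist_or {G : Type*} {l : List G} {t t' : G} (ht : t ∈ l) (ht' : t' ∈ l)
    (hne : t ≠ t') : List.Sublist [t, t'] l ∨ List.Sublist [t', t] l := by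
  obtain ⟨l₁, l₂, rfl⟩ := List.append_of_mem ht
  simp only [List.mem_append, List.mem_cons, hne.symm, false_or] at ht'
  rcases ht' with h | h
  · refine Or.inr ?_
    have h1 : List.Sublist [t'] l₁ := List.singleton_sublist.mpr h
    have h2 : List.Sublist [t] (t :: l₂) := List.singleton_sublist.mpr (by simp)
    exact h1.append h2
  · refine Or.inl ?_
    have h1 : List.Sublist [t'] l₂ := List.singleton_sublist.mpr h
    exact (h1.cons_cons t).trans (List.sublist_append_right l₁ _)

theorem isFactorization_map_simple {ω ω' : List B} (h : cs.wordProd ω' = cs.wordProd ω)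
    (hlen : ω'.length = ω.length) : cs.IsFactorization ω (ω'.map cs.simple) where
  isReflection := by
    intro t ht
    obtain ⟨i, -, rfl⟩ := List.mem_map.mp ht
    exact cs.isReflection_simple i
  prod_eq := h
  length_eq := by simpa using hlen

/-! ### The long element and the order `⪯_c` in terms of the skew form -/

section Finite

variable [Finite W]

/-- The inversion sequence has distinct entries, and there are as many of them as there are
reflections. -/
theorem mem_leftInvSeq_of_isLongElement {w₀ : W} (h : cs.IsLongElement w₀) {η : List B}
    (hη : cs.IsReducedWordFor η w₀) {t : W} (ht : cs.IsReflection t) :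
    t ∈ cs.leftInvSeq η := by
  classical
  have hnd := hη.1.nodup_leftInvSeq
  have hlen : (cs.leftInvSeq η).length = Nat.card {t : W // cs.IsReflection t} := by
    rw [length_leftInvSeq, ← h, ← hη.2, hη.1.eq]
  have hsub : ((cs.leftInvSeq η).toFinset : Set W) ⊆ {t | cs.IsReflection t} := by
    intro t ht
    exact cs.isReflection_of_mem_leftInvSeq η (by simpa using ht)
  have heq := Set.eq_of_subset_of_ncard_le hsub (by
    rw [Set.ncard_coe_finset, List.toFinset_card_of_nodup hnd, hlen]
    exact le_of_eq (Nat.card_coe_set_eq _).symm) (Set.toFinite _)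
  have : t ∈ ((cs.leftInvSeq η).toFinset : Set W) := by
    rw [heq]
    exact ht
  simpa using this

variable [Fintype B] [DecidableEq B]

theorem IsLongElement.geom_inv_nonpos {w₀ : W} (h : cs.IsLongElement w₀) {β : B → ℝ}
    (hβ : cs.IsRoot β) (h0 : 0 ≤ β) : cs.geom w₀⁻¹ β ≤ 0 := by
  obtain ⟨t, ht, rfl⟩ := hβ.exists_root_eq h0
  obtain ⟨η, hη, rfl⟩ := cs.exists_isReduced w₀
  have h1 := mem_leftInvSeq_of_isLongElement h ⟨hη, rfl⟩ ht
  exact (ht.length_mul_left_lt_iff _).mp (cs.isLeftInversion_of_mem_leftInvSeq hη h1).2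

theorem IsLongElement.aligned {w₀ : W} (h : cs.IsLongElement w₀) (ω : List B) :
    cs.Aligned ω w₀ :=
  fun _ _ _ _ hα hα0 _ _ _ _ _ _ _ => h.geom_inv_nonpos hα hα0

-- In an element of maximal length all simple reflections are descents, so every positive root is an
-- inversion.
variable (cs) in
theorem exists_isLongElement : ∃ w₀, cs.IsLongElement w₀ := by
  classical
  obtain ⟨w, hw⟩ := Finite.exists_max cs.length
  refine ⟨w, ?_⟩
  obtain ⟨η, hη, rfl⟩ := cs.exists_isReduced w
  have hneg : ∀ i, cs.geom (cs.wordProd η)⁻¹ (simpleRoot i) ≤ 0 := by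
    intro i
    rw [← isLeftDescent_iff_geom]
    have h1 := hw (cs.simple i * cs.wordProd η)
    have h2 := cs.length_simple_mul_ne (cs.wordProd η) i
    unfold IsLeftDescent
    omega
  have hall : ∀ t, cs.IsReflection t → t ∈ cs.leftInvSeq η := by
    intro t ht
    refine mem_leftInvSeq_of_geom_nonpos η ht ?_
    rw [← sum_smul_simpleRoot (cs.root t), map_sum]
    refine Finset.sum_nonpos fun i _ => ?_
    rw [map_smul]
    exact smul_nonpos_of_nonneg_of_nonpos (ht.root_nonneg i) (hneg i)
  have heq : ((cs.leftInvSeq η).toFinset : Set W) = {t | cs.IsReflection t} := by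
    ext t
    simp only [List.coe_toFinset, Set.mem_ofPred_eq]
    exact ⟨cs.isReflection_of_mem_leftInvSeq η, hall t⟩
  unfold IsLongElement
  rw [hη.eq, ← length_leftInvSeq cs, ← List.toFinset_card_of_nodup hη.nodup_leftInvSeq,
    ← Set.ncard_coe_finset, heq]
  exact (Nat.card_coe_set_eq _).symm

/-- A shorter word would also be a shorter word in reflections, which the rank bound excludes. -/
theorem length_wordProd_of_nodup {ω : List B} (hω : ω.Nodup) :
    cs.length (cs.wordProd ω) = ω.length := by
  refine le_antisymm (cs.length_wordProd_le ω) ?_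
  obtain ⟨ω', hr, he⟩ := cs.exists_isReduced (cs.wordProd ω)
  rw [he, hr.eq]
  have := cs.length_le_of_prod_eq hω (ts := ω'.map cs.simple) (by
    intro t ht
    obtain ⟨i, -, rfl⟩ := List.mem_map.mp ht
    exact cs.isReflection_simple i) (by rw [he]; rfl)
  simpa using this

/-- A reduced word for a standard Coxeter element is a permutation of the simple reflections, and
its Euler form only depends on the Coxeter element. -/
theorem IsReducedWordFor.perm_and_euler_eq {ω₀ ω : List B} (hω : ω₀.Nodup)
    (hfull : ∀ i, i ∈ ω₀) (h : cs.IsReducedWordFor ω (cs.wordProd ω₀)) :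
    ω.Perm ω₀ ∧ M.euler ω = M.euler ω₀ := by
  have hlen : ω.length = ω₀.length := by
    rw [← h.1.eq, h.2, length_wordProd_of_nodup hω]
  have hnd : ω.Nodup :=
    List.Nodup.of_map _ ((isFactorization_map_simple h.2 hlen).nodup hω)
  have hperm : ω.Perm ω₀ :=
    (List.subperm_of_subset hnd fun i _ => hfull i).perm_of_length_le hlen.ge
  refine ⟨hperm, LinearMap.ext fun x => LinearMap.ext fun y => ?_⟩
  have hfull' : ∀ i, i ∈ ω := fun i => hperm.mem_iff.mpr (hfull i)
  -- Every vector has the form `z - c⁻¹z`, and on such second arguments the Euler form depends only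
  -- on `c`.
  obtain ⟨z, -, rfl⟩ := cs.exists_sub_geom_inv_wordProd_eq hω (mem_supp_of_full hfull y)
  rw [cs.euler_sub_geom_inv hω, ← h.2, cs.euler_sub_geom_inv hnd,
    restr_eq_self hω (mem_supp_of_full hfull x), restr_eq_self hnd (mem_supp_of_full hfull' x)]

theorem skewLE_of_sublist_leftInvSeq {ω₀ ω : List B} (hω : ω₀.Nodup) (hfull : ∀ i, i ∈ ω₀)
    (h : cs.IsReducedWordFor ω (cs.wordProd ω₀)) {w₀ : W} (hw : cs.IsLongElement w₀) {η : List B}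
    (hη : cs.IsSortingWord ω w₀ η) {t t' : W} (ht : List.Sublist [t, t'] (cs.leftInvSeq η)) :
    M.SkewLE ω₀ (cs.root t) (cs.root t') := by
  obtain ⟨hperm, hE⟩ := h.perm_and_euler_eq hω hfull
  have hnd : ω.Nodup := hperm.nodup_iff.mpr hω
  have hfull' : ∀ i, i ∈ ω := fun i => hperm.mem_iff.mpr (hfull i)
  obtain ⟨η', P, hs⟩ := cs.exists_sortSeq _ ω 0 w₀ le_rfl hfull'
  rw [← hs.isSortingWord.unique hη] at ht
  have h1 := SortSeq.pairwise_skewLE _ hs hnd hfull' le_rfl (hw.aligned ω)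
  rw [← map_root_leftInvSeq hs.isReducedWordFor.1, List.pairwise_map] at h1
  have h2 := h1.sublist ht
  have h3 : M.SkewLE ω (cs.root t) (cs.root t') := by simpa using h2
  rw [SkewLE, skew, hE] at h3
  exact h3

/-- There is a list of all reflections that is compatible with the order `⪯_c`. -/
theorem exists_sorted_reflections {ω₀ : List B} (hω : ω₀.Nodup) (hfull : ∀ i, i ∈ ω₀) :
    ∃ L : List W, L.Nodup ∧ (∀ t, cs.IsReflection t → t ∈ L) ∧
      (∀ t t', List.Sublist [t, t'] L → M.SkewLE ω₀ (cs.root t) (cs.root t')) ∧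
      ∀ t t', cs.SortLE (cs.wordProd ω₀) t t' → t = t' ∨ List.Sublist [t, t'] L := by
  obtain ⟨w₀, hw⟩ := cs.exists_isLongElement
  obtain ⟨η, P, hs⟩ := cs.exists_sortSeq _ ω₀ 0 w₀ le_rfl hfull
  have hred : cs.IsReducedWordFor ω₀ (cs.wordProd ω₀) := ⟨length_wordProd_of_nodup hω, rfl⟩
  refine ⟨cs.leftInvSeq η, hs.isReducedWordFor.1.nodup_leftInvSeq,
    fun t ht => mem_leftInvSeq_of_isLongElement hw hs.isReducedWordFor ht,
    fun t t' h => skewLE_of_sublist_leftInvSeq hω hfull hred hw hs.isSortingWord h,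
    fun t t' h => h.imp id fun h => ?_⟩
  exact h ω₀ η w₀ _ hred hw hs.isSortingWord (CommEquiv.refl _)

/-- On noncommuting reflections the order `⪯_c` is given by the skew form. -/
theorem sortLE_iff {ω₀ : List B} (hω : ω₀.Nodup) (hfull : ∀ i, i ∈ ω₀) {t t' : W}
    (ht : cs.IsReflection t) (ht' : cs.IsReflection t') (hne : t * t' ≠ t' * t) :
    cs.SortLE (cs.wordProd ω₀) t t' ↔ 0 < M.skew ω₀ (cs.root t) (cs.root t') := by
  have htt : t ≠ t' := by
    rintro rfl
    exact hne rfl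
  have hform : M.cosForm (cs.root t) (cs.root t') ≠ 0 := fun h0 =>
    hne (ht.commute_of_cosForm_eq_zero ht' h0)
  constructor
  · intro h
    obtain ⟨L, -, -, hL, hL'⟩ := exists_sorted_reflections (cs := cs) hω hfull
    have h1 := hL _ _ ((hL' _ _ h).resolve_left htt)
    exact lt_of_le_of_ne h1.1 fun h0 => hform (h1.2 h0.symm)
  · intro h
    refine Or.inr fun ω η w₀ l hred hw hη hl => ?_
    -- The two letters do not commute, so it suffices to look at the inversion sequence itself. It
    -- contains both, and the wrong order would contradict the sign of the skew form.
    rw [← hl.pair_sublist_iff hne]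
    have hηr : cs.IsReducedWordFor η w₀ := by
      obtain ⟨P, hP, rfl⟩ := hη
      exact hP.1.2
    rcases pair_sublist_or (mem_leftInvSeq_of_isLongElement hw hηr ht)
      (mem_leftInvSeq_of_isLongElement hw hηr ht') htt with h1 | h1
    · exact h1
    · have h2 := (skewLE_of_sublist_leftInvSeq hω hfull hred hw hη h1).1
      rw [skew_swap] at h2
      linarith

end Finite

end CoxeterSystem

/-! ### Partial products and sorting by commutations -/

namespace CoxeterSystem

open CoxeterMatrix

theorem idxOf_lt_of_sublist {G : Type*} [DecidableEq G] {L : List G} (hL : L.Nodup) {s t : G}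
    (h : List.Sublist [s, t] L) : L.idxOf s < L.idxOf t := by
  induction L with
  | nil => simp at h
  | cons a L ih =>
    rw [List.nodup_cons] at hL
    cases h with
    | cons _ h =>
      have hs : s ∈ L := h.subset (by simp)
      have ht : t ∈ L := h.subset (by simp)
      have h1 : a ≠ s := by rintro rfl; exact hL.1 hs
      have h2 : a ≠ t := by rintro rfl; exact hL.1 ht
      rw [List.idxOf_cons_ne _ h1, List.idxOf_cons_ne _ h2]
      exact Nat.succ_lt_succ (ih hL.2 h)
    | cons_cons _ h =>
      have ht : t ∈ L := h.subset (by simp)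
      have h2 : s ≠ t := by rintro rfl; exact hL.1 ht
      rw [List.idxOf_cons_self, List.idxOf_cons_ne _ h2]
      exact Nat.succ_pos _

section PartialProducts

variable {G : Type*} [Group G]

/-- The list `a, a t₁, a t₁ t₂, …` of partial products. -/
def partialProds (a : G) : List G → List G
  | [] => [a]
  | t :: ts => a :: partialProds (a * t) ts

theorem exists_partialProds_eq_cons (a : G) (ts : List G) : ∃ l, partialProds a ts = a :: l := by
  cases ts with
  | nil => exact ⟨[], rfl⟩
  | cons t ts => exact ⟨_, rfl⟩

theorem quotientWord_cons_cons (a b : G) (l : List G) :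
    quotientWord (a :: b :: l) = a⁻¹ * b :: quotientWord (b :: l) := rfl

theorem quotientWord_partialProds (a : G) (ts : List G) :
    quotientWord (partialProds a ts) = ts := by
  induction ts generalizing a with
  | nil => rfl
  | cons t ts ih =>
    obtain ⟨l, hl⟩ := exists_partialProds_eq_cons (a * t) ts
    have h1 := ih (a * t)
    rw [partialProds, hl, quotientWord_cons_cons, ← hl, h1, inv_mul_cancel_left]

theorem partialProds_quotientWord (a : G) (l : List G) :
    partialProds a (quotientWord (a :: l)) = a :: l := by
  induction l generalizing a with
  | nil => rfl
  | cons b l ih => rw [quotientWord_cons_cons, partialProds, mul_inv_cancel_left, ih]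

theorem exists_partialProds_eq_concat (a : G) (ts : List G) :
    ∃ l, partialProds a ts = l ++ [a * ts.prod] := by
  induction ts generalizing a with
  | nil => exact ⟨[], by simp [partialProds]⟩
  | cons t ts ih =>
    obtain ⟨l, hl⟩ := ih (a * t)
    exact ⟨a :: l, by rw [partialProds, hl, List.prod_cons, mul_assoc]; rfl⟩

theorem mem_partialProds {a x : G} {ts : List G} :
    x ∈ partialProds a ts ↔ ∃ p q, ts = p ++ q ∧ x = a * p.prod := by
  induction ts generalizing a with
  | nil =>
    simp only [partialProds, List.mem_singleton]
    constructor
    · rintro rfl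
      exact ⟨[], [], rfl, by simp⟩
    · rintro ⟨p, q, h, rfl⟩
      rw [List.nil_eq, List.append_eq_nil_iff] at h
      simp [h.1]
  | cons t ts ih =>
    rw [partialProds, List.mem_cons, ih]
    constructor
    · rintro (rfl | ⟨p, q, rfl, rfl⟩)
      · exact ⟨[], t :: ts, rfl, by simp⟩
      · exact ⟨t :: p, q, rfl, by simp [mul_assoc]⟩
    · rintro ⟨p, q, h, rfl⟩
      cases p with
      | nil => left; simp
      | cons s p =>
        rw [List.cons_append, List.cons.injEq] at h
        obtain ⟨rfl, rfl⟩ := h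
        exact Or.inr ⟨p, q, rfl, by simp [mul_assoc]⟩

theorem pairwise_partialProds (a : G) (ts : List G) :
    (partialProds a ts).Pairwise fun x y =>
      ∃ p q r, ts = p ++ q ++ r ∧ q ≠ [] ∧ x = a * p.prod ∧ y = a * (p ++ q).prod := by
  induction ts generalizing a with
  | nil => exact List.pairwise_singleton _ _
  | cons t ts ih =>
    rw [partialProds, List.pairwise_cons]
    constructor
    · intro y hy
      obtain ⟨p, q, rfl, rfl⟩ := mem_partialProds.mp hy
      exact ⟨[], t :: p, q, by simp, by simp, by simp, by simp [mul_assoc]⟩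
    · refine (ih (a * t)).imp ?_
      rintro x y ⟨p, q, r, rfl, hq, rfl, rfl⟩
      exact ⟨t :: p, q, r, by simp, hq, by simp [mul_assoc], by simp [mul_assoc]⟩

theorem forall_mem_of_partialProds {P : G → Prop} {a : G} {ts : List G}
    (h : ∀ l₁ x y l₂, partialProds a ts = l₁ ++ x :: y :: l₂ → P (x⁻¹ * y)) :
    ∀ t ∈ ts, P t := by
  induction ts generalizing a with
  | nil => simp
  | cons t ts ih =>
    obtain ⟨l, hl⟩ := exists_partialProds_eq_cons (a * t) ts
    intro t' ht'
    rcases List.mem_cons.mp ht' with rfl | ht'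
    · have := h [] a (a * t') l (by rw [partialProds, hl]; rfl)
      rwa [inv_mul_cancel_left] at this
    · refine ih (a := a * t) (fun l₁ x y l₂ he => ?_) t' ht'
      exact h (a :: l₁) x y l₂ (by rw [partialProds, he]; rfl)

/-- A word whose noncommuting letters are already sorted can be sorted by commutations. -/
theorem exists_commEquiv_sorted (f : G → ℤ) {l : List G}
    (h : l.Pairwise fun s t => s * t ≠ t * s → f s < f t) :
    ∃ l', CommEquiv l l' ∧ l'.Pairwise fun s t => f s ≤ f t := by
  induction l with
  | nil => exact ⟨[], CommEquiv.refl _, List.Pairwise.nil⟩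
  | cons a l ih =>
    rw [List.pairwise_cons] at h
    obtain ⟨l', hl, hs⟩ := ih h.2
    -- The letter `a` is inserted behind those with smaller value of `f`. By hypothesis it commutes
    -- with each of them.
    have hcomm : ∀ x ∈ l', ¬ f a < f x → x * a = a * x := by
      intro x hx hfx
      by_contra hne
      exact hfx (h.1 x (hl.perm.mem_iff.mpr hx) fun h => hne h.symm)
    obtain ⟨l₁, l₂, rfl, h₁, h₂⟩ : ∃ l₁ l₂, l' = l₁ ++ l₂ ∧ (∀ x ∈ l₁, f x < f a) ∧
        ∀ x ∈ l₂, f a ≤ f x := by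
      clear hcomm hl
      induction l' with
      | nil => exact ⟨[], [], rfl, by simp, by simp⟩
      | cons y l' ihl =>
        rw [List.pairwise_cons] at hs
        by_cases hy : f y < f a
        · obtain ⟨l₁, l₂, rfl, h₁, h₂⟩ := ihl hs.2
          refine ⟨y :: l₁, l₂, rfl, ?_, h₂⟩
          simpa [hy] using h₁
        · refine ⟨[], y :: l', rfl, by simp, ?_⟩
          intro x hx
          rcases List.mem_cons.mp hx with rfl | hx
          · exact not_lt.mp hy
          · exact (not_lt.mp hy).trans (hs.1 x hx)
    refine ⟨l₁ ++ a :: l₂, (hl.cons a).trans (CommEquiv.move_front l₂ fun x hx =>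
      hcomm x (by simp [hx]) (h₁ x hx).le.not_gt).symm, ?_⟩
    rw [List.pairwise_append] at hs ⊢
    refine ⟨hs.1, List.pairwise_cons.mpr ⟨h₂, hs.2.1⟩, fun x hx y hy => ?_⟩
    rcases List.mem_cons.mp hy with rfl | hy
    · exact (h₁ x hx).le
    · exact hs.2.2 x hx y hy

end PartialProducts

variable {B W : Type*} [Group W] {M : CoxeterMatrix B} (cs : CoxeterSystem M W)

/-! ### Maximal chains and shortest words in reflections -/

section AbsoluteOrder

theorem exists_reflLength_eq (w : W) : ∃ l : List W, (∀ t ∈ l, cs.IsReflection t) ∧ l.prod = w ∧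
    l.length = cs.reflLength w := by
  refine Nat.sInf_mem (s := {n | ∃ l : List W, (∀ t ∈ l, cs.IsReflection t) ∧ l.prod = w ∧
    l.length = n}) ?_
  obtain ⟨ω, -, h⟩ := cs.exists_isReduced w
  refine ⟨_, ω.map cs.simple, ?_, h.symm, rfl⟩
  intro t ht
  obtain ⟨i, -, rfl⟩ := List.mem_map.mp ht
  exact cs.isReflection_simple i

theorem reflLength_prod_le {l : List W} (h : ∀ t ∈ l, cs.IsReflection t) :
    cs.reflLength l.prod ≤ l.length :=
  Nat.sInf_le ⟨l, h, rfl, rfl⟩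

@[simp] theorem reflLength_one : cs.reflLength 1 = 0 :=
  Nat.le_zero.mp (cs.reflLength_prod_le (l := []) (by simp))

theorem eq_one_of_reflLength_eq_zero {w : W} (h : cs.reflLength w = 0) : w = 1 := by
  obtain ⟨l, -, rfl, h'⟩ := cs.exists_reflLength_eq w
  rw [h, List.length_eq_zero_iff] at h'
  simp [h']

theorem reflLength_mul_le (v w : W) :
    cs.reflLength (v * w) ≤ cs.reflLength v + cs.reflLength w := by
  obtain ⟨l, h1, rfl, h2⟩ := cs.exists_reflLength_eq v
  obtain ⟨l', h1', rfl, h2'⟩ := cs.exists_reflLength_eq w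
  rw [← h2, ← h2', ← List.prod_append, ← List.length_append]
  refine cs.reflLength_prod_le fun t ht => ?_
  rcases List.mem_append.mp ht with h | h
  · exact h1 t h
  · exact h1' t h

theorem one_absLE (x : W) : cs.AbsLE 1 x := by simp [AbsLE]

theorem absLE_refl (x : W) : cs.AbsLE x x := by simp [AbsLE]

variable {cs}

theorem reflLength_le_mul (x y : W) :
    cs.reflLength y ≤ cs.reflLength x + cs.reflLength (x⁻¹ * y) := by
  simpa using cs.reflLength_mul_le x (x⁻¹ * y)

theorem AbsLE.trans {x y z : W} (h : cs.AbsLE x y) (h' : cs.AbsLE y z) : cs.AbsLE x z := by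
  have h1 := cs.reflLength_mul_le (x⁻¹ * y) (y⁻¹ * z)
  have h2 := reflLength_le_mul (cs := cs) x z
  rw [mul_assoc, mul_inv_cancel_left] at h1
  unfold AbsLE at *
  omega

theorem AbsLE.eq_of_reflLength_le {x y : W} (h : cs.AbsLE x y)
    (h' : cs.reflLength y ≤ cs.reflLength x) : x = y := by
  unfold AbsLE at h
  exact inv_mul_eq_one.mp (cs.eq_one_of_reflLength_eq_zero (w := x⁻¹ * y) (by omega))

theorem AbsLE.antisymm {x y : W} (h : cs.AbsLE x y) (h' : cs.AbsLE y x) : x = y := by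
  refine h.eq_of_reflLength_le ?_
  unfold AbsLE at h'
  omega

theorem AbsLE.exists_between {x y : W} (h : cs.AbsLE x y) (hne : x ≠ y) :
    ∃ t, cs.IsReflection t ∧ cs.AbsLE x (x * t) ∧ cs.AbsLE (x * t) y := by
  obtain ⟨l, h1, h2, h3⟩ := cs.exists_reflLength_eq (x⁻¹ * y)
  cases l with
  | nil =>
    refine absurd ?_ hne
    exact inv_mul_eq_one.mp h2.symm
  | cons t l =>
    have ht := h1 t (by simp)
    have h4 := cs.reflLength_prod_le (l := l) fun t' h' => h1 t' (by simp [h'])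
    have h5 := cs.reflLength_prod_le (l := [t]) (by simpa using ht)
    rw [List.prod_singleton, List.length_singleton] at h5
    have h6 : (x * t)⁻¹ * y = l.prod := by
      rw [mul_inv_rev, mul_assoc, ← h2, List.prod_cons, inv_mul_cancel_left]
    have h7 := reflLength_le_mul (cs := cs) (x * t) y
    have h8 := cs.reflLength_mul_le x t
    rw [h6] at h7
    rw [List.length_cons] at h3
    unfold AbsLE at h
    refine ⟨t, ht, ?_, ?_⟩
    · rw [AbsLE, inv_mul_cancel_left]
      omega
    · rw [AbsLE, h6]
      omega

theorem mem_noncrossing {c x : W} : x ∈ cs.noncrossing c ↔ cs.AbsLE x c :=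
  ⟨fun h => h.2, fun h => ⟨cs.one_absLE x, h⟩⟩

namespace MaxChain

variable {c : W} (π : cs.MaxChain c)

theorem exists_elems_eq_cons : ∃ l, π.elems = 1 :: l := by
  have hmem : (1 : W) ∈ π.elems := π.maximal 1 (CoxeterSystem.mem_noncrossing.mpr (cs.one_absLE c))
    fun y _ => Or.inl (cs.one_absLE y)
  obtain ⟨l₁, l₂, h⟩ := List.append_of_mem hmem
  cases l₁ with
  | nil => exact ⟨l₂, h⟩
  | cons x l₁ =>
    have h1 := π.increasing
    rw [h, List.cons_append, List.pairwise_cons] at h1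
    have h2 := h1.1 1 (by simp)
    exact absurd (h2.1.antisymm (cs.one_absLE x)) h2.2

theorem exists_elems_eq_concat : ∃ l, π.elems = l ++ [c] := by
  have hmem : c ∈ π.elems := π.maximal c (CoxeterSystem.mem_noncrossing.mpr (cs.absLE_refl c))
    fun y hy => Or.inr (π.mem_noncrossing y hy).2
  obtain ⟨l₁, l₂, h⟩ := List.append_of_mem hmem
  cases l₂ with
  | nil => exact ⟨l₁, h⟩
  | cons x l₂ =>
    have h1 := π.increasing
    rw [h, List.pairwise_append, List.pairwise_cons] at h1
    have h2 := h1.2.1.1 x (by simp)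
    exact absurd (h2.1.antisymm (π.mem_noncrossing x (by rw [h]; simp)).2) h2.2

/-- Between adjacent elements `x` and `y` lies some `x t`. It is comparable with the entire chain,
so it belongs to the chain by maximality and can only be `y`. -/
theorem isReflection_of_adjacent {l₁ l₂ : List W} {x y : W}
    (h : π.elems = l₁ ++ x :: y :: l₂) : cs.IsReflection (x⁻¹ * y) := by
  have h1 := π.increasing
  rw [h, List.pairwise_append, List.pairwise_cons, List.pairwise_cons] at h1
  obtain ⟨-, ⟨hx, hy, -⟩, hl⟩ := h1
  have hxy := hx y (by simp)
  obtain ⟨t, ht, hxz, hzy⟩ := hxy.1.exists_between hxy.2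
  have hyc : cs.AbsLE y c := (π.mem_noncrossing y (by rw [h]; simp)).2
  have hz : x * t ∈ π.elems := by
    refine π.maximal _ (CoxeterSystem.mem_noncrossing.mpr (hzy.trans hyc)) fun w hw => ?_
    rw [h, List.mem_append, List.mem_cons, List.mem_cons] at hw
    rcases hw with hw | rfl | rfl | hw
    · exact Or.inr ((hl w hw x (by simp)).1.trans hxz)
    · exact Or.inr hxz
    · exact Or.inl hzy
    · exact Or.inl (hzy.trans (hy w hw).1)
  rw [h, List.mem_append, List.mem_cons, List.mem_cons] at hz
  rcases hz with hz | hz | hz | hz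
  · have h2 := hl _ hz x (by simp)
    exact absurd (h2.1.antisymm hxz) h2.2
  · rw [mul_eq_left] at hz
    have h3 := ht.odd_length
    rw [hz, length_one] at h3
    exact absurd h3 (by decide)
  · rwa [← hz, inv_mul_cancel_left]
  · have h2 := hy _ hz
    exact absurd (h2.1.antisymm hzy) h2.2

theorem elems_eq : π.elems = partialProds 1 π.reflWord := by
  obtain ⟨l, h⟩ := π.exists_elems_eq_cons
  rw [reflWord, h, partialProds_quotientWord]

theorem isReflection_of_mem_reflWord : ∀ t ∈ π.reflWord, cs.IsReflection t := by
  refine forall_mem_of_partialProds (a := 1) fun l₁ x y l₂ h => ?_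
  rw [← elems_eq] at h
  exact π.isReflection_of_adjacent h

theorem prod_reflWord : π.reflWord.prod = c := by
  obtain ⟨l, h⟩ := exists_partialProds_eq_concat 1 π.reflWord
  obtain ⟨l', h'⟩ := π.exists_elems_eq_concat
  rw [← elems_eq, h', one_mul] at h
  have := congrArg List.getLast? h
  simpa using this.symm

theorem length_reflWord : π.reflWord.length = cs.reflLength c := by
  refine le_antisymm ?_ ?_
  · have key : ∀ (ts : List W) (a : W),
        ((partialProds a ts).Pairwise fun x y => cs.AbsLE x y ∧ x ≠ y) →
        cs.reflLength a + ts.length ≤ cs.reflLength (a * ts.prod) := by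
      intro ts
      induction ts with
      | nil => simp
      | cons t ts ih =>
        intro a h
        rw [partialProds, List.pairwise_cons] at h
        have h1 := ih (a * t) h.2
        obtain ⟨l, hl⟩ := exists_partialProds_eq_cons (a * t) ts
        have h2 := h.1 (a * t) (by rw [hl]; simp)
        have h3 : cs.reflLength a < cs.reflLength (a * t) := by
          by_contra hcon
          exact h2.2 (h2.1.eq_of_reflLength_le (by omega))
        rw [List.prod_cons, ← mul_assoc, List.length_cons]
        omega
    have h1 := key π.reflWord 1 (by rw [← elems_eq]; exact π.increasing)
    rw [one_mul, prod_reflWord, reflLength_one] at h1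
    omega
  · have := cs.reflLength_prod_le π.isReflection_of_mem_reflWord
    rwa [prod_reflWord] at this

/-- Every shortest word for `c` in the reflections is the word of a maximal chain. -/
theorem exists_reflWord_eq {ts : List W} (hts : ∀ t ∈ ts, cs.IsReflection t) (hprod : ts.prod = c)
    (hlen : ts.length = cs.reflLength c) : ∃ π : cs.MaxChain c, π.reflWord = ts := by
  -- Factors of a shortest word are shortest.
  have hseg : ∀ p q r, ts = p ++ q ++ r → cs.reflLength q.prod = q.length := by
    rintro p q r rfl
    have hp := cs.reflLength_prod_le (l := p) fun t ht => hts t (by simp [ht])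
    have hq := cs.reflLength_prod_le (l := q) fun t ht => hts t (by simp [ht])
    have hr := cs.reflLength_prod_le (l := r) fun t ht => hts t (by simp [ht])
    have h1 := cs.reflLength_mul_le (p.prod * q.prod) r.prod
    have h2 := cs.reflLength_mul_le p.prod q.prod
    rw [List.prod_append, List.prod_append] at hprod
    rw [hprod, ← hlen] at h1
    simp only [List.length_append] at h1
    omega
  have hle : ∀ p q r, ts = p ++ q ++ r → cs.AbsLE p.prod (p ++ q).prod := by
    intro p q r h
    have h1 := hseg [] p (q ++ r) (by simpa using h)
    have h2 := hseg p q r h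
    have h3 := hseg [] (p ++ q) r (by simpa using h)
    rw [AbsLE, List.prod_append, inv_mul_cancel_left, ← List.prod_append, h1, h2, h3,
      List.length_append]
  refine ⟨⟨partialProds 1 ts, ?_, ?_, ?_⟩, quotientWord_partialProds 1 ts⟩
  · intro x hx
    obtain ⟨p, q, h, rfl⟩ := mem_partialProds.mp hx
    rw [CoxeterSystem.mem_noncrossing, one_mul, ← hprod, h]
    exact hle p q [] (by simpa using h)
  · refine (pairwise_partialProds 1 ts).imp ?_
    rintro x y ⟨p, q, r, h, hq, rfl, rfl⟩
    rw [one_mul, one_mul]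
    refine ⟨hle p q r h, fun he => hq ?_⟩
    rw [List.prod_append, left_eq_mul] at he
    have h1 := hseg p q r h
    rw [he, reflLength_one] at h1
    exact List.length_eq_zero_iff.mp h1.symm
  -- The partial products realize every reflection length up to that of `c`; comparable elements of
  -- equal reflection length coincide.
  · intro x hx hcomp
    rw [CoxeterSystem.mem_noncrossing] at hx
    have hk : cs.reflLength x ≤ ts.length := by
      unfold AbsLE at hx
      omega
    have htake : ts = ts.take (cs.reflLength x) ++ ts.drop (cs.reflLength x) := by simp
    have hmem : (ts.take (cs.reflLength x)).prod ∈ partialProds 1 ts :=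
      mem_partialProds.mpr ⟨_, _, htake, by simp⟩
    have hl : cs.reflLength (ts.take (cs.reflLength x)).prod = cs.reflLength x := by
      rw [hseg [] _ _ htake, List.length_take]
      omega
    rcases hcomp _ hmem with h | h
    · rw [h.eq_of_reflLength_le hl.le]
      exact hmem
    · rw [← h.eq_of_reflLength_le hl.ge]
      exact hmem

end MaxChain

end AbsoluteOrder

/-! ### Bruhat chains as upward paths -/

section Bruhat

variable {cs}

theorem BruhatLE.length_le {v w : W} (h : cs.BruhatLE v w) : cs.length v ≤ cs.length w := by
  induction h with
  | refl => exact le_rfl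
  | tail _ h ih =>
    have := h.1
    omega

variable [Fintype B] [DecidableEq B]

/-- Bruhat comparability enters only through lengths: multiplication by a reflection always changes
the length, so each step goes up strictly. -/
theorem isUp_of_isChain_bruhatLE {u a : W} {ts : List W} (hts : ∀ t ∈ ts, cs.IsReflection t)
    (h : ((partialProds a ts).map (fun x => u * x)).IsChain cs.BruhatLE) :
    cs.IsUp (u * a) ts := by
  induction ts generalizing a with
  | nil => exact trivial
  | cons t ts ih =>
    obtain ⟨l, hl⟩ := exists_partialProds_eq_cons (a * t) ts
    have ht := hts t (by simp)
    rw [partialProds, hl, List.map_cons, List.map_cons, List.isChain_cons_cons, ← List.map_cons,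
      ← hl] at h
    have h1 := h.1.length_le
    rw [← mul_assoc] at h1
    refine ⟨?_, ?_⟩
    · rw [← ht.lt_length_mul_iff]
      exact lt_of_le_of_ne h1 (ht.length_mul_left_ne _).symm
    · rw [mul_assoc]
      exact ih (fun t' h' => hts t' (by simp [h'])) h.2

/-- The total increase in length equals the number of steps, so each step is by exactly one and
hence a Bruhat cover. -/
theorem isChain_bruhatLE_of_isUp {u a : W} {ts : List W} (hts : ∀ t ∈ ts, cs.IsReflection t)
    (h : cs.IsUp (u * a) ts)
    (hlen : cs.length (u * a * ts.prod) = cs.length (u * a) + ts.length) :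
    ((partialProds a ts).map (fun x => u * x)).IsChain cs.BruhatLE := by
  induction ts generalizing a with
  | nil => simp [partialProds]
  | cons t ts ih =>
    obtain ⟨l, hl⟩ := exists_partialProds_eq_cons (a * t) ts
    have ht := hts t (by simp)
    have hts' : ∀ t ∈ ts, cs.IsReflection t := fun t' h' => hts t' (by simp [h'])
    have h1 := (ht.lt_length_mul_iff (u * a)).mpr h.1
    have h2 := h.2.length_le hts'
    rw [List.prod_cons, ← mul_assoc, List.length_cons] at hlen
    have h3 : cs.length (u * a * t) = cs.length (u * a) + 1 := by omega
    have h4 := ih (a := a * t) hts' (by rw [← mul_assoc]; exact h.2)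
      (by rw [← mul_assoc]; omega)
    rw [partialProds, hl, List.map_cons, List.map_cons, List.isChain_cons_cons, ← List.map_cons,
      ← hl]
    refine ⟨Relation.ReflTransGen.single ⟨by rw [← mul_assoc, h3], t, ht, by rw [mul_assoc]⟩, h4⟩

theorem isUp_map_simple {u : W} {ω : List B}
    (h : cs.length (u * cs.wordProd ω) = cs.length u + ω.length) :
    cs.IsUp u (ω.map cs.simple) := by
  induction ω generalizing u with
  | nil => exact trivial
  | cons i ω ih =>
    rw [wordProd_cons, ← mul_assoc, List.length_cons] at h
    have h1 := cs.length_mul_le (u * cs.simple i) (cs.wordProd ω)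
    have h2 := cs.length_wordProd_le ω
    have h3 := cs.length_mul_le u (cs.simple i)
    rw [length_simple] at h3
    refine ⟨?_, ih (by omega)⟩
    rw [← (cs.isReflection_simple i).lt_length_mul_iff]
    omega

end Bruhat

/-! ### Increasing and decreasing classes -/

section Coxeter

variable {cs} {ω : List B}

theorem IsFactorization.of_commEquiv {ts ts' : List W} (h : cs.IsFactorization ω ts)
    (hc : CommEquiv ts ts') : cs.IsFactorization ω ts' where
  isReflection := fun t ht => h.1 t (hc.perm.mem_iff.mpr ht)
  prod_eq := by rw [← hc.prod_eq, h.2]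
  length_eq := by rw [← hc.perm.length_eq, h.3]

variable [Finite W] [Fintype B] [DecidableEq B]

theorem reflLength_wordProd (hω : ω.Nodup) : cs.reflLength (cs.wordProd ω) = ω.length := by
  refine le_antisymm ?_ ?_
  · have := cs.reflLength_prod_le (l := ω.map cs.simple) (by
      intro t ht
      obtain ⟨i, -, rfl⟩ := List.mem_map.mp ht
      exact cs.isReflection_simple i)
    simpa [wordProd] using this
  · obtain ⟨l, h1, h2, h3⟩ := cs.exists_reflLength_eq (cs.wordProd ω)
    rw [← h3]
    exact cs.length_le_of_prod_eq hω h1 h2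

theorem MaxChain.isFactorization (hω : ω.Nodup) (π : cs.MaxChain (cs.wordProd ω)) :
    cs.IsFactorization ω π.reflWord where
  isReflection := π.isReflection_of_mem_reflWord
  prod_eq := π.prod_reflWord
  length_eq := by rw [π.length_reflWord, reflLength_wordProd hω]

theorem IsFactorization.exists_maxChain (hω : ω.Nodup) {ts : List W}
    (h : cs.IsFactorization ω ts) : ∃ π : cs.MaxChain (cs.wordProd ω), π.reflWord = ts :=
  MaxChain.exists_reflWord_eq h.1 h.2 (by rw [h.3, reflLength_wordProd hω])

theorem MaxChain.concordant_iff (hω : ω.Nodup) {u : W} (hu : u ∈ cs.plusSet (cs.wordProd ω))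
    (π : cs.MaxChain (cs.wordProd ω)) : π.Concordant u ↔ cs.IsUp u π.reflWord := by
  have hf := π.isFactorization hω
  rw [Concordant, π.elems_eq]
  constructor
  · intro h
    simpa using isUp_of_isChain_bruhatLE hf.1 h
  · intro h
    refine isChain_bruhatLE_of_isUp hf.1 (by simpa using h) ?_
    rw [mul_one, hf.2, hf.3, ← length_wordProd_of_nodup (cs := cs) hω]
    exact hu

/-- The bridge between order and angle: the Euler form vanishes from an earlier to a later root, so
only the symmetrization remains, with a minus sign. -/
theorem IsFactorization.pairwise_skew (hω : ω.Nodup) {ts : List W}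
    (h : cs.IsFactorization ω ts) :
    ts.Pairwise fun t t' => t ≠ t' ∧
      M.skew ω (cs.root t) (cs.root t') = -2 * M.cosForm (cs.root t) (cs.root t') := by
  refine (h.pairwise hω).imp_of_mem fun {t t'} ht ht' hE => ⟨hE.1, ?_⟩
  have h1 := M.euler_add_euler ω (cs.root t) (cs.root t')
  rw [restr_eq_self hω (h.root_mem_supp hω ht), restr_eq_self hω (h.root_mem_supp hω ht'),
    hE.2] at h1
  rw [skew, hE.2]
  linarith

/-- Noncommuting letters have strictly negative product and hence positive skew form, so they
already stand in the order of the list `L` of all reflections. Commutations then sort the whole word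
by `L`, which also takes care of commuting letters that are comparable. -/
theorem IsFactorization.exists_increasing (hω : ω.Nodup) (hfull : ∀ i, i ∈ ω) {ts : List W}
    (h : cs.IsFactorization ω ts)
    (hp : ts.Pairwise fun t t' => M.cosForm (cs.root t) (cs.root t') ≤ 0) :
    ∃ ts', CommEquiv ts ts' ∧
      ts'.Pairwise fun t t' => ¬ cs.SortLE (cs.wordProd ω) t' t := by
  classical
  obtain ⟨L, hL, hmem, hskew, hsort⟩ := exists_sorted_reflections (cs := cs) hω hfull
  obtain ⟨ts', hc, hs⟩ := exists_commEquiv_sorted (fun t => (L.idxOf t : ℤ)) (l := ts) (by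
    refine ((h.pairwise_skew hω).and hp).imp_of_mem fun {t t'} ht ht' hh hne => ?_
    obtain ⟨⟨htt, h1⟩, h2⟩ := hh
    have hform : M.cosForm (cs.root t) (cs.root t') ≠ 0 := fun h0 =>
      hne ((h.1 t ht).commute_of_cosForm_eq_zero (h.1 t' ht') h0)
    have h3 := lt_of_le_of_ne h2 hform
    rcases pair_sublist_or (hmem t (h.1 t ht)) (hmem t' (h.1 t' ht')) htt with h4 | h4
    · exact_mod_cast idxOf_lt_of_sublist hL h4
    · have := (hskew _ _ h4).1
      rw [skew_swap] at this
      linarith)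
  refine ⟨ts', hc, ?_⟩
  refine (hs.and ((h.of_commEquiv hc).nodup hω)).imp fun {t t'} hh hle => ?_
  rcases hsort _ _ hle with h1 | h1
  · exact hh.2 h1.symm
  · have := idxOf_lt_of_sublist hL h1
    have h2 := hh.1
    simp only [Nat.cast_le] at h2
    omega

theorem IsFactorization.exists_decreasing (hω : ω.Nodup) (hfull : ∀ i, i ∈ ω) {ts : List W}
    (h : cs.IsFactorization ω ts)
    (hp : ts.Pairwise fun t t' => 0 ≤ M.cosForm (cs.root t) (cs.root t')) :
    ∃ ts', CommEquiv ts ts' ∧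
      ts'.Pairwise fun t t' => ¬ cs.SortLE (cs.wordProd ω) t t' := by
  classical
  obtain ⟨L, hL, hmem, hskew, hsort⟩ := exists_sorted_reflections (cs := cs) hω hfull
  -- The negated position in `L` is the key, so that sorting produces the order opposite to `L`.
  obtain ⟨ts', hc, hs⟩ := exists_commEquiv_sorted (fun t => -(L.idxOf t : ℤ)) (l := ts) (by
    refine ((h.pairwise_skew hω).and hp).imp_of_mem fun {t t'} ht ht' hh hne => ?_
    obtain ⟨⟨htt, h1⟩, h2⟩ := hh
    have hform : M.cosForm (cs.root t) (cs.root t') ≠ 0 := fun h0 =>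
      hne ((h.1 t ht).commute_of_cosForm_eq_zero (h.1 t' ht') h0)
    have h3 := lt_of_le_of_ne h2 hform.symm
    rcases pair_sublist_or (hmem t (h.1 t ht)) (hmem t' (h.1 t' ht')) htt with h4 | h4
    · have := (hskew _ _ h4).1
      linarith
    · have := idxOf_lt_of_sublist hL h4
      simp only [neg_lt_neg_iff, Nat.cast_lt]
      exact this)
  refine ⟨ts', hc, ?_⟩
  refine (hs.and ((h.of_commEquiv hc).nodup hω)).imp fun {t t'} hh hle => ?_
  rcases hsort _ _ hle with h1 | h1
  · exact hh.2 h1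
  · have := idxOf_lt_of_sublist hL h1
    have h2 := hh.1
    simp only [neg_le_neg_iff, Nat.cast_le] at h2
    omega

/-- Commuting letters are orthogonal. For the others the order is the sign of the skew form, hence
the opposite sign of the product of the roots. -/
theorem IsFactorization.obtuse_of_increasing (hω : ω.Nodup) (hfull : ∀ i, i ∈ ω) {ts : List W}
    (h : cs.IsFactorization ω ts)
    (hp : ts.Pairwise fun t t' => ¬ cs.SortLE (cs.wordProd ω) t' t) :
    ts.Pairwise fun t t' => M.cosForm (cs.root t) (cs.root t') ≤ 0 := by
  refine ((h.pairwise_skew hω).and hp).imp_of_mem fun {t t'} ht ht' hh => ?_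
  obtain ⟨⟨htt, h1⟩, h2⟩ := hh
  by_cases hc : t * t' = t' * t
  · exact ((h.1 t ht).cosForm_eq_zero_of_commute (h.1 t' ht') htt hc).le
  · rw [sortLE_iff hω hfull (h.1 t' ht') (h.1 t ht) fun h0 => hc h0.symm, skew_swap, h1] at h2
    linarith

theorem IsFactorization.acute_of_decreasing (hω : ω.Nodup) (hfull : ∀ i, i ∈ ω) {ts : List W}
    (h : cs.IsFactorization ω ts)
    (hp : ts.Pairwise fun t t' => ¬ cs.SortLE (cs.wordProd ω) t t') :
    ts.Pairwise fun t t' => 0 ≤ M.cosForm (cs.root t) (cs.root t') := by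
  refine ((h.pairwise_skew hω).and hp).imp_of_mem fun {t t'} ht ht' hh => ?_
  obtain ⟨⟨htt, h1⟩, h2⟩ := hh
  by_cases hc : t * t' = t' * t
  · exact ((h.1 t ht).cosForm_eq_zero_of_commute (h.1 t' ht') htt hc).ge
  · rw [sortLE_iff hω hfull (h.1 t ht) (h.1 t' ht') hc, h1] at h2
    linarith

theorem isIncreasingClass_iff (hω : ω.Nodup) (hfull : ∀ i, i ∈ ω)
    {π₀ : cs.MaxChain (cs.wordProd ω)} (hπ₀ : π₀.reflWord = ω.map cs.simple)
    (C : cs.CommClass (cs.wordProd ω)) : cs.IsIncreasingClass C ↔ C = cs.commClass π₀ := by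
  constructor
  · rintro ⟨π, rfl, hinc⟩
    have hf := π.isFactorization hω
    refine Quotient.sound ?_
    change CommEquiv π.reflWord π₀.reflWord
    rw [hπ₀]
    exact cs.commEquiv_of_obtuse _ ω _ rfl hω hf (hf.obtuse_of_increasing hω hfull hinc)
  · rintro rfl
    have hf := π₀.isFactorization hω
    obtain ⟨ts', hc, hs⟩ := hf.exists_increasing hω hfull (by
      rw [hπ₀, List.pairwise_map]
      refine hω.imp fun {i j} hij => ?_
      rw [root_simple, root_simple]
      exact M.cosForm_simpleRoot_nonpos hij)
    obtain ⟨π, rfl⟩ := (hf.of_commEquiv hc).exists_maxChain hω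
    exact ⟨π, Quotient.sound (CommEquiv.symm hc), hs⟩

theorem existsUnique_decreasing (hω : ω.Nodup) (hfull : ∀ i, i ∈ ω) {u : W}
    (hu : u ∈ cs.plusSet (cs.wordProd ω)) :
    ∃! D : cs.CommClass (cs.wordProd ω),
      D ∈ cs.concordantClasses (cs.wordProd ω) u ∧ cs.IsDecreasingClass D := by
  obtain ⟨w, hw⟩ := Finite.exists_max cs.length
  have hlen : cs.length (u * cs.wordProd ω) = cs.length u + ω.length := by
    rw [← length_wordProd_of_nodup (cs := cs) hω]
    exact hu
  obtain ⟨ts, hts, huniq⟩ := exists_isAcuteUp (cs := cs) (cs.length w) hw ω.length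
    (cs.length w) ω u (by omega) rfl hω hlen
  obtain ⟨π, hπ⟩ := hts.fact.exists_maxChain hω
  obtain ⟨ts', hc, hs⟩ := hts.fact.exists_decreasing hω hfull hts.acute
  obtain ⟨π', rfl⟩ := (hts.fact.of_commEquiv hc).exists_maxChain hω
  refine ⟨cs.commClass π, ⟨⟨π, rfl, ?_⟩, π', Quotient.sound ?_, hs⟩, ?_⟩
  · rw [π.concordant_iff hω hu, hπ]
    exact hts.up
  · change CommEquiv π'.reflWord π.reflWord
    rw [hπ]
    exact hc.symm
  · rintro D ⟨⟨σ, rfl, hσ⟩, σ', hσσ', hdec⟩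
    have hcomm : CommEquiv σ'.reflWord σ.reflWord := Quotient.exact hσσ'
    -- The class contains a concordant chain `σ` and a decreasing chain `σ'`, possibly different.
    -- The angle condition does not depend on the order of the letters and passes from `σ'` to `σ`.
    have hacute := (σ'.isFactorization hω).acute_of_decreasing hω hfull hdec
    refine Quotient.sound ?_
    change CommEquiv σ.reflWord π.reflWord
    rw [hπ]
    refine huniq _ ⟨σ.isFactorization hω, (σ.concordant_iff hω hu).mp hσ, ?_⟩
    exact cs.pairwise_cosForm_perm (p := fun a => 0 ≤ a) hcomm.perm hacute

end Coxeter

end CoxeterSystem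

theorem theorem1p4 {B W : Type*} [Group W] [Finite W] {M : CoxeterMatrix B}
    (cs : CoxeterSystem M W) (c : W) (hc : cs.IsStandardCoxeterElement c) :
    ∃ I : cs.CommClass c,
      (∀ C : cs.CommClass c, cs.IsIncreasingClass C ↔ C = I) ∧
      ∀ u ∈ cs.plusSet c,
        I ∈ cs.concordantClasses c u ∧
        ∃! D : cs.CommClass c, D ∈ cs.concordantClasses c u ∧ cs.IsDecreasingClass D := by
  classical
  obtain ⟨ω, hω, hfull, rfl⟩ := hc
  -- The simple reflections are finite in number because the word for `c` lists them all.
  have : Fintype B := ⟨ω.toFinset, fun i => List.mem_toFinset.mpr (hfull i)⟩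
  obtain ⟨π₀, hπ₀⟩ :=
    (CoxeterSystem.isFactorization_map_simple (cs := cs) rfl rfl).exists_maxChain hω
  refine ⟨cs.commClass π₀, CoxeterSystem.isIncreasingClass_iff hω hfull hπ₀, fun u hu =>
    ⟨⟨π₀, rfl, ?_⟩, CoxeterSystem.existsUnique_decreasing hω hfull hu⟩⟩
  rw [π₀.concordant_iff hω hu, hπ₀]
  refine CoxeterSystem.isUp_map_simple ?_
  rw [← CoxeterSystem.length_wordProd_of_nodup (cs := cs) hω]
  exact hu
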